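/- **Notation.** Let $H^2\subset L^2(\mathbb R)$ be the Hardy space of the upper half-plane $\mathbb C_+$ (functions are identified with their boundary values), $\langle f,g\rangle=\int_{\mathbb R} f\bar g\,dx$, and let $\mathbb P_+$ be the orthogonal projection of $L^2(\mathbb R)$ onto $H^2$. For a finite Blaschke product $\theta(x)=e^{i\alpha}\prod_{j=1}^m\frac{x-a_j}{x-\bar a_j}$, $\operatorname{Im}a_j>0$, put $K_\theta=H^2\cap(\theta H^2)^\perp$, let $P_\theta$ be the orthogonal projection onto $K_\theta$, and let $A_\theta$ be the infinitesimal generator of the semigroup $S_\theta(\tau)f=P_\theta(e^{i\tau x}f)=e^{i\tau A_\theta}f$ on $K_\theta$, i.e. $A_\theta f=\lim_{\tau\to0+}\frac{1}{i\tau}(S_\theta(\tau)f-f)$. A holomorphic function $p$ on $\mathbb C_+$ is an isometric multiplier on $K_\psi$ if $pf\in H^2$ and $\|pf\|=\|f\|$ for all $f\in K_\psi$. Let $u$ be a rational function without poles in the closed upper half-plane, with $u(\infty)=0$, and let $H_uf=\mathbb P_+(u\bar f)$, $f\in H^2$, be its anti-linear Hankel operator. *Spectral data* $(\{\lambda_n\}_{n=1}^N,\{\psi_n\}_{n=1}^N,\{e^{i\varphi_n}\}_{n=1}^N,\{\omega_n\}_{n=1}^N)$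 of $u$ are defined as follows. * $\lambda_1>\dots>\lambda_N>0$ are the singular values of $H_u$, i.e. all $\lambda>0$ with $E(\lambda):=\operatorname{Ker}(H_u^2-\lambda^2)\neq\{0\}$. * $\psi_n$ is a finite Blaschke product with $\psi_n(\infty)=1$ such that $E(\lambda_n)=p_nK_{\psi_n}$ for some isometric multiplier $p_n$ on $K_{\psi_n}$. (Such $\psi_n$ is defined only up to Frostman shifts $\psi\mapsto e^{i\alpha}\frac{w-\psi}{1-\bar w\psi}$, $|w|<1$, $\alpha\in\mathbb R$.) * $|e^{i\varphi_n}|=1$ and $H_uu_n=\lambda_ne^{i\varphi_n}u_n$, where $u_n$ is the orthogonal projection of $u$ onto $E(\lambda_n)$. * $\omega_n=\langle A_\theta u_n,u_n\rangle$, where $\theta$ is the finite Blaschke product with $\theta(\infty)=1$ and $\operatorname{Ran}H_u=K_\theta$. **Theorem.** Let $u$ be a rational function without poles in the closed upper half-plane, with $u(\infty)=0$, and let $(\lambda_n,\psi_n,e^{i\varphi_n},\omega_n)_{n=1}^N$ be spectral data of $u$. Then $\operatorname{Im}\omega_n>0$ for all $n$, and for every $x$ with $\operatorname{Im}x>0$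 the $N\times N$ matrix $Q(x)$ below is invertible and $$u(x)=\frac1{2\pi i}\bigl\langle Q(x)^{-1}D(\lambda)D(e^{-i\varphi})\mathbb 1,\mathbb 1\bigr\rangle_{\mathbb C^N},\qquad Q(x)=\mathcal A^*-xD(\nu^2)^{-1}-D(b(x)).$$ Here $\mathbb 1=(1,\dots,1)^\top$, $D(\alpha)$ is the diagonal matrix with entries $\alpha_1,\dots,\alpha_N$, $\nu_j>0$ is given by $\nu_j^2=\sqrt{4\pi\operatorname{Im}\omega_j}/\lambda_j$, and $$\mathcal A_{kj}=\frac{i}{2\pi}\,\frac{\lambda_j^2-\lambda_j\lambda_ke^{i(\varphi_j-\varphi_k)}}{\lambda_j^2-\lambda_k^2}\quad(j\neq k),\qquad \mathcal A_{jj}=\frac{\omega_j}{4\pi\operatorname{Im}\omega_j},$$ $$b_j(x)=\frac1{\nu_j^2}\left(i\,\frac{\|1-\psi_j\|^2}{4\pi}\,\frac{1+\psi_j(x)}{1-\psi_j(x)}+\frac{\operatorname{Re}\langle A_{\psi_j}(1-\psi_j),1-\psi_j\rangle}{\|1-\psi_j\|^2}-x\right).$$ In particular $u$ is uniquely determined by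 its spectral data: if $v$ is another rational function without poles in the closed upper half-plane, with $v(\infty)=0$, which has spectral data $(\lambda_n,\psi'_n,e^{i\varphi_n},\omega_n)_{n=1}^N$, where each $\psi'_n$ is a Frostman shift of $\psi_n$ (for instance $\psi'_n=\psi_n$), then $v=u$. -/

import Mathlib

open MeasureTheory Filter Topology
open scoped ComplexConjugate ENNReal NNReal

noncomputable section

namespace SzegoHankel

/-- The Hilbert space `L²(ℝ)` of complex valued functions (Lebesgue measure).
Mathlib's `inner ℂ f g` is anti-linear in `f` and linear in `g`, so the inner product `⟨f, g⟩`
which is linear in its first factor is `inner ℂ g f`. -/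
abbrev L2 : Type := Lp ℂ 2 (volume : Measure ℝ)

/-- The element of `L²(ℝ)` represented by a square integrable function
(it is only used for square integrable functions; the value is `0` for all others). -/
def toL2 (f : ℝ → ℂ) : L2 :=
  open Classical in if h : MemLp f 2 volume then h.toLp f else 0

/-- The open upper half-plane. -/
def upper : Set ℂ := {z | 0 < z.im}

/-- `F` belongs to the Hardy class `H²` of the upper half-plane and `f ∈ L²(ℝ)` is its boundary
function: `F` is holomorphic in the open upper half-plane, the norms of `F(· + iy)` in `L²(ℝ)` are
bounded uniformly in `y > 0`, and `F(· + iy) → f` in `L²(ℝ)` as `y → 0+`. -/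
structure HasBoundary (F : ℂ → ℂ) (f : L2) : Prop where
  holo : DifferentiableOn ℂ F upper
  bound : ∃ C : ℝ≥0, ∀ y : ℝ, 0 < y →
    eLpNorm (fun x : ℝ => F (x + y * Complex.I)) 2 volume ≤ C
  lim : Tendsto (fun y : ℝ => eLpNorm (fun x : ℝ => F (x + y * Complex.I) - f x) 2 volume)
    (𝓝[>] 0) (𝓝 0)

theorem aesm_slice {F : ℂ → ℂ} (hF : DifferentiableOn ℂ F upper) {y : ℝ} (hy : 0 < y) :
    AEStronglyMeasurable (fun x : ℝ => F (x + y * Complex.I)) volume := by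
  have hc : Continuous (fun x : ℝ => F (x + y * Complex.I)) := by
    refine hF.continuousOn.comp_continuous (by fun_prop) (fun x => ?_)
    simpa [upper] using hy
  exact hc.aestronglyMeasurable

theorem HasBoundary.zero : HasBoundary 0 0 where
  holo := differentiableOn_const 0
  bound := ⟨0, fun y _ => by simp⟩
  lim := by
    refine tendsto_const_nhds.congr' (Eventually.of_forall fun y => ?_)
    symm
    change eLpNorm (fun x : ℝ => (0 : ℂ) - (0 : L2) x) 2 volume = 0
    rw [eLpNorm_congr_ae (g := (0 : ℝ → ℂ))]
    · simp
    · filter_upwards [Lp.coeFn_zero ℂ 2 (volume : Measure ℝ)] with x hx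
      simp

theorem HasBoundary.add {F G : ℂ → ℂ} {f g : L2} (hF : HasBoundary F f) (hG : HasBoundary G g) :
    HasBoundary (F + G) (f + g) where
  holo := hF.holo.add hG.holo
  bound := by
    obtain ⟨C, hC⟩ := hF.bound
    obtain ⟨D, hD⟩ := hG.bound
    refine ⟨C + D, fun y hy => ?_⟩
    refine (eLpNorm_add_le (aesm_slice hF.holo hy) (aesm_slice hG.holo hy) (by norm_num)).trans ?_
    push_cast
    exact add_le_add (hC y hy) (hD y hy)
  lim := by
    have h0 : Tendsto (fun y : ℝ =>
        eLpNorm (fun x : ℝ => F (x + y * Complex.I) - f x) 2 volume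
        + eLpNorm (fun x : ℝ => G (x + y * Complex.I) - g x) 2 volume) (𝓝[>] 0) (𝓝 0) := by
      simpa using hF.lim.add hG.lim
    refine tendsto_of_tendsto_of_tendsto_of_le_of_le' tendsto_const_nhds h0
      (Eventually.of_forall fun _ => zero_le) ?_
    filter_upwards [self_mem_nhdsWithin] with y hy
    refine le_trans (le_of_eq ?_) (eLpNorm_add_le
      ((aesm_slice hF.holo hy).sub (Lp.aestronglyMeasurable f))
      ((aesm_slice hG.holo hy).sub (Lp.aestronglyMeasurable g)) (by norm_num))
    refine eLpNorm_congr_ae ?_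
    filter_upwards [Lp.coeFn_add f g] with x hx
    rw [hx]
    simp only [Pi.add_apply]
    ring

theorem HasBoundary.smul {F : ℂ → ℂ} {f : L2} (c : ℂ) (hF : HasBoundary F f) :
    HasBoundary (c • F) (c • f) where
  holo := hF.holo.const_smul c
  bound := by
    obtain ⟨C, hC⟩ := hF.bound
    refine ⟨‖c‖₊ * C, fun y hy => ?_⟩
    have h := eLpNorm_const_smul c (fun x : ℝ => F (x + y * Complex.I)) 2 volume
    refine (le_of_eq h).trans ?_
    push_cast
    exact mul_le_mul' (le_of_eq rfl) (hC y hy)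
  lim := by
    have h0 : Tendsto (fun y : ℝ => ‖c‖ₑ *
        eLpNorm (fun x : ℝ => F (x + y * Complex.I) - f x) 2 volume) (𝓝[>] 0) (𝓝 0) := by
      simpa using ENNReal.Tendsto.const_mul hF.lim (Or.inr (by simp))
    refine h0.congr fun y => ?_
    rw [← eLpNorm_const_smul]
    refine eLpNorm_congr_ae ?_
    filter_upwards [Lp.coeFn_smul c f] with x hx
    rw [hx]
    simp only [Pi.smul_apply, smul_eq_mul]
    ring

/-- The Hardy space `H²(ℂ₊)`, identified through boundary values with a subspace of `L²(ℝ)`. -/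
def H2 : Submodule ℂ L2 where
  carrier := {f | ∃ F, HasBoundary F f}
  zero_mem' := ⟨0, HasBoundary.zero⟩
  add_mem' := fun ⟨F, hF⟩ ⟨G, hG⟩ => ⟨F + G, hF.add hG⟩
  smul_mem' := fun c _ ⟨F, hF⟩ => ⟨c • F, hF.smul c⟩

/-- The orthogonal projection in `L²(ℝ)` onto a closed subspace `K`
(for a general subspace this is the projection onto its closure). -/
def orthProj (K : Submodule ℂ L2) : L2 →L[ℂ] L2 := K.topologicalClosure.starProjection

/-! ### Model spaces -/

/-- `θ` is a finite Blaschke product, `θ(x) = e^{iα} ∏ (x - a_j) / (x - conj a_j)` with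
`Im a_j > 0`. -/
def IsFiniteBlaschke (θ : ℂ → ℂ) : Prop :=
  ∃ (α : ℝ) (m : ℕ) (a : Fin m → ℂ), (∀ j, 0 < (a j).im) ∧
    ∀ z, θ z = Complex.exp (α * Complex.I) * ∏ j, (z - a j) / (z - conj (a j))

/-- A finite Blaschke product normalised by `θ(∞) = 1`. -/
structure IsNormalizedBlaschke (θ : ℂ → ℂ) : Prop where
  blaschke : IsFiniteBlaschke θ
  at_infty : Tendsto θ (Bornology.cobounded ℂ) (𝓝 1)

/-- The model space `K_θ = H² ∩ (θ H²)^⊥`. -/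
def modelSpace (θ : ℂ → ℂ) : Submodule ℂ L2 :=
  H2 ⊓ (Submodule.span ℂ ((fun f : L2 => toL2 (fun x => θ x * f x)) '' (H2 : Set L2)))ᗮ

/-- The Beurling-Lax semigroup `S_θ(τ) f = P_θ (e^{iτx} f)` on `K_θ`. -/
def semigroup (θ : ℂ → ℂ) (τ : ℝ) (f : L2) : L2 :=
  orthProj (modelSpace θ) (toL2 (fun x => Complex.exp (Complex.I * τ * x) * f x))

/-- The infinitesimal generator `A_θ` of `S_θ(τ) = e^{iτ A_θ}`, i.e.
`A_θ f = lim_{τ → 0+} (S_θ(τ) f - f) / (iτ)` for `f ∈ K_θ`.  For a finite Blaschke product `θ` the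
space `K_θ` has finite dimension, and the limit exists for all `f ∈ K_θ`. -/
def generator (θ : ℂ → ℂ) (f : L2) : L2 :=
  limUnder (𝓝[>] (0 : ℝ)) (fun τ : ℝ => (Complex.I * τ)⁻¹ • (semigroup θ τ f - f))

/-- `g = p f` for `f, g ∈ H²`, the product being taken in the upper half-plane. -/
def IsProduct (p : ℂ → ℂ) (f g : L2) : Prop :=
  ∃ F, HasBoundary F f ∧ HasBoundary (fun z => p z * F z) g

/-- `p` is an isometric multiplier on `K_ψ`: it is holomorphic in the upper half-plane, and for
every `f ∈ K_ψ` one has `p f ∈ H²` and `‖p f‖ = ‖f‖`. -/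
structure IsIsometricMultiplier (p ψ : ℂ → ℂ) : Prop where
  holo : DifferentiableOn ℂ p upper
  isom : ∀ f ∈ modelSpace ψ, ∃ g, IsProduct p f g ∧ ‖g‖ = ‖f‖

/-- The set `p K_ψ = {p f : f ∈ K_ψ}`. -/
def multSpace (p ψ : ℂ → ℂ) : Set L2 := {g | ∃ f ∈ modelSpace ψ, IsProduct p f g}

/-- `ψ'` is obtained from `ψ` by a Frostman shift,
`ψ' = e^{iα} (w - ψ) / (1 - conj w ψ)` in the upper half-plane, with `|w| < 1`. -/
def IsFrostmanShift (ψ ψ' : ℂ → ℂ) : Prop :=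
  ∃ (w : ℂ) (α : ℝ), ‖w‖ < 1 ∧
    ∀ z ∈ upper, ψ' z = Complex.exp (α * Complex.I) * ((w - ψ z) / (1 - conj w * ψ z))

/-! ### Hankel operators -/

/-- The values of a rational function. -/
def ratEval (u : RatFunc ℂ) (z : ℂ) : ℂ := u.eval (RingHom.id ℂ) z

/-- A rational symbol without poles in the closed upper half-plane, with `u(∞) = 0`. -/
structure IsSymbol (u : RatFunc ℂ) : Prop where
  no_poles : ∀ z : ℂ, 0 ≤ z.im → u.denom.eval z ≠ 0
  at_infty : Tendsto (ratEval u) (Bornology.cobounded ℂ) (𝓝 0)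

/-- The anti-linear Hankel operator `H_u f = P₊ (u conj f)`, `f ∈ H²`. -/
def hankel (u : RatFunc ℂ) (f : L2) : L2 :=
  orthProj H2 (toL2 (fun x => ratEval u x * conj (f x)))

/-- The Schmidt subspace `E(s) = Ker (H_u² - s²)` in `H²`.  (The set under the span is already a
linear subspace.) -/
def schmidt (u : RatFunc ℂ) (s : ℝ) : Submodule ℂ L2 :=
  Submodule.span ℂ {f | f ∈ H2 ∧ hankel u (hankel u f) = ((s : ℂ) ^ 2) • f}

/-- The orthogonal projection of `u`, as an element of `H²`, onto the Schmidt subspace `E(s)`. -/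
def symbolProj (u : RatFunc ℂ) (s : ℝ) : L2 :=
  orthProj (schmidt u s) (toL2 (fun x => ratEval u x))

/-- `(λ_n, ψ_n, e^{iφ_n}, ω_n)` are spectral data of the rational symbol `u`.  The `ψ_n` are
representatives of their orbits under Frostman shifts. -/
structure IsSpectralData (u : RatFunc ℂ) {N : ℕ} (lam : Fin N → ℝ) (ψ : Fin N → ℂ → ℂ)
    (e : Fin N → Circle) (ω : Fin N → ℂ) : Prop where
  /-- `λ_1 > ... > λ_N` -/
  anti : StrictAnti lam
  /-- the `λ_n` are exactly the singular values of `H_u` -/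
  singular : ∀ s : ℝ, (∃ n, lam n = s) ↔ (0 < s ∧ schmidt u s ≠ ⊥)
  blaschke : ∀ n, IsNormalizedBlaschke (ψ n)
  /-- the Schmidt subspaces are `p_n K_{ψ_n}` with isometric multipliers `p_n` -/
  model : ∀ n, ∃ p, IsIsometricMultiplier p (ψ n) ∧
    (schmidt u (lam n) : Set L2) = multSpace p (ψ n)
  /-- `H_u u_n = λ_n e^{iφ_n} u_n` -/
  phase : ∀ n, hankel u (symbolProj u (lam n)) =
    ((lam n : ℂ) * (e n : ℂ)) • symbolProj u (lam n)
  /-- `ω_n = ⟨A_θ u_n, u_n⟩`, where `Ran H_u = K_θ` and `θ(∞) = 1` -/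
  moment : ∃ θ : ℂ → ℂ, IsNormalizedBlaschke θ ∧
    hankel u '' (H2 : Set L2) = (modelSpace θ : Set L2) ∧
    ∀ n, ω n = inner ℂ (symbolProj u (lam n)) (generator θ (symbolProj u (lam n)))

/-! ### The matrices built from the spectral data -/

variable {N : ℕ}

/-- `ν²`, determined by `λ` and `ω` through `4π Im ω = λ² ν⁴`. -/
def nuSq (l : ℝ) (w : ℂ) : ℝ := Real.sqrt (4 * Real.pi * w.im) / l

/-- The vector `1 - ψ ∈ K_ψ`. -/
def oneSub (ψ : ℂ → ℂ) : L2 := toL2 (fun x => 1 - ψ x)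

/-- The function `b(x)` built from one quadruple of the data. -/
def bFun (l : ℝ) (ψ : ℂ → ℂ) (w : ℂ) (x : ℂ) : ℂ :=
  (1 / (nuSq l w : ℂ)) *
    (Complex.I * ((‖oneSub ψ‖ ^ 2 / (4 * Real.pi) : ℝ) : ℂ) * ((1 + ψ x) / (1 - ψ x))
      + (((inner ℂ (oneSub ψ) (generator ψ (oneSub ψ))).re / ‖oneSub ψ‖ ^ 2 : ℝ) : ℂ) - x)

/-- The matrix `𝒜`. -/
def matA (lam : Fin N → ℝ) (e : Fin N → Circle) (ω : Fin N → ℂ) : Matrix (Fin N) (Fin N) ℂ :=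
  Matrix.of fun k j =>
    if j = k then ω j / (4 * Real.pi * (ω j).im)
    else Complex.I / (2 * Real.pi) *
      (((lam j : ℂ) ^ 2 - lam j * lam k * ((e j : ℂ) * conj (e k : ℂ)))
        / ((lam j : ℂ) ^ 2 - (lam k : ℂ) ^ 2))

/-- The matrix `Q(x) = 𝒜* - x D(ν²)⁻¹ - D(b(x))`. -/
def matQ (lam : Fin N → ℝ) (ψ : Fin N → ℂ → ℂ) (e : Fin N → Circle) (ω : Fin N → ℂ) (x : ℂ) :
    Matrix (Fin N) (Fin N) ℂ :=
  (matA lam e ω).conjTranspose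
    - x • (Matrix.diagonal fun n => (nuSq (lam n) (ω n) : ℂ))⁻¹
    - Matrix.diagonal fun n => bFun (lam n) (ψ n) (ω n) x

/-- `(2πi)⁻¹ ⟨Q(x)⁻¹ D(λ) D(e^{-iφ}) 𝟙, 𝟙⟩`, with the inner product of `ℂ^N`. -/
def symbolFormula (lam : Fin N → ℝ) (ψ : Fin N → ℂ → ℂ) (e : Fin N → Circle) (ω : Fin N → ℂ)
    (x : ℂ) : ℂ :=
  (2 * Real.pi * Complex.I)⁻¹ *
    (((matQ lam ψ e ω x)⁻¹ * Matrix.diagonal (fun n => (lam n : ℂ)) *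
      Matrix.diagonal (fun n => conj (e n : ℂ))).mulVec (1 : Fin N → ℂ) ⬝ᵥ star (1 : Fin N → ℂ))

end SzegoHankel

end

/-! Write `q = 1 - θ` and let `A*` be the adjoint of `A_θ`, that is `f ↦ x f - c_f` on `K_θ`, where
`c_f = (i/2π)⟨f, q⟩` is the coefficient of `1/x` at infinity. Evaluating `(A* - z) g = f` at the
point `z` gives `f(z) = -c_g`, so `u(z) = (2πi)⁻¹ ⟨(A* - z)⁻¹ u, q⟩`
(`ext_eq_of_backShift_sub_smul`). The theorem computes this resolvent in the orthogonal
decomposition of `K_θ = Ran H_u` into the Schmidt subspaces `E(λ_n)`.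

Let `q_n` be the projection of `q` onto `E(λ_n)`. Since `H_u q = u`, one has `u_n = H_u q_n = λ_n
e^{-iφ_n} q_n`, and `ν_n² = ‖q_n‖²`. Two relations govern everything: `A - A* = (i/2π)⟨·, q⟩ q`, and
`H_u A = A* H_u` (`hankel_generator`). Together they show that every off-diagonal block of `A*` is a
multiple of `⟨·, q_n⟩ q_k`, with the coefficient found in `𝒜*` (`inner_generator_schmidt`), and that
`A*` maps the part of `E(λ_n)` orthogonal to `q` into `E(λ_n)` (`backShift_mem_schmidt`).

For the diagonal blocks, multiplication by `p_n` is a unitary map from `K_{ψ_n}` onto `E(λ_n)`. On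
vectors without `1/x` term both backward shifts are multiplication by `x`, so this map intertwines
them on the complement of `q_n`; the diagonal block is therefore a model operator plus a rank one
term along `q_n`. Its resolvent applied to `q_n` is explicit (`exists_resolvent_vector`), and this
is where `b_n` comes from.

The outcome is a vector `h_n ∈ E(λ_n)` with `⟨h_n, q⟩ = 1` and `(A* - z) h_n = ∑_k Q_{kn}(z) q_k`
(`exists_matQ_vector`). As `u = ∑ λ_n e^{-iφ_n} q_n`, solving `(A* - z) G = u` with `G = ∑ X_n h_n`
is the linear system for `Q(z)`, and `⟨G, q⟩ = ∑ X_n`. The matrix is invertible because `A*` has no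
eigenvalue in the upper half-plane.

For uniqueness, `ψ_n` enters only through `b_n`. A Frostman shift changes `1/(1 - ψ)` by an affine
map, and the normalisation of `b_n` at infinity leaves no freedom (`herglotzFun_frostman`). -/

namespace SzegoHankel

/-! ### From functions to elements of `L²(ℝ)`, shifting horizontal contours, Cauchy kernels. -/

section SquareIntegrable

/-! ### Square integrable functions -/

theorem coe_toL2 {f : ℝ → ℂ} (hf : MemLp f 2 volume) : toL2 f =ᵐ[volume] f := by
  rw [toL2, dif_pos hf]
  exact hf.coeFn_toLp

theorem memLp_coe (f : L2) : MemLp f 2 volume := Lp.memLp f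

@[simp] theorem toL2_coe (f : L2) : toL2 (fun x => f x) = f := by
  rw [toL2, dif_pos (memLp_coe f)]
  exact Lp.toLp_coeFn f _

theorem toL2_congr {f g : ℝ → ℂ} (h : f =ᵐ[volume] g) : toL2 f = toL2 g := by
  by_cases hf : MemLp f 2 volume
  · have hg : MemLp g 2 volume := (memLp_congr_ae h).1 hf
    rw [toL2, toL2, dif_pos hf, dif_pos hg]
    exact MemLp.toLp_congr hf hg h
  · have hg : ¬ MemLp g 2 volume := fun hg => hf ((memLp_congr_ae h).2 hg)
    rw [toL2, toL2, dif_neg hf, dif_neg hg]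

theorem toL2_eq {f : ℝ → ℂ} {g : L2} (h : f =ᵐ[volume] g) : toL2 f = g := by
  rw [toL2_congr h]
  exact toL2_coe g

theorem toL2_add {f g : ℝ → ℂ} (hf : MemLp f 2 volume) (hg : MemLp g 2 volume) :
    toL2 (fun x => f x + g x) = toL2 f + toL2 g := by
  refine toL2_eq ?_
  filter_upwards [coe_toL2 hf, coe_toL2 hg, Lp.coeFn_add (toL2 f) (toL2 g)] with x h1 h2 h3
  rw [h3, Pi.add_apply, h1, h2]

theorem toL2_const_mul (c : ℂ) {f : ℝ → ℂ} (hf : MemLp f 2 volume) :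
    toL2 (fun x => c * f x) = c • toL2 f := by
  refine toL2_eq ?_
  filter_upwards [coe_toL2 hf, Lp.coeFn_smul c (toL2 f)] with x h1 h3
  rw [h3, Pi.smul_apply, h1, smul_eq_mul]

theorem norm_toL2 {f : ℝ → ℂ} (hf : MemLp f 2 volume) :
    ‖toL2 f‖ = (eLpNorm f 2 volume).toReal := by
  rw [Lp.norm_def, eLpNorm_congr_ae (coe_toL2 hf)]

theorem inner_eq_integral (f g : L2) : inner ℂ f g = ∫ x, conj (f x) * g x := by
  rw [L2.inner_def]
  refine integral_congr_ae (Eventually.of_forall fun x => ?_)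
  simp [mul_comm]

theorem integrable_mul_of_memLp {f g : ℝ → ℂ} (hf : MemLp f 2 volume) (hg : MemLp g 2 volume) :
    Integrable (fun x => f x * g x) := hf.integrable_mul hg

theorem memLp_conj {f : ℝ → ℂ} (hf : MemLp f 2 volume) :
    MemLp (fun x => conj (f x)) 2 volume := by
  refine ⟨Complex.continuous_conj.comp_aestronglyMeasurable hf.1, ?_⟩
  rw [eLpNorm_congr_norm_ae (g := f) (Eventually.of_forall fun x => by simp)]
  exact hf.2

theorem inner_toL2_left {f : ℝ → ℂ} (hf : MemLp f 2 volume) (g : L2) :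
    inner ℂ (toL2 f) g = ∫ x, conj (f x) * g x := by
  rw [inner_eq_integral]
  refine integral_congr_ae ?_
  filter_upwards [coe_toL2 hf] with x hx
  rw [hx]

theorem inner_toL2_right (f : L2) {g : ℝ → ℂ} (hg : MemLp g 2 volume) :
    inner ℂ f (toL2 g) = ∫ x, conj (f x) * g x := by
  rw [inner_eq_integral]
  refine integral_congr_ae ?_
  filter_upwards [coe_toL2 hg] with x hx
  rw [hx]

theorem inner_toL2_toL2 {f g : ℝ → ℂ} (hf : MemLp f 2 volume) (hg : MemLp g 2 volume) :
    inner ℂ (toL2 f) (toL2 g) = ∫ x, conj (f x) * g x := by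
  rw [inner_toL2_left hf]
  refine integral_congr_ae ?_
  filter_upwards [coe_toL2 hg] with x hx
  rw [hx]

/-! ### Integrals over horizontal lines -/

theorem mem_upper {z : ℂ} : z ∈ upper ↔ 0 < z.im := Iff.rfl

theorem isOpen_upper : IsOpen upper := isOpen_lt continuous_const Complex.continuous_im

theorem line_mem_upper (x : ℝ) {y : ℝ} (hy : 0 < y) : (x + y * Complex.I : ℂ) ∈ upper := by
  simpa [upper] using hy

theorem continuous_slice {F : ℂ → ℂ} (hF : DifferentiableOn ℂ F upper) {y : ℝ} (hy : 0 < y) :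
    Continuous (fun x : ℝ => F (x + y * Complex.I)) :=
  hF.continuousOn.comp_continuous (by fun_prop) (fun x => line_mem_upper x hy)

/-- Fubini on the strip makes the integral of `Φ` over the vertical segment above `x` an integrable
function of `x`. This takes the place of pointwise decay on the vertical sides of rectangles. -/
theorem integrable_slice_prod {Φ : ℂ → ℂ} (hΦ : DifferentiableOn ℂ Φ upper) {a b : ℝ} (ha : 0 < a)
    {C : ℝ≥0} (hC : ∀ y ∈ Set.Icc a b, ∫⁻ x : ℝ, ‖Φ (x + y * Complex.I)‖ₑ ≤ C) :
    Integrable (fun p : ℝ × ℝ => Φ (p.1 + p.2 * Complex.I))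
      (volume.prod (volume.restrict (Set.Icc a b))) := by
  have hmeas : AEStronglyMeasurable (fun p : ℝ × ℝ => Φ (p.1 + p.2 * Complex.I))
      (volume.prod (volume.restrict (Set.Icc a b))) := by
    have : (volume : Measure ℝ).prod (volume.restrict (Set.Icc a b))
        = (volume.prod volume).restrict (Set.univ ×ˢ Set.Icc a b) := by
      rw [← Measure.prod_restrict, Measure.restrict_univ]
    rw [this]
    refine ContinuousOn.aestronglyMeasurable ?_ (MeasurableSet.univ.prod measurableSet_Icc)
    refine hΦ.continuousOn.comp (by fun_prop) ?_
    rintro ⟨x, y⟩ ⟨-, hy⟩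
    exact line_mem_upper x (ha.trans_le hy.1)
  refine ⟨hmeas, ?_⟩
  rw [hasFiniteIntegral_iff_enorm, lintegral_prod_symm _ hmeas.enorm]
  refine lt_of_le_of_lt (setLIntegral_mono measurable_const hC) ?_
  simp only [lintegral_const, Measure.restrict_apply_univ]
  exact ENNReal.mul_lt_top ENNReal.coe_lt_top (by simp)

theorem integrable_slice_of_lintegral {Φ : ℂ → ℂ} (hΦ : DifferentiableOn ℂ Φ upper) {y : ℝ}
    (hy : 0 < y) {C : ℝ≥0} (hC : ∫⁻ x : ℝ, ‖Φ (x + y * Complex.I)‖ₑ ≤ C) :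
    Integrable (fun x : ℝ => Φ (x + y * Complex.I)) :=
  ⟨aesm_slice hΦ hy, lt_of_le_of_lt hC ENNReal.coe_lt_top⟩

/-- Cauchy's theorem for a strip. -/
theorem integral_line_eq {Φ : ℂ → ℂ} (hΦ : DifferentiableOn ℂ Φ upper) {a b : ℝ} (ha : 0 < a)
    (hab : a ≤ b) {C : ℝ≥0}
    (hC : ∀ y ∈ Set.Icc a b, ∫⁻ x : ℝ, ‖Φ (x + y * Complex.I)‖ₑ ≤ C) :
    ∫ x : ℝ, Φ (x + a * Complex.I) = ∫ x : ℝ, Φ (x + b * Complex.I) := by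
  have hia := integrable_slice_of_lintegral hΦ ha (hC a ⟨le_rfl, hab⟩)
  have hib := integrable_slice_of_lintegral hΦ (ha.trans_le hab) (hC b ⟨hab, le_rfl⟩)
  -- Up to the factor `i`, `V x` is the integral over the vertical side at abscissa `x`.
  set V : ℝ → ℂ := fun x => ∫ y in Set.Icc a b, Φ (x + y * Complex.I) with hV
  have hVint : Integrable V := (integrable_slice_prod hΦ ha hC).integral_prod_left
  have hVint' : Integrable (fun R => Complex.I • V (-R) - Complex.I • V R) :=
    (hVint.comp_neg.smul Complex.I).sub (hVint.smul Complex.I)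
  have hlim : Tendsto (fun R : ℝ => (∫ x in (-R)..R, Φ (x + a * Complex.I))
      - ∫ x in (-R)..R, Φ (x + b * Complex.I)) atTop
      (𝓝 ((∫ x : ℝ, Φ (x + a * Complex.I)) - ∫ x : ℝ, Φ (x + b * Complex.I))) :=
    (intervalIntegral_tendsto_integral hia tendsto_neg_atTop_atBot tendsto_id).sub
      (intervalIntegral_tendsto_integral hib tendsto_neg_atTop_atBot tendsto_id)
  have heq : ∀ R : ℝ, (∫ x in (-R)..R, Φ (x + a * Complex.I))
      - (∫ x in (-R)..R, Φ (x + b * Complex.I)) = Complex.I • V (-R) - Complex.I • V R := by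
    intro R
    have h := Complex.integral_boundary_rect_eq_zero_of_differentiableOn Φ
      (-R + a * Complex.I : ℂ) (R + b * Complex.I : ℂ) (hΦ.mono ?_)
    · simp only [Complex.add_re, Complex.neg_re, Complex.ofReal_re, Complex.mul_re, Complex.I_re,
        mul_zero, Complex.ofReal_im, Complex.I_im, mul_one, sub_self, add_zero, Complex.add_im,
        Complex.neg_im, neg_zero, Complex.mul_im, zero_add] at h
      rw [intervalIntegral.integral_of_le hab, intervalIntegral.integral_of_le hab,
        ← integral_Icc_eq_integral_Ioc, ← integral_Icc_eq_integral_Ioc] at h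
      simp only [hV]
      linear_combination h
    · rintro z ⟨-, hz⟩
      simp only [Set.mem_preimage] at hz
      have h1 : a ≤ z.im := by
        have := hz.1
        simpa [hab] using this
      exact ha.trans_le h1
  simp_rw [heq] at hlim
  -- The contribution of the vertical sides has a limit as `R → ∞` and is integrable in `R`, so the
  -- limit can only be `0`.
  have h0 := IntegrableAtFilter.eq_zero_of_tendsto (l := atTop) (μ := volume)
    ⟨Set.univ, univ_mem, hVint'.integrableOn⟩ (fun s hs => by
      obtain ⟨c, hc⟩ := mem_atTop_sets.1 hs
      exact top_unique (by
        calc (⊤ : ℝ≥0∞) = volume (Set.Ici c) := by simp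
          _ ≤ volume s := measure_mono hc)) hlim
  exact sub_eq_zero.1 h0

/-! ### The Cauchy kernels -/

theorem lintegral_mul_le {f g : ℝ → ℂ} (hf : AEStronglyMeasurable f volume)
    (hg : AEStronglyMeasurable g volume) :
    ∫⁻ x, ‖f x * g x‖ₑ ≤ eLpNorm f 2 volume * eLpNorm g 2 volume := by
  have h := eLpNorm_smul_le_mul_eLpNorm (p := 2) (q := 2) (r := 1) hg hf
  rw [eLpNorm_one_eq_lintegral_enorm] at h
  simpa using h

theorem ne_of_im_pos_of_im_neg {z r : ℂ} (hz : 0 ≤ z.im) (hr : r.im < 0) : z - r ≠ 0 := by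
  intro h
  rw [sub_eq_zero.1 h] at hz
  linarith

theorem integrable_inv_sq_add_sq (x₀ : ℝ) {s : ℝ} (hs : 0 < s) :
    Integrable (fun x : ℝ => ((x - x₀) ^ 2 + s ^ 2)⁻¹) ∧
      ∫ x : ℝ, ((x - x₀) ^ 2 + s ^ 2)⁻¹ = Real.pi / s := by
  have h : (fun x : ℝ => ((x - x₀) ^ 2 + s ^ 2)⁻¹)
      = fun x : ℝ => (fun t : ℝ => (s ^ 2)⁻¹ * (1 + (t / s) ^ 2)⁻¹) (x - x₀) := by
    funext x
    field_simp
    ring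
  rw [h]
  constructor
  · exact (((integrable_inv_one_add_sq.comp_div hs.ne').const_mul _).comp_sub_right x₀)
  · rw [integral_sub_right_eq_self (fun t : ℝ => (s ^ 2)⁻¹ * (1 + (t / s) ^ 2)⁻¹) x₀,
      integral_const_mul, Measure.integral_comp_div (fun t : ℝ => (1 + t ^ 2)⁻¹) s,
      integral_univ_inv_one_add_sq, abs_of_pos hs, smul_eq_mul]
    field_simp

theorem normSq_line_sub (x : ℝ) (w : ℂ) : ‖(x - w : ℂ)‖ ^ 2 = (x - w.re) ^ 2 + w.im ^ 2 := by
  rw [← Complex.normSq_eq_norm_sq, Complex.normSq_apply]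
  simp
  ring

/-- The function `x ↦ 1 / (x - w)` on the real line. -/
noncomputable def kernelFun (w : ℂ) : ℝ → ℂ := fun x => 1 / (x - w)

theorem norm_kernelFun_sq (w : ℂ) (x : ℝ) :
    ‖kernelFun w x‖ ^ 2 = ((x - w.re) ^ 2 + |w.im| ^ 2)⁻¹ := by
  rw [kernelFun, one_div, norm_inv, inv_pow, normSq_line_sub, sq_abs]

theorem continuous_kernelFun {w : ℂ} (hw : w.im ≠ 0) : Continuous (kernelFun w) := by
  refine continuous_const.div (by fun_prop) fun x h => hw ?_
  rw [← sub_eq_zero.1 h]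
  simp

theorem memLp_kernelFun {w : ℂ} (hw : w.im ≠ 0) : MemLp (kernelFun w) 2 volume := by
  rw [memLp_two_iff_integrable_sq_norm (continuous_kernelFun hw).aestronglyMeasurable]
  refine (integrable_inv_sq_add_sq w.re (abs_pos.2 hw)).1.congr (Eventually.of_forall fun x => ?_)
  exact (norm_kernelFun_sq w x).symm

theorem norm_toL2_kernelFun_sq {w : ℂ} (hw : w.im ≠ 0) :
    ‖toL2 (kernelFun w)‖ ^ 2 = Real.pi / |w.im| := by
  have h := norm_sq_eq_re_inner (𝕜 := ℂ) (toL2 (kernelFun w))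
  rw [inner_toL2_toL2 (memLp_kernelFun hw) (memLp_kernelFun hw)] at h
  have h2 : ∫ x : ℝ, conj (kernelFun w x) * kernelFun w x
      = ((∫ x : ℝ, ((x - w.re) ^ 2 + |w.im| ^ 2)⁻¹ : ℝ) : ℂ) := by
    rw [← integral_complex_ofReal]
    congr 1
    funext x
    rw [mul_comm, Complex.mul_conj, Complex.normSq_eq_norm_sq, norm_kernelFun_sq]
  rw [h, h2, (integrable_inv_sq_add_sq w.re (abs_pos.2 hw)).2]
  simp

theorem eLpNorm_kernelFun {w : ℂ} (hw : w.im ≠ 0) :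
    eLpNorm (kernelFun w) 2 volume = ENNReal.ofReal (Real.sqrt (Real.pi / |w.im|)) := by
  rw [← norm_toL2_kernelFun_sq hw, Real.sqrt_sq (norm_nonneg _), norm_toL2 (memLp_kernelFun hw),
    ENNReal.ofReal_toReal (memLp_kernelFun hw).2.ne]

theorem eLpNorm_kernelFun_le {w r : ℂ} (hr : r.im < 0) (hw : w.im ≤ r.im) :
    eLpNorm (kernelFun w) 2 volume ≤ ENNReal.ofReal (Real.sqrt (Real.pi / |r.im|)) := by
  rw [eLpNorm_kernelFun (by linarith)]
  refine ENNReal.ofReal_le_ofReal (Real.sqrt_le_sqrt ?_)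
  refine div_le_div_of_nonneg_left Real.pi_pos.le (abs_pos.2 hr.ne) ?_
  rw [abs_of_neg hr, abs_of_neg (by linarith)]
  linarith

theorem kernel_slice (r : ℂ) (y : ℝ) :
    (fun x : ℝ => 1 / ((x + y * Complex.I : ℂ) - r)) = kernelFun (r - y * Complex.I) := by
  funext x
  rw [kernelFun]
  ring

theorem hasBoundary_kernel {r : ℂ} (hr : r.im < 0) :
    HasBoundary (fun z => 1 / (z - r)) (toL2 (kernelFun r)) where
  holo := by
    refine (differentiableOn_const 1).div (by fun_prop) fun z hz => ?_
    exact ne_of_im_pos_of_im_neg (mem_upper.1 hz).le hr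
  bound := by
    refine ⟨(Real.sqrt (Real.pi / |r.im|)).toNNReal, fun y hy => ?_⟩
    rw [kernel_slice]
    exact eLpNorm_kernelFun_le hr (by simp [hy.le])
  lim := by
    have h0 : Tendsto (fun y : ℝ => ENNReal.ofReal (y / |r.im|) * eLpNorm (kernelFun r) 2 volume)
        (𝓝[>] 0) (𝓝 0) := by
      have : Tendsto (fun y : ℝ => ENNReal.ofReal (y / |r.im|)) (𝓝[>] 0) (𝓝 0) := by
        have h1 : Tendsto (fun y : ℝ => ENNReal.ofReal (y / |r.im|)) (𝓝 0)
            (𝓝 (ENNReal.ofReal (0 / |r.im|))) :=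
          (ENNReal.continuous_ofReal.comp (continuous_id.div_const _)).tendsto 0
        rw [zero_div, ENNReal.ofReal_zero] at h1
        exact h1.mono_left nhdsWithin_le_nhds
      simpa using ENNReal.Tendsto.mul_const this (Or.inr (memLp_kernelFun hr.ne).2.ne)
    refine tendsto_of_tendsto_of_tendsto_of_le_of_le' tendsto_const_nhds h0
      (Eventually.of_forall fun _ => zero_le) ?_
    filter_upwards [self_mem_nhdsWithin] with y hy
    have hy : 0 < y := hy
    rw [← eLpNorm_norm (kernelFun r)]
    have hsm := eLpNorm_const_smul (y / |r.im| : ℝ) (fun x => ‖kernelFun r x‖) 2 volume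
    rw [Real.enorm_eq_ofReal (by positivity)] at hsm
    rw [← hsm]
    refine eLpNorm_mono_ae ?_
    filter_upwards [coe_toL2 (memLp_kernelFun hr.ne)] with x hx
    rw [hx, kernelFun]
    have h1 : (x + y * Complex.I : ℂ) - r ≠ 0 := ne_of_im_pos_of_im_neg (by simpa using hy.le) hr
    have h2 : (x : ℂ) - r ≠ 0 := ne_of_im_pos_of_im_neg (by simp) hr
    -- The difference is `1/(x - r)` times a factor of modulus at most `y/|Im r|`, which makes the
    -- convergence linear in `y`.
    have h3 : 1 / ((x + y * Complex.I : ℂ) - r) - 1 / ((x : ℂ) - r)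
        = -(y * Complex.I) / ((x + y * Complex.I : ℂ) - r) * (1 / ((x : ℂ) - r)) := by
      field_simp
      ring
    rw [h3, norm_mul]
    simp only [Pi.smul_apply, smul_eq_mul, norm_mul, norm_norm]
    refine mul_le_mul_of_nonneg_right ?_ (norm_nonneg _)
    rw [norm_div, norm_neg, norm_mul, Complex.norm_I, mul_one, Complex.norm_real, norm_div,
      Real.norm_eq_abs, Real.norm_eq_abs, abs_abs]
    refine div_le_div_of_nonneg_left (abs_nonneg _) (abs_pos.2 hr.ne) ?_
    refine le_trans ?_ (Complex.abs_im_le_norm _)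
    rw [abs_of_neg hr, abs_of_pos (by simp; linarith)]
    simp
    linarith

end SquareIntegrable

/-! ### The Hardy space: Cauchy's theorem on the boundary and bounded multipliers. -/

section Hardy

/-! ### Cauchy's theorem in the Hardy space -/

theorem HasBoundary.memLp_slice {F : ℂ → ℂ} {f : L2} (hF : HasBoundary F f) {y : ℝ} (hy : 0 < y) :
    MemLp (fun x : ℝ => F (x + y * Complex.I)) 2 volume := by
  obtain ⟨C, hC⟩ := hF.bound
  exact ⟨aesm_slice hF.holo hy, (hC y hy).trans_lt ENNReal.coe_lt_top⟩

theorem HasBoundary.mem_H2 {F : ℂ → ℂ} {f : L2} (hF : HasBoundary F f) : f ∈ H2 := ⟨F, hF⟩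

/-- Cauchy–Schwarz applied to `FG - fg = (F - f)G + f(G - g)` turns `L²` convergence of the factors
into `L¹` convergence of the product. -/
theorem HasBoundary.tendsto_integral_mul {F G : ℂ → ℂ} {f g : L2} (hF : HasBoundary F f)
    (hG : HasBoundary G g) :
    Tendsto (fun y : ℝ => ∫ x : ℝ, F (x + y * Complex.I) * G (x + y * Complex.I)) (𝓝[>] 0)
      (𝓝 (∫ x, f x * g x)) := by
  refine tendsto_integral_of_L1 _ (integrable_mul_of_memLp (memLp_coe f) (memLp_coe g)).1 ?_ ?_
  · filter_upwards [self_mem_nhdsWithin] with y hy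
    exact integrable_mul_of_memLp (hF.memLp_slice hy) (hG.memLp_slice hy)
  · obtain ⟨C, hC⟩ := hG.bound
    have h0 : Tendsto (fun y : ℝ =>
        eLpNorm (fun x : ℝ => F (x + y * Complex.I) - f x) 2 volume * C
          + eLpNorm f 2 volume * eLpNorm (fun x : ℝ => G (x + y * Complex.I) - g x) 2 volume)
        (𝓝[>] 0) (𝓝 0) := by
      have h1 := ENNReal.Tendsto.mul_const (b := (C : ℝ≥0∞)) hF.lim (Or.inr ENNReal.coe_ne_top)
      have h2 := ENNReal.Tendsto.const_mul (a := eLpNorm f 2 volume) hG.lim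
        (Or.inr (memLp_coe f).2.ne)
      simpa using h1.add h2
    refine tendsto_of_tendsto_of_tendsto_of_le_of_le' tendsto_const_nhds h0
      (Eventually.of_forall fun _ => zero_le) ?_
    filter_upwards [self_mem_nhdsWithin] with y hy
    have hFy := hF.memLp_slice hy
    have hGy := hG.memLp_slice hy
    calc ∫⁻ x : ℝ, ‖F (x + y * Complex.I) * G (x + y * Complex.I) - f x * g x‖ₑ
        ≤ ∫⁻ x : ℝ, (‖(F (x + y * Complex.I) - f x) * G (x + y * Complex.I)‖ₑ
            + ‖f x * (G (x + y * Complex.I) - g x)‖ₑ) := by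
          refine lintegral_mono fun x => ?_
          refine le_trans (le_of_eq ?_) (enorm_add_le _ _)
          congr 1
          ring
      _ = (∫⁻ x : ℝ, ‖(F (x + y * Complex.I) - f x) * G (x + y * Complex.I)‖ₑ)
            + ∫⁻ x : ℝ, ‖f x * (G (x + y * Complex.I) - g x)‖ₑ := by
          refine lintegral_add_left' ?_ _
          exact ((hFy.1.sub (memLp_coe f).1).mul hGy.1).enorm
      _ ≤ _ := by
          refine add_le_add ((lintegral_mul_le (hFy.1.sub (memLp_coe f).1) hGy.1).trans ?_)
            (lintegral_mul_le (memLp_coe f).1 (hGy.1.sub (memLp_coe g).1))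
          exact mul_le_mul' le_rfl (hC y hy)

/-- The Hardy space is orthogonal to the conjugates of the Cauchy kernels it contains. -/
theorem integral_kernel_mul_eq_zero {F : ℂ → ℂ} {f : L2} (hF : HasBoundary F f) {r : ℂ}
    (hr : r.im < 0) : ∫ x, kernelFun r x * f x = 0 := by
  obtain ⟨C, hC⟩ := hF.bound
  have hk := hasBoundary_kernel hr
  obtain ⟨D, hD⟩ := hk.bound
  have hle : ∀ y : ℝ, 0 < y →
      ∫⁻ x : ℝ, ‖1 / ((x + y * Complex.I : ℂ) - r) * F (x + y * Complex.I)‖ₑ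
        ≤ eLpNorm (kernelFun (r - y * Complex.I)) 2 volume * C := by
    intro y hy
    rw [← kernel_slice]
    exact (lintegral_mul_le (hk.memLp_slice hy).1 (hF.memLp_slice hy).1).trans
      (mul_le_mul' le_rfl (hC y hy))
  have hconst : ∀ y : ℝ, 0 < y →
      ∫ x : ℝ, 1 / ((x + y * Complex.I : ℂ) - r) * F (x + y * Complex.I) = 0 := by
    intro y hy
    set J := ∫ x : ℝ, 1 / ((x + y * Complex.I : ℂ) - r) * F (x + y * Complex.I) with hJ
    -- The integral `J` may be moved up to any height `b`, where the kernel has `L²` norm at most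
    -- `√(π/b)`; letting `b → ∞` gives `J = 0`.
    have h1 : ∀ b : ℝ, y ≤ b → ‖J‖ₑ ≤ ENNReal.ofReal (Real.sqrt (Real.pi / b)) * C := by
      intro b hb
      have hb0 : 0 < b := hy.trans_le hb
      have hline := integral_line_eq (Φ := fun z => 1 / (z - r) * F z) (hk.holo.mul hF.holo) hy hb
        (C := D * C) (fun t ht => ?_)
      · rw [hJ, hline]
        refine (enorm_integral_le_lintegral_enorm _).trans ((hle b hb0).trans ?_)
        refine mul_le_mul' ?_ le_rfl
        have := eLpNorm_kernelFun_le (w := r - b * Complex.I) (r := -(b * Complex.I))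
          (by simpa using hb0) (by simp; linarith)
        simpa [abs_of_pos hb0] using this
      · have ht0 : 0 < t := hy.trans_le ht.1
        refine (hle t ht0).trans ?_
        rw [← kernel_slice]
        push_cast
        exact mul_le_mul' (hD t ht0) le_rfl
    have h2 : Tendsto (fun b : ℝ => ENNReal.ofReal (Real.sqrt (Real.pi / b)) * C) atTop (𝓝 0) := by
      have h3 : Tendsto (fun b : ℝ => ENNReal.ofReal (Real.sqrt (Real.pi / b))) atTop
          (𝓝 (ENNReal.ofReal (Real.sqrt 0))) :=
        (ENNReal.continuous_ofReal.comp Real.continuous_sqrt).continuousAt.tendsto.comp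
          (tendsto_const_nhds.div_atTop tendsto_id)
      rw [Real.sqrt_zero, ENNReal.ofReal_zero] at h3
      simpa using ENNReal.Tendsto.mul_const h3 (Or.inr ENNReal.coe_ne_top)
    have h4 : ‖J‖ₑ ≤ 0 := ge_of_tendsto h2 ((eventually_ge_atTop y).mono h1)
    simpa using h4
  have hlim := hk.tendsto_integral_mul hF
  have hlim0 : Tendsto (fun y : ℝ =>
      ∫ x : ℝ, 1 / ((x + y * Complex.I : ℂ) - r) * F (x + y * Complex.I)) (𝓝[>] 0) (𝓝 0) := by
    refine tendsto_const_nhds.congr' ?_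
    filter_upwards [self_mem_nhdsWithin] with y hy
    exact (hconst y hy).symm
  rw [← tendsto_nhds_unique hlim hlim0]
  refine integral_congr_ae ?_
  filter_upwards [coe_toL2 (memLp_kernelFun hr.ne)] with x hx
  rw [hx]

/-! ### Multipliers of the Hardy space -/

/-- Bounded holomorphic functions in the upper half-plane which are Lipschitz up to the
boundary along vertical lines. -/
structure IsMult (β : ℂ → ℂ) : Prop where
  holo : DifferentiableOn ℂ β upper
  cont : Continuous (fun x : ℝ => β x)
  bdd : ∃ C : ℝ, ∀ z : ℂ, 0 ≤ z.im → ‖β z‖ ≤ C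
  lip : ∃ C : ℝ, ∀ x y : ℝ, 0 < y → ‖β (x + y * Complex.I) - β x‖ ≤ C * y

theorem IsMult.const (c : ℂ) : IsMult (fun _ => c) where
  holo := differentiableOn_const c
  cont := continuous_const
  bdd := ⟨‖c‖, fun _ _ => le_rfl⟩
  lip := ⟨0, fun x y _ => by simp⟩

theorem IsMult.add {β γ : ℂ → ℂ} (hβ : IsMult β) (hγ : IsMult γ) :
    IsMult (fun z => β z + γ z) where
  holo := hβ.holo.add hγ.holo
  cont := hβ.cont.add hγ.cont
  bdd := by
    obtain ⟨C, hC⟩ := hβ.bdd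
    obtain ⟨D, hD⟩ := hγ.bdd
    exact ⟨C + D, fun z hz => (norm_add_le _ _).trans (add_le_add (hC z hz) (hD z hz))⟩
  lip := by
    obtain ⟨C, hC⟩ := hβ.lip
    obtain ⟨D, hD⟩ := hγ.lip
    refine ⟨C + D, fun x y hy => ?_⟩
    rw [add_sub_add_comm, add_mul]
    exact (norm_add_le _ _).trans (add_le_add (hC x y hy) (hD x y hy))

theorem IsMult.mul {β γ : ℂ → ℂ} (hβ : IsMult β) (hγ : IsMult γ) :
    IsMult (fun z => β z * γ z) where
  holo := hβ.holo.mul hγ.holo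
  cont := hβ.cont.mul hγ.cont
  bdd := by
    obtain ⟨C, hC⟩ := hβ.bdd
    obtain ⟨D, hD⟩ := hγ.bdd
    refine ⟨C * D, fun z hz => ?_⟩
    rw [norm_mul]
    exact mul_le_mul (hC z hz) (hD z hz) (norm_nonneg _) ((norm_nonneg _).trans (hC z hz))
  lip := by
    obtain ⟨C, hC⟩ := hβ.lip
    obtain ⟨D, hD⟩ := hγ.lip
    obtain ⟨C', hC'⟩ := hβ.bdd
    obtain ⟨D', hD'⟩ := hγ.bdd
    refine ⟨C * D' + C' * D, fun x y hy => ?_⟩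
    have h : β (x + y * Complex.I) * γ (x + y * Complex.I) - β x * γ x
        = (β (x + y * Complex.I) - β x) * γ (x + y * Complex.I)
          + β x * (γ (x + y * Complex.I) - γ x) := by ring
    have hz : 0 ≤ (x + y * Complex.I : ℂ).im := (line_mem_upper x hy).le
    rw [h]
    refine (norm_add_le _ _).trans ?_
    rw [norm_mul, norm_mul]
    calc _ ≤ C * y * D' + C' * (D * y) := add_le_add
          (mul_le_mul (hC x y hy) (hD' _ hz) (norm_nonneg _) ((norm_nonneg _).trans (hC x y hy)))
          (mul_le_mul (hC' _ (by simp)) (hD x y hy) (norm_nonneg _)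
            ((norm_nonneg _).trans (hC' x (by simp))))
      _ = _ := by ring

theorem abs_im_le_norm_sub {z r : ℂ} (hz : 0 ≤ z.im) (hr : r.im < 0) : |r.im| ≤ ‖z - r‖ := by
  refine le_trans ?_ (Complex.abs_im_le_norm _)
  rw [abs_of_neg hr, Complex.sub_im, abs_of_pos (by linarith)]
  linarith

theorem IsMult.kernel {r : ℂ} (hr : r.im < 0) : IsMult (fun z => 1 / (z - r)) where
  holo := (hasBoundary_kernel hr).holo
  cont := continuous_kernelFun hr.ne
  bdd := by
    refine ⟨1 / |r.im|, fun z hz => ?_⟩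
    rw [norm_div, norm_one]
    exact div_le_div_of_nonneg_left zero_le_one (abs_pos.2 hr.ne) (abs_im_le_norm_sub hz hr)
  lip := by
    refine ⟨1 / (|r.im| * |r.im|), fun x y hy => ?_⟩
    have hz : 0 ≤ (x + y * Complex.I : ℂ).im := (line_mem_upper x hy).le
    have h1 : (x + y * Complex.I : ℂ) - r ≠ 0 := ne_of_im_pos_of_im_neg hz hr
    have h2 : (x : ℂ) - r ≠ 0 := ne_of_im_pos_of_im_neg (by simp) hr
    have h3 : 1 / ((x + y * Complex.I : ℂ) - r) - 1 / ((x : ℂ) - r)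
        = -(y * Complex.I) / (((x + y * Complex.I : ℂ) - r) * ((x : ℂ) - r)) := by
      field_simp
      ring
    rw [h3, norm_div, norm_neg, norm_mul, norm_mul, Complex.norm_I, mul_one, Complex.norm_real,
      Real.norm_eq_abs, abs_of_pos hy, one_div_mul_eq_div]
    refine div_le_div_of_nonneg_left hy.le (by have := abs_pos.2 hr.ne; positivity) ?_
    exact mul_le_mul (abs_im_le_norm_sub hz hr) (abs_im_le_norm_sub (by simp) hr) (abs_nonneg _)
      (norm_nonneg _)

theorem IsMult.memLp {β : ℂ → ℂ} (hβ : IsMult β) {f : ℝ → ℂ} (hf : MemLp f 2 volume) :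
    MemLp (fun x : ℝ => β x * f x) 2 volume := by
  obtain ⟨C, hC⟩ := hβ.bdd
  refine MemLp.of_le_mul (c := C) hf (hβ.cont.aestronglyMeasurable.mul hf.1)
    (Eventually.of_forall fun x => ?_)
  rw [norm_mul]
  exact mul_le_mul_of_nonneg_right (hC x (by simp)) (norm_nonneg _)

theorem eLpNorm_mul_le_of_bound {β g : ℝ → ℂ} {C : ℝ} (hC : ∀ x, ‖β x‖ ≤ C) :
    eLpNorm (fun x => β x * g x) 2 volume ≤ ENNReal.ofReal C * eLpNorm g 2 volume := by
  have hC0 : 0 ≤ C := (norm_nonneg _).trans (hC 0)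
  rw [← eLpNorm_norm g]
  have hsm := eLpNorm_const_smul C (fun x => ‖g x‖) 2 volume
  rw [Real.enorm_eq_ofReal hC0] at hsm
  rw [← hsm]
  refine eLpNorm_mono fun x => ?_
  simp only [Pi.smul_apply, smul_eq_mul, norm_mul, Real.norm_eq_abs, abs_norm, abs_of_nonneg hC0]
  exact mul_le_mul_of_nonneg_right (hC x) (norm_nonneg _)

/-- Convergence to boundary values is preserved under multiplication by functions which are
bounded and Lipschitz near the boundary. -/
theorem tendsto_eLpNorm_mul {F β : ℂ → ℂ} {f : L2}
    (hlim : Tendsto (fun y : ℝ => eLpNorm (fun x : ℝ => F (x + y * Complex.I) - f x) 2 volume)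
      (𝓝[>] 0) (𝓝 0)) (hF : DifferentiableOn ℂ F upper)
    (hcont : Continuous (fun x : ℝ => β x)) {δ C D : ℝ} (hδ : 0 < δ)
    (hslice : ∀ y : ℝ, 0 < y → y < δ → Continuous (fun x : ℝ => β (x + y * Complex.I)))
    (hC : ∀ x y : ℝ, 0 ≤ y → y < δ → ‖β (x + y * Complex.I)‖ ≤ C)
    (hD : ∀ x y : ℝ, 0 < y → y < δ → ‖β (x + y * Complex.I) - β x‖ ≤ D * y) :
    Tendsto (fun y : ℝ => eLpNorm (fun x : ℝ => β (x + y * Complex.I) * F (x + y * Complex.I)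
      - toL2 (fun x => β x * f x) x) 2 volume) (𝓝[>] 0) (𝓝 0) := by
  have hmem : MemLp (fun x : ℝ => β x * f x) 2 volume := by
    refine MemLp.of_le_mul (c := C) (memLp_coe f)
      (hcont.aestronglyMeasurable.mul (memLp_coe f).1) (Eventually.of_forall fun x => ?_)
    rw [norm_mul]
    have := hC x 0 le_rfl hδ
    simp only [Complex.ofReal_zero, zero_mul, add_zero] at this
    exact mul_le_mul_of_nonneg_right this (norm_nonneg _)
  have h0 : Tendsto (fun y : ℝ =>
      ENNReal.ofReal C * eLpNorm (fun x : ℝ => F (x + y * Complex.I) - f x) 2 volume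
        + ENNReal.ofReal (D * y) * eLpNorm f 2 volume) (𝓝[>] 0) (𝓝 0) := by
    have h1 := ENNReal.Tendsto.const_mul (a := ENNReal.ofReal C) hlim
      (Or.inr ENNReal.ofReal_ne_top)
    have h2 : Tendsto (fun y : ℝ => ENNReal.ofReal (D * y)) (𝓝[>] 0) (𝓝 0) := by
      have h1 : Tendsto (fun y : ℝ => ENNReal.ofReal (D * y)) (𝓝 0)
          (𝓝 (ENNReal.ofReal (D * 0))) :=
        (ENNReal.continuous_ofReal.comp (continuous_const.mul continuous_id)).tendsto 0
      rw [mul_zero, ENNReal.ofReal_zero] at h1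
      exact h1.mono_left nhdsWithin_le_nhds
    have h3 := ENNReal.Tendsto.mul_const (b := eLpNorm f 2 volume) h2 (Or.inr (memLp_coe f).2.ne)
    simpa using h1.add h3
  refine tendsto_of_tendsto_of_tendsto_of_le_of_le' tendsto_const_nhds h0
    (Eventually.of_forall fun _ => zero_le) ?_
  filter_upwards [self_mem_nhdsWithin, Ioo_mem_nhdsGT hδ] with y hy hyδ
  have hy : 0 < y := hy
  have hβy := (hslice y hy hyδ.2).aestronglyMeasurable (μ := volume)
  have hFy := aesm_slice hF hy
  calc eLpNorm (fun x : ℝ => β (x + y * Complex.I) * F (x + y * Complex.I)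
        - toL2 (fun x => β x * f x) x) 2 volume
      = eLpNorm ((fun x : ℝ => β (x + y * Complex.I) * (F (x + y * Complex.I) - f x))
          + fun x : ℝ => (β (x + y * Complex.I) - β x) * f x) 2 volume := by
        refine eLpNorm_congr_ae ?_
        filter_upwards [coe_toL2 hmem] with x hx
        rw [hx, Pi.add_apply]
        ring
    _ ≤ _ := by
        refine (eLpNorm_add_le (hβy.mul (hFy.sub (memLp_coe f).1))
          ((hβy.sub hcont.aestronglyMeasurable).mul (memLp_coe f).1) (by norm_num)).trans ?_
        exact add_le_add (eLpNorm_mul_le_of_bound fun x => hC x y hy.le hyδ.2)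
          (eLpNorm_mul_le_of_bound fun x => hD x y hy hyδ.2)

theorem HasBoundary.mul {F β : ℂ → ℂ} {f : L2} (hF : HasBoundary F f) (hβ : IsMult β) :
    HasBoundary (fun z => β z * F z) (toL2 (fun x => β x * f x)) where
  holo := hβ.holo.mul hF.holo
  bound := by
    obtain ⟨C, hC⟩ := hβ.bdd
    obtain ⟨D, hD⟩ := hF.bound
    refine ⟨C.toNNReal * D, fun y hy => ?_⟩
    refine (eLpNorm_mul_le_of_bound (C := C) fun x => hC _ (line_mem_upper x hy).le).trans ?_
    push_cast
    exact mul_le_mul' le_rfl (hD y hy)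
  lim := by
    obtain ⟨C, hC⟩ := hβ.bdd
    obtain ⟨D, hD⟩ := hβ.lip
    exact tendsto_eLpNorm_mul hF.lim hF.holo hβ.cont one_pos
      (fun y hy _ => continuous_slice hβ.holo hy)
      (fun x y hy _ => hC _ (by simpa using hy)) (fun x y hy _ => hD x y hy)

end Hardy

/-! ### Division by Blaschke factors, the reproducing property, point values. -/

section PointEvaluation

/-! ### Division by a Blaschke factor and point evaluations -/

theorem HasBoundary.congr {F G : ℂ → ℂ} {f : L2} (hF : HasBoundary F f)
    (h : ∀ z ∈ upper, G z = F z) : HasBoundary G f where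
  holo := hF.holo.congr h
  bound := by
    obtain ⟨C, hC⟩ := hF.bound
    refine ⟨C, fun y hy => ?_⟩
    simp_rw [h _ (line_mem_upper _ hy)]
    exact hC y hy
  lim := by
    refine hF.lim.congr' ?_
    filter_upwards [self_mem_nhdsWithin] with y hy
    simp_rw [h _ (line_mem_upper _ hy)]

theorem norm_sub_conj (a : ℂ) : ‖a - conj a‖ = 2 * |a.im| := by
  rw [Complex.sub_conj]
  simp

/-- The constant is `1 + 4`: `z - conj a` differs from `z - a` by `2i Im a`, of modulus `4r ≤ 4‖z -
a‖`. -/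
theorem norm_blaschke_inv_le {z a : ℂ} {r : ℝ} (hr : 0 < r) (ha : a.im = 2 * r)
    (hz : r ≤ ‖z - a‖) : ‖(z - conj a) / (z - a)‖ ≤ 5 := by
  have h0 : 0 < ‖z - a‖ := hr.trans_le hz
  rw [norm_div, div_le_iff₀ h0]
  have h1 : z - conj a = (z - a) + (a - conj a) := by ring
  rw [h1]
  refine (norm_add_le _ _).trans ?_
  rw [norm_sub_conj, ha, abs_of_pos (by linarith)]
  linarith

theorem le_norm_sub_of_im_le {z a : ℂ} {r : ℝ} (ha : a.im = 2 * r) (hz : z.im ≤ r) :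
    r ≤ ‖z - a‖ := by
  refine le_trans ?_ (Complex.abs_im_le_norm _)
  rw [Complex.sub_im, ha, abs_sub_comm]
  refine le_trans ?_ (le_abs_self _)
  linarith

/-- Division by a Blaschke factor at a zero. -/
theorem HasBoundary.div_blaschke {F : ℂ → ℂ} {f : L2} (hF : HasBoundary F f) {a : ℂ}
    (ha : a ∈ upper) (h0 : F a = 0) :
    HasBoundary (fun z => (z - conj a) * dslope F a z)
      (toL2 (fun x => ((x : ℂ) - conj a) / (x - a) * f x)) := by
  obtain ⟨r, hr, har⟩ : ∃ r : ℝ, 0 < r ∧ a.im = 2 * r :=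
    ⟨a.im / 2, half_pos ha, by ring⟩
  have hG : ∀ z, z ≠ a → (z - conj a) * dslope F a z = (z - conj a) / (z - a) * F z := by
    intro z hz
    rw [dslope_of_ne _ hz, slope_def_field, h0]
    ring
  have hholo : DifferentiableOn ℂ (fun z => (z - conj a) * dslope F a z) upper := by
    refine DifferentiableOn.mul (by fun_prop) ?_
    exact (Complex.differentiableOn_dslope (isOpen_upper.mem_nhds ha)).2 hF.holo
  refine ⟨hholo, ?_, ?_⟩
  -- Uniform `L²` bound: outside the ball of radius `r` about `a` the quotient is at most `5|F|`,
  -- and on the ball it is bounded by compactness. All horizontal slices of the ball lie over one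
  -- interval of length `2r`, so the indicator term does not depend on the height.
  · have hball : Metric.closedBall a r ⊆ upper := by
      intro z hz
      have h1 := (Complex.abs_im_le_norm (z - a)).trans (mem_closedBall_iff_norm.1 hz)
      rw [Complex.sub_im, abs_le] at h1
      exact mem_upper.2 (by linarith [h1.1])
    obtain ⟨M, hM⟩ := (isCompact_closedBall a r).exists_bound_of_continuousOn
      (hholo.continuousOn.mono hball)
    have hM0 : 0 ≤ M := (norm_nonneg _).trans (hM a (Metric.mem_closedBall_self hr.le))
    obtain ⟨C, hC⟩ := hF.bound
    set χ : ℝ → ℝ := (Set.Icc (a.re - r) (a.re + r)).indicator (fun _ => M) with hχ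
    have hχmem : MemLp χ 2 volume := memLp_indicator_const 2 measurableSet_Icc M
      (Or.inr (by simp))
    obtain ⟨D, hD⟩ : ∃ D : ℝ≥0, (D : ℝ≥0∞) = eLpNorm χ 2 volume :=
      ⟨_, ENNReal.coe_toNNReal hχmem.2.ne⟩
    refine ⟨5 * C + D, fun y hy => ?_⟩
    have hsm := eLpNorm_const_smul (5 : ℝ) (fun x : ℝ => ‖F (x + y * Complex.I)‖) 2 volume
    calc eLpNorm (fun x : ℝ => ((x + y * Complex.I : ℂ) - conj a)
            * dslope F a (x + y * Complex.I)) 2 volume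
        ≤ eLpNorm (((5 : ℝ) • fun x : ℝ => ‖F (x + y * Complex.I)‖) + χ) 2 volume := by
          refine eLpNorm_mono_real fun x => ?_
          simp only [Pi.add_apply, Pi.smul_apply, smul_eq_mul]
          have hχ0 : 0 ≤ χ x := Set.indicator_nonneg (fun _ _ => hM0) x
          by_cases hz : ‖(x + y * Complex.I : ℂ) - a‖ ≤ r
          · refine (hM _ (mem_closedBall_iff_norm.2 hz)).trans ?_
            have hx : x ∈ Set.Icc (a.re - r) (a.re + r) := by
              have h1 := (Complex.abs_re_le_norm _).trans hz
              simp only [Complex.sub_re, Complex.add_re, Complex.ofReal_re, Complex.mul_re,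
                Complex.I_re, mul_zero, Complex.ofReal_im, Complex.I_im, mul_one, sub_self,
                add_zero, abs_le] at h1
              constructor <;> linarith [h1.1, h1.2]
            rw [hχ, Set.indicator_of_mem hx]
            linarith [norm_nonneg (F (x + y * Complex.I))]
          · have hz' : r ≤ ‖(x + y * Complex.I : ℂ) - a‖ := (not_le.1 hz).le
            have hne : (x + y * Complex.I : ℂ) ≠ a := by
              intro h
              rw [h, sub_self, norm_zero] at hz'
              linarith
            rw [hG _ hne, norm_mul]
            have := mul_le_mul_of_nonneg_right (norm_blaschke_inv_le hr har hz')
              (norm_nonneg (F (x + y * Complex.I)))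
            linarith
      _ ≤ eLpNorm ((5 : ℝ) • fun x : ℝ => ‖F (x + y * Complex.I)‖) 2 volume
            + eLpNorm χ 2 volume :=
          eLpNorm_add_le ((aesm_slice hF.holo hy).norm.const_smul _) hχmem.1 (by norm_num)
      _ ≤ _ := by
          rw [hsm, eLpNorm_norm, ← hD]
          push_cast
          refine add_le_add (mul_le_mul' (le_of_eq ?_) (hC y hy)) le_rfl
          rw [Real.enorm_eq_ofReal (by norm_num)]
          norm_num
  · have hne : ∀ x y : ℝ, y < r → (x + y * Complex.I : ℂ) - a ≠ 0 := by
      intro x y hy h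
      have := congrArg Complex.im h
      simp at this
      linarith
    have hle : ∀ x y : ℝ, y < r → r ≤ ‖(x + y * Complex.I : ℂ) - a‖ := fun x y hy =>
      le_norm_sub_of_im_le har (by simpa using hy.le)
    have hcont : ∀ y : ℝ, y < r → Continuous (fun x : ℝ =>
        ((x + y * Complex.I : ℂ) - conj a) / ((x + y * Complex.I : ℂ) - a)) := fun y hy =>
      Continuous.div (by fun_prop) (by fun_prop) fun x => hne x y hy
    -- For boundary values only the strip `0 < y < r` matters, and it misses the pole `a`. There the
    -- factor is at most `5` and has Lipschitz constant `|a - conj a| / r² = 4/r`.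
    have h := tendsto_eLpNorm_mul (β := fun z => (z - conj a) / (z - a)) (C := 5) (D := 4 / r)
      hF.lim hF.holo (by simpa using hcont 0 hr) hr (fun y _ hy => hcont y hy)
      (fun x y _ hy => norm_blaschke_inv_le hr har (hle x y hy)) ?_
    · refine h.congr' ?_
      filter_upwards [Ioo_mem_nhdsGT hr] with y hy
      congr 1
      funext x
      rw [hG _ (sub_ne_zero.1 (hne x y hy.2))]
    · intro x y hy hyr
      have h1 := hne x y hyr
      have h2 : (x : ℂ) - a ≠ 0 := by simpa using hne x 0 hr
      have h3 : ((x + y * Complex.I : ℂ) - conj a) / ((x + y * Complex.I : ℂ) - a)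
          - ((x : ℂ) - conj a) / ((x : ℂ) - a)
          = -(y * Complex.I) * (a - conj a) / (((x + y * Complex.I : ℂ) - a) * ((x : ℂ) - a)) := by
        field_simp
        ring
      have h4 : r ≤ ‖(x : ℂ) - a‖ := by simpa using hle x 0 hr
      rw [h3, norm_div, norm_mul, norm_neg, norm_mul, norm_mul, Complex.norm_I, mul_one,
        Complex.norm_real, Real.norm_eq_abs, abs_of_pos hy, norm_sub_conj, har,
        abs_of_pos (by linarith), div_le_iff₀ (mul_pos (hr.trans_le (hle x y hyr))
          (hr.trans_le h4))]
      calc y * (2 * (2 * r)) = 4 / r * y * (r * r) := by field_simp; ring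
        _ ≤ _ := mul_le_mul_of_nonneg_left (mul_le_mul (hle x y hyr) h4 hr.le (norm_nonneg _))
          (by positivity)

theorem conj_im_neg {a : ℂ} (ha : a ∈ upper) : (conj a).im < 0 := by
  rw [Complex.conj_im]
  exact neg_neg_of_pos ha

theorem line_sub_ne_zero (x : ℝ) {w : ℂ} (hw : w.im ≠ 0) : (x : ℂ) - w ≠ 0 := by
  intro h
  rw [← sub_eq_zero.1 h] at hw
  simp at hw

theorem IsMult.blaschkeFactor {a : ℂ} (ha : a ∈ upper) :
    IsMult (fun z => 1 + (conj a - a) * (1 / (z - conj a))) :=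
  (IsMult.const 1).add ((IsMult.const _).mul (IsMult.kernel (conj_im_neg ha)))

theorem blaschkeFactor_eq {a z : ℂ} (h : z - conj a ≠ 0) :
    1 + (conj a - a) * (1 / (z - conj a)) = (z - a) / (z - conj a) := by
  field_simp
  ring

/-- Subtracting the multiple of the Cauchy kernel with the same value at `a` leaves a function
vanishing at `a`, which the Blaschke factor divides. Both the reproducing property and the
description of model spaces come from this splitting. -/
theorem HasBoundary.decomp {F : ℂ → ℂ} {f : L2} (hF : HasBoundary F f) {a : ℂ}
    (ha : a ∈ upper) : ∃ G g, HasBoundary G g ∧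
      f = (F a * (a - conj a)) • toL2 (kernelFun (conj a))
        + toL2 (fun x : ℝ => ((x : ℂ) - a) / (x - conj a) * g x) := by
  have hr := conj_im_neg ha
  have hane : a - conj a ≠ 0 := ne_of_im_pos_of_im_neg (mem_upper.1 ha).le hr
  have hF0 := hF.add ((hasBoundary_kernel hr).smul (-(F a * (a - conj a))))
  have h0 : (F + (-(F a * (a - conj a))) • fun z => 1 / (z - conj a)) a = 0 := by
    simp only [Pi.add_apply, Pi.smul_apply, smul_eq_mul]
    field_simp
    ring
  refine ⟨_, _, hF0.div_blaschke ha h0, ?_⟩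
  set f0 := f + (-(F a * (a - conj a))) • toL2 (kernelFun (conj a)) with hf0
  have hf : f = (F a * (a - conj a)) • toL2 (kernelFun (conj a)) + f0 := by
    rw [hf0]
    module
  have hmem : MemLp (fun x : ℝ => ((x : ℂ) - conj a) / (x - a) * f0 x) 2 volume := by
    refine MemLp.of_le_mul (c := 5) (memLp_coe f0) (AEStronglyMeasurable.mul
      (Continuous.aestronglyMeasurable ?_) (memLp_coe f0).1) (Eventually.of_forall fun x => ?_)
    · exact Continuous.div (by fun_prop) (by fun_prop)
        fun x => line_sub_ne_zero x (mem_upper.1 ha).ne'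
    · rw [norm_mul]
      refine mul_le_mul_of_nonneg_right (norm_blaschke_inv_le (r := a.im / 2) (half_pos ha)
        (by ring) (le_norm_sub_of_im_le (by ring) ?_)) (norm_nonneg _)
      simpa using (half_pos ha).le
  nth_rewrite 1 [hf]
  congr 1
  symm
  refine toL2_eq ?_
  filter_upwards [coe_toL2 hmem] with x hx
  rw [hx]
  have h1 := line_sub_ne_zero x (mem_upper.1 ha).ne'
  have h2 := line_sub_ne_zero x hr.ne
  field_simp

/-- The reproducing property of the Cauchy kernels. -/
theorem HasBoundary.inner_kernel {F : ℂ → ℂ} {f : L2} (hF : HasBoundary F f) {a : ℂ}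
    (ha : a ∈ upper) :
    inner ℂ (toL2 (kernelFun (conj a))) f = 2 * Real.pi * Complex.I * F a := by
  obtain ⟨G, g, hG, hf⟩ := hF.decomp ha
  have hr := conj_im_neg ha
  have hmem : MemLp (fun x : ℝ => ((x : ℂ) - a) / (x - conj a) * g x) 2 volume := by
    refine ((IsMult.blaschkeFactor ha).memLp (memLp_coe g)).ae_eq (Eventually.of_forall fun x => ?_)
    simp only [blaschkeFactor_eq (line_sub_ne_zero x hr.ne)]
  -- Conjugation moves the pole of the kernel to `a`, where the Blaschke factor cancels it; what
  -- remains is `g / (x - conj a)`, of integral zero.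
  have h0 : inner ℂ (toL2 (kernelFun (conj a)))
      (toL2 (fun x : ℝ => ((x : ℂ) - a) / (x - conj a) * g x)) = 0 := by
    rw [inner_toL2_toL2 (memLp_kernelFun hr.ne) hmem, ← integral_kernel_mul_eq_zero hG hr]
    congr 1
    funext x
    have h1 := line_sub_ne_zero x (mem_upper.1 ha).ne'
    have h2 := line_sub_ne_zero x hr.ne
    simp only [kernelFun, map_div₀, map_sub, map_one, Complex.conj_ofReal, Complex.conj_conj]
    field_simp
  have him : (a.im : ℂ) ≠ 0 := by exact_mod_cast (mem_upper.1 ha).ne'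
  nth_rewrite 1 [hf]
  rw [inner_add_right, h0, add_zero, inner_smul_right, inner_self_eq_norm_sq_to_K]
  have h2 : ((‖toL2 (kernelFun (conj a))‖ : ℂ)) ^ 2 = Real.pi / a.im := by
    rw [← Complex.ofReal_pow, norm_toL2_kernelFun_sq hr.ne, Complex.conj_im, abs_neg,
      abs_of_pos ha, Complex.ofReal_div]
  change F a * (a - conj a) * ((‖toL2 (kernelFun (conj a))‖ : ℂ)) ^ 2 = _
  rw [h2, Complex.sub_conj]
  field_simp
  push_cast
  ring

/-- The holomorphic extension of a function in the Hardy space to the upper half-plane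
(the Cauchy integral). -/
noncomputable def ext (f : L2) (z : ℂ) : ℂ :=
  (2 * Real.pi * Complex.I)⁻¹ * inner ℂ (toL2 (kernelFun (conj z))) f

theorem two_pi_I_ne_zero : (2 * Real.pi * Complex.I : ℂ) ≠ 0 := Complex.two_pi_I_ne_zero

theorem HasBoundary.ext_eq {F : ℂ → ℂ} {f : L2} (hF : HasBoundary F f) {z : ℂ}
    (hz : z ∈ upper) : ext f z = F z := by
  rw [ext, hF.inner_kernel hz, inv_mul_cancel_left₀ two_pi_I_ne_zero]

theorem hasBoundary_ext {f : L2} (hf : f ∈ H2) : HasBoundary (ext f) f := by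
  obtain ⟨F, hF⟩ := hf
  exact hF.congr fun z hz => hF.ext_eq hz

theorem ext_add (f g : L2) (z : ℂ) : ext (f + g) z = ext f z + ext g z := by
  simp only [ext, inner_add_right, mul_add]

theorem ext_sub (f g : L2) (z : ℂ) : ext (f - g) z = ext f z - ext g z := by
  simp only [ext, inner_sub_right, mul_sub]

theorem ext_smul (c : ℂ) (f : L2) (z : ℂ) : ext (c • f) z = c * ext f z := by
  simp only [ext, inner_smul_right]
  ring

theorem HasBoundary.unique {F : ℂ → ℂ} {f g : L2} (hf : HasBoundary F f) (hg : HasBoundary F g) :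
    f = g := by
  have h0 : eLpNorm (fun x => f x - g x) 2 volume ≤ 0 := by
    have hlim : Tendsto (fun y : ℝ => eLpNorm (fun x : ℝ => F (x + y * Complex.I) - f x) 2 volume
        + eLpNorm (fun x : ℝ => F (x + y * Complex.I) - g x) 2 volume) (𝓝[>] 0) (𝓝 0) := by
      simpa using hf.lim.add hg.lim
    refine ge_of_tendsto hlim ?_
    filter_upwards [self_mem_nhdsWithin] with y hy
    have h1 := (aesm_slice hf.holo hy).sub (memLp_coe f).1
    have h2 := (aesm_slice hf.holo hy).sub (memLp_coe g).1
    refine le_trans (le_of_eq ?_) ((eLpNorm_sub_le h2 h1 (by norm_num)).trans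
      (le_of_eq (add_comm _ _)))
    congr 1
    funext x
    simp
  rw [nonpos_iff_eq_zero] at h0
  replace h0 := (eLpNorm_eq_zero_iff ((memLp_coe f).1.sub (memLp_coe g).1) (by norm_num)).1 h0
  refine Lp.ext ?_
  filter_upwards [h0] with x hx
  exact sub_eq_zero.1 hx

theorem eq_of_ext_eq {f g : L2} (hf : f ∈ H2) (hg : g ∈ H2)
    (h : ∀ z ∈ upper, ext f z = ext g z) : f = g :=
  (hasBoundary_ext hf).unique ((hasBoundary_ext hg).congr h)

theorem norm_ext_le (f : L2) {z : ℂ} (hz : z ∈ upper) :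
    ‖ext f z‖ ≤ (2 * Real.pi)⁻¹ * (Real.sqrt (Real.pi / z.im) * ‖f‖) := by
  rw [ext, norm_mul, norm_inv]
  have h1 : ‖(2 * Real.pi * Complex.I : ℂ)‖ = 2 * Real.pi := by
    simp [abs_of_pos Real.pi_pos]
  rw [h1]
  refine mul_le_mul_of_nonneg_left ((norm_inner_le_norm _ _).trans (le_of_eq ?_))
    (by positivity)
  rw [← Real.sqrt_sq (norm_nonneg (toL2 _)), norm_toL2_kernelFun_sq (conj_im_neg hz).ne,
    Complex.conj_im, abs_neg, abs_of_pos hz]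

/-- Cauchy–Schwarz against a kernel of norm `√(π/y)`. Behaviour at infinity is always read off along
the imaginary axis by means of this limit. -/
theorem tendsto_ext_atTop (f : L2) :
    Tendsto (fun y : ℝ => ext f (y * Complex.I)) atTop (𝓝 0) := by
  have h : Tendsto (fun y : ℝ => (2 * Real.pi)⁻¹ * (Real.sqrt (Real.pi / y) * ‖f‖)) atTop
      (𝓝 ((2 * Real.pi)⁻¹ * (Real.sqrt 0 * ‖f‖))) :=
    ((Real.continuous_sqrt.continuousAt.tendsto.comp
      (tendsto_const_nhds.div_atTop tendsto_id)).mul_const _).const_mul _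
  rw [Real.sqrt_zero, zero_mul, mul_zero] at h
  refine squeeze_zero_norm' ?_ h
  filter_upwards [eventually_gt_atTop 0] with y hy
  have := norm_ext_le f (z := y * Complex.I) (by simpa [upper] using hy)
  simpa using this

end PointEvaluation

/-! ### Rational functions in the Hardy space and the explicit form of model spaces. -/

section RationalFunctions

/-! ### Rational functions and model spaces -/

/-- `Q` has no zeros in the closed upper half-plane. -/
def NoUpperRoots (Q : Polynomial ℂ) : Prop := ∀ z : ℂ, 0 ≤ z.im → Q.eval z ≠ 0

theorem IsMult.congr {β γ : ℂ → ℂ} (hβ : IsMult β) (h : ∀ z : ℂ, 0 ≤ z.im → γ z = β z) :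
    IsMult γ where
  holo := hβ.holo.congr fun z hz => h z (mem_upper.1 hz).le
  cont := by
    have : (fun x : ℝ => γ x) = fun x : ℝ => β x := funext fun x => h x (by simp)
    rw [this]
    exact hβ.cont
  bdd := by
    obtain ⟨C, hC⟩ := hβ.bdd
    exact ⟨C, fun z hz => by rw [h z hz]; exact hC z hz⟩
  lip := by
    obtain ⟨C, hC⟩ := hβ.lip
    refine ⟨C, fun x y hy => ?_⟩
    rw [h _ (line_mem_upper x hy).le, h x (by simp)]
    exact hC x y hy

theorem NoUpperRoots.exists_factor {Q : Polynomial ℂ} (hQ : NoUpperRoots Q)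
    (hdeg : Q.natDegree ≠ 0) : ∃ r : ℂ, r.im < 0 ∧ ∃ Q', NoUpperRoots Q' ∧
      Q = (Polynomial.X - Polynomial.C r) * Q' ∧ Q.natDegree = Q'.natDegree + 1 := by
  obtain ⟨r, hr⟩ := IsAlgClosed.exists_root Q fun h =>
    hdeg (Polynomial.natDegree_eq_of_degree_eq_some h)
  have hrim : r.im < 0 := by
    by_contra! h
    exact hQ r h hr
  have hfac := Polynomial.mul_divByMonic_eq_iff_isRoot.2 hr
  refine ⟨r, hrim, Q /ₘ (Polynomial.X - Polynomial.C r), fun z hz h => hQ z hz ?_, hfac.symm, ?_⟩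
  · rw [← hfac, Polynomial.eval_mul, h, mul_zero]
  · rw [Polynomial.natDegree_divByMonic _ (Polynomial.monic_X_sub_C r),
      Polynomial.natDegree_X_sub_C]
    lia

/-- Proper rational functions without poles in the closed upper half-plane are multipliers. -/
theorem isMult_rat (n : ℕ) : ∀ {P Q : Polynomial ℂ}, NoUpperRoots Q → Q.natDegree = n →
    P.natDegree ≤ n → IsMult (fun z => P.eval z / Q.eval z) := by
  induction n with
  | zero =>
    intro P Q hQ hn hP
    rw [Polynomial.eq_C_of_natDegree_eq_zero hn, Polynomial.eq_C_of_natDegree_le_zero hP]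
    simp only [Polynomial.eval_C]
    exact IsMult.const _
  | succ n ih =>
    intro P Q hQ hn hP
    obtain ⟨r, hr, Q', hQ', hfac, hdeg⟩ := hQ.exists_factor (by lia)
    have hPd := Polynomial.modByMonic_add_div P (Polynomial.X - Polynomial.C r)
    rw [Polynomial.modByMonic_X_sub_C_eq_C_eval] at hPd
    -- With `P = P(r) + (z - r)P₁` and `Q = (z - r)Q'`, one has `P/Q = P₁/Q' + P(r)/(z - r) · 1/Q'`.
    have h1 : IsMult (fun z => (P /ₘ (Polynomial.X - Polynomial.C r)).eval z / Q'.eval z) := by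
      refine ih hQ' (by lia) ?_
      rw [Polynomial.natDegree_divByMonic _ (Polynomial.monic_X_sub_C r),
        Polynomial.natDegree_X_sub_C]
      lia
    have h2 : IsMult (fun z => (1 : Polynomial ℂ).eval z / Q'.eval z) :=
      ih hQ' (by lia) (by simp)
    refine (h1.add (((IsMult.const (P.eval r)).mul (IsMult.kernel hr)).mul h2)).congr
      fun z hz => ?_
    have hz1 := ne_of_im_pos_of_im_neg hz hr
    have hz2 := hQ' z hz
    have hPz : P.eval z
        = P.eval r + (z - r) * (P /ₘ (Polynomial.X - Polynomial.C r)).eval z := by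
      nth_rewrite 1 [← hPd]
      simp
    have hQz : Q.eval z = (z - r) * Q'.eval z := by
      rw [hfac]
      simp
    rw [hPz, hQz, Polynomial.eval_one]
    field_simp
    ring

/-- A strictly proper rational function without poles in the closed upper half-plane is a Cauchy
kernel times a multiplier. -/
theorem NoUpperRoots.exists_eq_kernel_mul {P Q : Polynomial ℂ} (hQ : NoUpperRoots Q)
    (hPQ : P.degree < Q.degree) : ∃ r : ℂ, r.im < 0 ∧ ∃ β, IsMult β ∧
      ∀ z : ℂ, 0 ≤ z.im → P.eval z / Q.eval z = β z * (1 / (z - r)) := by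
  by_cases hP : P = 0
  · refine ⟨-Complex.I, by simp, fun _ => 0, IsMult.const 0, fun z _ => by simp [hP]⟩
  have hlt := Polynomial.natDegree_lt_natDegree hP hPQ
  obtain ⟨r, hr, Q', hQ', hfac, hdeg⟩ := hQ.exists_factor (by lia)
  refine ⟨r, hr, _, isMult_rat _ hQ' rfl (by lia : P.natDegree ≤ _), fun z hz => ?_⟩
  have hz1 := ne_of_im_pos_of_im_neg hz hr
  have hz2 := hQ' z hz
  rw [hfac, Polynomial.eval_mul]
  simp only [Polynomial.eval_sub, Polynomial.eval_X, Polynomial.eval_C]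
  field_simp

theorem hasBoundary_rat {P Q : Polynomial ℂ} (hQ : NoUpperRoots Q) (hPQ : P.degree < Q.degree) :
    MemLp (fun x : ℝ => P.eval (x : ℂ) / Q.eval (x : ℂ)) 2 volume ∧
    HasBoundary (fun z => P.eval z / Q.eval z)
      (toL2 (fun x : ℝ => P.eval (x : ℂ) / Q.eval (x : ℂ))) := by
  obtain ⟨r, hr, β, hβ, h⟩ := hQ.exists_eq_kernel_mul hPQ
  have hmem : MemLp (fun x : ℝ => P.eval (x : ℂ) / Q.eval (x : ℂ)) 2 volume :=
    (hβ.memLp (memLp_kernelFun hr.ne)).ae_eq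
      (Eventually.of_forall fun x => (h x (by simp)).symm)
  refine ⟨hmem, ?_⟩
  have h1 := ((hasBoundary_kernel hr).mul hβ).congr fun z hz => h z (mem_upper.1 hz).le
  convert h1 using 1
  refine toL2_congr ?_
  filter_upwards [coe_toL2 (memLp_kernelFun hr.ne)] with x hx
  rw [hx, kernelFun, h x (by simp)]

theorem integral_rat_mul_eq_zero {P Q : Polynomial ℂ} (hQ : NoUpperRoots Q)
    (hPQ : P.degree < Q.degree) {h : L2} (hh : h ∈ H2) :
    ∫ x : ℝ, P.eval (x : ℂ) / Q.eval (x : ℂ) * h x = 0 := by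
  obtain ⟨r, hr, β, hβ, heq⟩ := hQ.exists_eq_kernel_mul hPQ
  obtain ⟨H, hH⟩ := hh
  rw [← integral_kernel_mul_eq_zero (hH.mul hβ) hr]
  refine integral_congr_ae ?_
  filter_upwards [coe_toL2 (hβ.memLp (memLp_coe h))] with x hx
  rw [hx, heq x (by simp), kernelFun]
  ring

/-! ### Model spaces of finite Blaschke products -/

section Blaschke

/-- The numerator `∏ (z - a_j)` of a Blaschke product. -/
noncomputable def num {m : ℕ} (a : Fin m → ℂ) : Polynomial ℂ :=
  ∏ j, (Polynomial.X - Polynomial.C (a j))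

/-- The denominator `∏ (z - conj a_j)` of a Blaschke product. -/
noncomputable def den {m : ℕ} (a : Fin m → ℂ) : Polynomial ℂ :=
  ∏ j, (Polynomial.X - Polynomial.C (conj (a j)))

/-- The polynomial with conjugated coefficients. -/
noncomputable def conjPoly (P : Polynomial ℂ) : Polynomial ℂ := P.map (starRingEnd ℂ)

variable {m : ℕ} (a : Fin m → ℂ)

theorem monic_num : (num a).Monic := Polynomial.monic_prod_X_sub_C _ _

theorem monic_den : (den a).Monic := Polynomial.monic_prod_X_sub_C (fun j => conj (a j)) _

theorem natDegree_num : (num a).natDegree = m := by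
  rw [num, Polynomial.natDegree_finsetProd_X_sub_C_eq_card]
  simp

theorem natDegree_den : (den a).natDegree = m := by
  rw [den, Polynomial.natDegree_finsetProd_X_sub_C_eq_card _ (fun j => conj (a j))]
  simp

theorem degree_num : (num a).degree = m := by
  rw [Polynomial.degree_eq_natDegree (monic_num a).ne_zero, natDegree_num]

theorem degree_den : (den a).degree = m := by
  rw [Polynomial.degree_eq_natDegree (monic_den a).ne_zero, natDegree_den]

theorem eval_conjPoly (P : Polynomial ℂ) (x : ℝ) :
    (conjPoly P).eval (x : ℂ) = conj (P.eval (x : ℂ)) := by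
  rw [conjPoly, ← Complex.conj_ofReal, Polynomial.eval_map, Polynomial.eval₂_at_apply,
    Complex.conj_ofReal]

theorem degree_conjPoly (P : Polynomial ℂ) : (conjPoly P).degree = P.degree :=
  Polynomial.degree_map_eq_of_injective (starRingEnd ℂ).injective P

theorem coeff_conjPoly (P : Polynomial ℂ) (k : ℕ) : (conjPoly P).coeff k = conj (P.coeff k) :=
  Polynomial.coeff_map _ _

theorem conj_eval_den (x : ℝ) : conj ((den a).eval (x : ℂ)) = (num a).eval (x : ℂ) := by
  simp [den, num, Polynomial.eval_prod]

theorem conj_eval_num (x : ℝ) : conj ((num a).eval (x : ℂ)) = (den a).eval (x : ℂ) := by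
  rw [← conj_eval_den, Complex.conj_conj]

variable {a}

theorem noUpperRoots_den (ha : ∀ j, 0 < (a j).im) : NoUpperRoots (den a) := by
  intro z hz h
  rw [den, Polynomial.eval_prod, Finset.prod_eq_zero_iff] at h
  obtain ⟨j, -, hj⟩ := h
  simp only [Polynomial.eval_sub, Polynomial.eval_X, Polynomial.eval_C] at hj
  exact ne_of_im_pos_of_im_neg hz (conj_im_neg (ha j)) hj

theorem eval_num_ne_zero (ha : ∀ j, 0 < (a j).im) (x : ℝ) : (num a).eval (x : ℂ) ≠ 0 := by
  rw [← conj_eval_den]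
  exact (map_ne_zero _).2 (noUpperRoots_den ha x (by simp))

variable (a) in
/-- The element `P / ∏ (x - conj a_j)` of `L²(ℝ)`. -/
noncomputable def ratL2 (P : Polynomial ℂ) : L2 :=
  toL2 (fun x : ℝ => P.eval (x : ℂ) / (den a).eval (x : ℂ))

theorem memLp_rat (ha : ∀ j, 0 < (a j).im) {P : Polynomial ℂ} (hP : P.degree < m) :
    MemLp (fun x : ℝ => P.eval (x : ℂ) / (den a).eval (x : ℂ)) 2 volume :=
  (hasBoundary_rat (noUpperRoots_den ha) (by rwa [degree_den])).1

theorem hasBoundary_ratL2 (ha : ∀ j, 0 < (a j).im) {P : Polynomial ℂ} (hP : P.degree < m) :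
    HasBoundary (fun z => P.eval z / (den a).eval z) (ratL2 a P) :=
  (hasBoundary_rat (noUpperRoots_den ha) (by rwa [degree_den])).2

theorem coe_ratL2 (ha : ∀ j, 0 < (a j).im) {P : Polynomial ℂ} (hP : P.degree < m) :
    ratL2 a P =ᵐ[volume] fun x : ℝ => P.eval (x : ℂ) / (den a).eval (x : ℂ) :=
  coe_toL2 (memLp_rat ha hP)

theorem ratL2_add (ha : ∀ j, 0 < (a j).im) {P R : Polynomial ℂ} (hP : P.degree < m)
    (hR : R.degree < m) : ratL2 a (P + R) = ratL2 a P + ratL2 a R := by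
  rw [ratL2, ratL2, ratL2, ← toL2_add (memLp_rat ha hP) (memLp_rat ha hR)]
  simp only [Polynomial.eval_add, add_div]

theorem ratL2_smul (ha : ∀ j, 0 < (a j).im) (c : ℂ) {P : Polynomial ℂ} (hP : P.degree < m) :
    ratL2 a (Polynomial.C c * P) = c • ratL2 a P := by
  rw [ratL2, ratL2, ← toL2_const_mul c (memLp_rat ha hP)]
  simp only [Polynomial.eval_mul, Polynomial.eval_C, mul_div_assoc]

theorem isMult_num_div_den (ha : ∀ j, 0 < (a j).im) :
    IsMult (fun z => (num a).eval z / (den a).eval z) :=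
  isMult_rat _ (noUpperRoots_den ha) rfl (by rw [natDegree_num, natDegree_den])

/-- Splitting off one zero at a time with `HasBoundary.decomp` leaves a quotient in `H²` and adds
one Cauchy kernel. Collecting the kernels over a common denominator, instead of using partial
fractions, treats repeated zeros like simple ones. -/
theorem exists_rat_add_blaschke_mul : ∀ (m : ℕ) (a : Fin m → ℂ), (∀ j, 0 < (a j).im) →
    ∀ f ∈ H2, ∃ (P : Polynomial ℂ) (h : L2), P.degree < m ∧ h ∈ H2 ∧
      ∀ᵐ x : ℝ, f x = P.eval (x : ℂ) / (den a).eval (x : ℂ)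
        + (num a).eval (x : ℂ) / (den a).eval (x : ℂ) * h x := by
  intro m
  induction m with
  | zero =>
    intro a ha f hf
    refine ⟨0, f, by simp, hf, Eventually.of_forall fun x => ?_⟩
    simp [num, den]
  | succ m ih =>
    intro a ha f hf
    obtain ⟨P, h, hP, hh, hfx⟩ := ih (fun j => a j.castSucc) (fun j => ha _) f hf
    set c := a (Fin.last m) with hc
    have hcu : c ∈ upper := ha _
    obtain ⟨H, hH⟩ := hh
    obtain ⟨G, g, hG, hhg⟩ := hH.decomp hcu
    set γ := H c * (c - conj c)
    set a' : Fin m → ℂ := fun j => a j.castSucc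
    have hden : den a = den a' * (Polynomial.X - Polynomial.C (conj c)) := by
      rw [den, Fin.prod_univ_castSucc]
      rfl
    have hnum : num a = num a' * (Polynomial.X - Polynomial.C c) := by
      rw [num, Fin.prod_univ_castSucc]
      rfl
    refine ⟨P * (Polynomial.X - Polynomial.C (conj c)) + Polynomial.C γ * num a', g, ?_,
      hG.mem_H2, ?_⟩
    · refine (Polynomial.degree_add_le _ _).trans_lt (max_lt ?_ ?_)
      · by_cases hP0 : P = 0
        · rw [hP0, zero_mul, Polynomial.degree_zero]
          exact WithBot.bot_lt_coe _
        · rw [Polynomial.degree_mul, Polynomial.degree_X_sub_C]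
          rw [Polynomial.degree_eq_natDegree hP0] at hP ⊢
          exact_mod_cast Nat.succ_lt_succ (by exact_mod_cast hP)
      · rw [← Polynomial.smul_eq_C_mul]
        refine (Polynomial.degree_smul_le _ _).trans_lt ?_
        rw [degree_num]
        exact_mod_cast Nat.lt_succ_self m
    · have hr := conj_im_neg hcu
      have hmem : MemLp (fun x : ℝ => ((x : ℂ) - c) / (x - conj c) * g x) 2 volume := by
        refine ((IsMult.blaschkeFactor hcu).memLp (memLp_coe g)).ae_eq
          (Eventually.of_forall fun x => ?_)
        simp only [blaschkeFactor_eq (line_sub_ne_zero x hr.ne)]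
      have hhx := Lp.coeFn_add (γ • toL2 (kernelFun (conj c)))
        (toL2 fun x : ℝ => ((x : ℂ) - c) / (x - conj c) * g x)
      rw [← hhg] at hhx
      filter_upwards [hfx, hhx, Lp.coeFn_smul γ (toL2 (kernelFun (conj c))),
        coe_toL2 (memLp_kernelFun hr.ne), coe_toL2 hmem] with x h1 h2 h3 h4 h5
      rw [Pi.add_apply, h3, Pi.smul_apply, h4, h5, kernelFun, smul_eq_mul] at h2
      have hx1 := noUpperRoots_den (a := a') (fun j => ha _) x (by simp)
      have hx2 := line_sub_ne_zero x hr.ne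
      rw [h1, h2, hden, hnum]
      simp only [Polynomial.eval_add, Polynomial.eval_mul, Polynomial.eval_sub, Polynomial.eval_X,
        Polynomial.eval_C]
      field_simp
      ring

/-- The model space of a finite Blaschke product consists of rational functions. -/
theorem mem_modelSpace_iff (ha : ∀ j, 0 < (a j).im) {θ : ℂ → ℂ} {κ : ℂ} (hκ : κ ≠ 0)
    (hθ : ∀ z, θ z = κ * ((num a).eval z / (den a).eval z)) {f : L2} :
    f ∈ modelSpace θ ↔ ∃ P : Polynomial ℂ, P.degree < m ∧ f = ratL2 a P := by
  have hmult : IsMult θ := by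
    have := (IsMult.const κ).mul (isMult_num_div_den ha)
    exact this.congr fun z _ => hθ z
  have hmem : ∀ P : Polynomial ℂ, P.degree < m → ratL2 a P ∈ modelSpace θ := by
    intro P hP
    refine ⟨(hasBoundary_ratL2 ha hP).mem_H2, ?_⟩
    rw [SetLike.mem_coe, Submodule.mem_orthogonal]
    intro v hv
    induction hv using Submodule.span_induction with
    | mem v hv =>
      obtain ⟨h, hh, rfl⟩ := hv
      simp only
      -- On the real line the numerator and the denominator of the Blaschke product are conjugate.
      -- The conjugate of the integrand is therefore `κ (conjPoly P / den) h`, a strictly proper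
      -- rational function without poles above times a Hardy function, and its integral vanishes.
      rw [ratL2, inner_toL2_toL2 (hmult.memLp (memLp_coe h)) (memLp_rat ha hP),
        ← map_zero (starRingEnd ℂ), ← mul_zero (κ : ℂ), ← integral_rat_mul_eq_zero
        (noUpperRoots_den ha) (P := conjPoly P) (by rwa [degree_den, degree_conjPoly]) hh,
        ← integral_const_mul, ← integral_conj]
      congr 1
      funext x
      simp only [map_mul, map_div₀, hθ, eval_conjPoly, conj_eval_den, conj_eval_num,
        Complex.conj_conj]
      have h1 := noUpperRoots_den ha x (by simp)
      have h2 := eval_num_ne_zero ha x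
      field_simp
    | zero => simp
    | add v w _ _ hv hw => rw [inner_add_left, hv, hw, add_zero]
    | smul c v _ hv => rw [inner_smul_left, hv, mul_zero]
  constructor
  · intro hf
    obtain ⟨P, h, hP, hh, hfx⟩ := exists_rat_add_blaschke_mul m a ha f hf.1
    refine ⟨P, hP, ?_⟩
    have hd : f - ratL2 a P ∈ modelSpace θ := Submodule.sub_mem _ hf (hmem P hP)
    have heq : f - ratL2 a P = toL2 (fun x => θ x * (κ⁻¹ • h : L2) x) := by
      symm
      refine toL2_eq ?_
      filter_upwards [hfx, coe_ratL2 ha hP, Lp.coeFn_sub f (ratL2 a P), Lp.coeFn_smul κ⁻¹ h]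
        with x h1 h2 h3 h4
      rw [h3, Pi.sub_apply, h1, h2, h4, hθ, Pi.smul_apply, smul_eq_mul]
      field_simp
      ring
    -- The remainder lies both in `K_θ` and in `θH²`, hence is orthogonal to itself.
    have h0 : inner ℂ (f - ratL2 a P) (f - ratL2 a P) = 0 := by
      nth_rewrite 1 [heq]
      refine (Submodule.mem_orthogonal _ _).1 hd.2 _ (Submodule.subset_span ?_)
      exact ⟨_, H2.smul_mem _ hh, rfl⟩
    exact sub_eq_zero.1 (inner_self_eq_zero.1 h0)
  · rintro ⟨P, hP, rfl⟩
    exact hmem P hP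

end Blaschke

end RationalFunctions

/-! ### The generator `A_θ` in terms of polynomials, and its adjoint. -/

section ModelSpaceGenerator

/-! ### Orthogonal projections -/

theorem orthProj_eq {K : Submodule ℂ L2} {v w : L2} (hw : w ∈ K)
    (h : ∀ k ∈ K, inner ℂ k (v - w) = 0) : orthProj K v = w := by
  refine Submodule.eq_starProjection_of_mem_orthogonal (K.le_topologicalClosure hw) ?_
  rw [Submodule.orthogonal_closure, Submodule.mem_orthogonal]
  exact h

theorem orthProj_of_mem {K : Submodule ℂ L2} {v : L2} (hv : v ∈ K) : orthProj K v = v :=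
  orthProj_eq hv fun k _ => by rw [sub_self, inner_zero_right]

theorem inner_orthProj {K : Submodule ℂ L2} {k : L2} (hk : k ∈ K) (v : L2) :
    inner ℂ k (orthProj K v) = inner ℂ k v := by
  have h := Submodule.starProjection_inner_eq_zero (K := K.topologicalClosure) v k
    (K.le_topologicalClosure hk)
  rw [← inner_conj_symm, map_eq_zero, inner_sub_right, sub_eq_zero] at h
  exact h.symm

theorem orthProj_mem (K : Submodule ℂ L2) [FiniteDimensional ℂ K] (v : L2) :
    orthProj K v ∈ K := by
  have h := Submodule.starProjection_apply_mem K.topologicalClosure v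
  have hK : K.topologicalClosure = K := by
    rw [IsClosed.submodule_topologicalClosure_eq]
    exact Submodule.closed_of_finiteDimensional K
  exact (le_of_eq hK) h

/-! ### Averaged exponentials -/

/-- The function `(e^{iτz} - 1) / (iτz)`. -/
noncomputable def expMean (τ : ℝ) (z : ℂ) : ℂ :=
  ∫ s in (0 : ℝ)..1, Complex.exp (Complex.I * τ * z * s)

theorem mul_expMean (τ : ℝ) (z : ℂ) :
    Complex.I * τ * z * expMean τ z = Complex.exp (Complex.I * τ * z) - 1 := by
  by_cases h : Complex.I * τ * z = 0
  · rw [h, zero_mul, Complex.exp_zero, sub_self]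
  · rw [expMean, integral_exp_mul_complex h]
    generalize Complex.I * τ * z = c at h ⊢
    field_simp
    simp

theorem norm_exp_le_one {τ s : ℝ} (hτ : 0 ≤ τ) (hs : 0 ≤ s) {z : ℂ} (hz : 0 ≤ z.im) :
    ‖Complex.exp (Complex.I * τ * z * s)‖ ≤ 1 := by
  rw [Complex.norm_exp, Real.exp_le_one_iff]
  simp only [Complex.mul_re, Complex.I_re, Complex.ofReal_re, zero_mul, Complex.I_im,
    Complex.ofReal_im, mul_zero, sub_self, Complex.mul_im, one_mul, zero_add, zero_sub, sub_zero]
  have := mul_nonneg (mul_nonneg hτ hz) hs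
  linarith

theorem norm_exp_sub_exp_le {τ s : ℝ} (hτ : 0 ≤ τ) (hs : 0 ≤ s) (x : ℝ) {y : ℝ} (hy : 0 ≤ y) :
    ‖Complex.exp (Complex.I * τ * (x + y * Complex.I) * s) - Complex.exp (Complex.I * τ * x * s)‖
      ≤ τ * s * y := by
  have h1 : Complex.I * τ * (x + y * Complex.I) * s
      = Complex.I * τ * x * s + ((-(τ * s * y) : ℝ) : ℂ) := by
    push_cast
    linear_combination (τ * y * s : ℂ) * Complex.I_mul_I
  have h0 : 0 ≤ τ * s * y := by positivity
  rw [h1, Complex.exp_add, ← mul_sub_one, norm_mul, ← Complex.ofReal_exp, ← Complex.ofReal_one,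
    ← Complex.ofReal_sub, Complex.norm_real, Real.norm_eq_abs,
    abs_of_nonpos (by rw [sub_nonpos]; exact Real.exp_le_one_iff.2 (by linarith))]
  have h2 := norm_exp_le_one hτ hs (z := x) (by simp)
  have h3 := Real.add_one_le_exp (-(τ * s * y))
  have h4 : 0 ≤ -(Real.exp (-(τ * s * y)) - 1) := by
    have := Real.exp_le_one_iff.2 (neg_nonpos.2 h0)
    linarith
  calc _ ≤ 1 * -(Real.exp (-(τ * s * y)) - 1) := mul_le_mul_of_nonneg_right h2 h4
    _ ≤ _ := by linarith

theorem isMult_exp {τ : ℝ} (hτ : 0 ≤ τ) : IsMult (fun z => Complex.exp (Complex.I * τ * z)) where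
  holo := by fun_prop
  cont := by fun_prop
  bdd := ⟨1, fun z hz => by simpa using norm_exp_le_one hτ zero_le_one hz⟩
  lip := ⟨τ, fun x y hy => by simpa using norm_exp_sub_exp_le hτ zero_le_one x hy.le⟩

theorem norm_expMean_le {τ : ℝ} (hτ : 0 ≤ τ) {z : ℂ} (hz : 0 ≤ z.im) : ‖expMean τ z‖ ≤ 1 := by
  have := intervalIntegral.norm_integral_le_of_norm_le_const (a := (0 : ℝ)) (b := 1) (C := 1)
    (f := fun s : ℝ => Complex.exp (Complex.I * τ * z * s)) fun s hs => by
      rw [Set.uIoc_of_le zero_le_one] at hs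
      exact norm_exp_le_one hτ hs.1.le hz
  simpa [expMean] using this

theorem continuous_expMean (τ : ℝ) : Continuous (fun x : ℝ => expMean τ x) :=
  intervalIntegral.continuous_parametric_intervalIntegral_of_continuous' (by fun_prop) _ _

theorem isMult_expMean {τ : ℝ} (hτ : 0 < τ) : IsMult (expMean τ) where
  holo := by
    have h : DifferentiableOn ℂ
        (fun z : ℂ => (Complex.exp (Complex.I * τ * z) - 1) / (Complex.I * τ * z)) upper := by
      refine DifferentiableOn.div (by fun_prop) (by fun_prop) fun z hz h0 => ?_
      simp only [mul_eq_zero, Complex.I_ne_zero, Complex.ofReal_eq_zero, hτ.ne', or_self,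
        false_or] at h0
      rw [h0] at hz
      exact lt_irrefl _ (mem_upper.1 hz)
    refine h.congr fun z hz => ?_
    rw [← mul_expMean, mul_div_cancel_left₀]
    intro h0
    simp only [mul_eq_zero, Complex.I_ne_zero, Complex.ofReal_eq_zero, hτ.ne', or_self,
      false_or] at h0
    rw [h0] at hz
    exact lt_irrefl _ (mem_upper.1 hz)
  cont := continuous_expMean τ
  bdd := ⟨1, fun z hz => norm_expMean_le hτ.le hz⟩
  lip := by
    refine ⟨τ, fun x y hy => ?_⟩
    rw [expMean, expMean, ← intervalIntegral.integral_sub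
      (Continuous.intervalIntegrable (by fun_prop) _ _)
      (Continuous.intervalIntegrable (by fun_prop) _ _)]
    have := intervalIntegral.norm_integral_le_of_norm_le_const (a := (0 : ℝ)) (b := 1) (C := τ * y)
      (f := fun s : ℝ => Complex.exp (Complex.I * τ * (x + y * Complex.I) * s)
        - Complex.exp (Complex.I * τ * x * s)) fun s hs => by
        rw [Set.uIoc_of_le zero_le_one] at hs
        refine (norm_exp_sub_exp_le hτ.le hs.1.le x hy.le).trans ?_
        have := mul_le_mul_of_nonneg_left hs.2 (mul_nonneg hτ.le hy.le)
        linarith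
    simpa using this

/-- These functions are bounded by `1` and tend to `1` as `τ → 0+`, so they stand in for the
constant `1`, which is not in `H²`. They also occur in the difference quotient of the semigroup. -/
theorem hasBoundary_expMean {τ : ℝ} (hτ : 0 < τ) :
    MemLp (fun x : ℝ => expMean τ x) 2 volume ∧
      HasBoundary (expMean τ) (toL2 (fun x : ℝ => expMean τ x)) := by
  have hr : (-Complex.I).im < 0 := by simp
  have hτ0 : (τ : ℂ) ≠ 0 := Complex.ofReal_ne_zero.2 hτ.ne'
  -- The factor `z` is harmless because `iτz · expMean τ z = e^{iτz} - 1` is bounded; thus `expMean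
  -- τ` is a multiplier times the kernel `1/(z + i)`.
  have hβ : IsMult (fun z => (z + Complex.I) * expMean τ z) := by
    refine (((IsMult.const (Complex.I * τ)⁻¹).mul ((isMult_exp hτ.le).add (IsMult.const (-1)))).add
      ((IsMult.const Complex.I).mul (isMult_expMean hτ))).congr fun z _ => ?_
    rw [← sub_eq_add_neg, ← mul_expMean]
    field_simp
  have heq : ∀ z : ℂ, 0 ≤ z.im →
      (z + Complex.I) * expMean τ z * (1 / (z - -Complex.I)) = expMean τ z := by
    intro z hz
    have := ne_of_im_pos_of_im_neg hz hr
    rw [sub_neg_eq_add] at this ⊢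
    field_simp
  have hmem : MemLp (fun x : ℝ => expMean τ x) 2 volume :=
    (hβ.memLp (memLp_kernelFun hr.ne)).ae_eq (Eventually.of_forall fun x => heq x (by simp))
  refine ⟨hmem, ?_⟩
  have h1 := ((hasBoundary_kernel hr).mul hβ).congr (G := expMean τ)
    fun z hz => (heq z (mem_upper.1 hz).le).symm
  convert h1 using 1
  refine toL2_congr ?_
  filter_upwards [coe_toL2 (memLp_kernelFun hr.ne)] with x hx
  rw [hx, kernelFun]
  exact (heq x (by simp)).symm

theorem tendsto_expMean (x : ℝ) :
    Tendsto (fun τ : ℝ => expMean τ x) (𝓝[>] 0) (𝓝 1) := by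
  have h : Continuous (fun τ : ℝ => expMean τ x) :=
    intervalIntegral.continuous_parametric_intervalIntegral_of_continuous' (by fun_prop) _ _
  have h1 := (h.tendsto 0).mono_left (nhdsWithin_le_nhds (s := Set.Ioi (0 : ℝ)))
  simpa [expMean] using h1

theorem memLp_expMean_mul {τ : ℝ} (hτ : 0 ≤ τ) (h : L2) :
    MemLp (fun x : ℝ => expMean τ x * h x) 2 volume := by
  refine MemLp.of_le_mul (c := 1) (memLp_coe h)
    ((continuous_expMean τ).aestronglyMeasurable.mul (memLp_coe h).1)
    (Eventually.of_forall fun x => ?_)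
  rw [norm_mul]
  exact mul_le_mul_of_nonneg_right (norm_expMean_le hτ (by simp)) (norm_nonneg _)

theorem norm_sq_eq_integral (f : L2) : ‖f‖ ^ 2 = ∫ x, ‖f x‖ ^ 2 := by
  have h := inner_self_eq_norm_sq_to_K (𝕜 := ℂ) f
  rw [inner_eq_integral] at h
  have h2 : (fun x => conj (f x) * f x) = fun x => ((‖f x‖ ^ 2 : ℝ) : ℂ) := by
    funext x
    rw [mul_comm, Complex.mul_conj, Complex.normSq_eq_norm_sq]
  rw [h2, integral_complex_ofReal] at h
  exact Complex.ofReal_injective ((Complex.ofReal_pow _ _).trans h.symm)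

theorem tendsto_expMean_mul (h : L2) :
    Tendsto (fun τ : ℝ => toL2 (fun x : ℝ => expMean τ x * h x)) (𝓝[>] 0) (𝓝 h) := by
  rw [tendsto_iff_norm_sub_tendsto_zero]
  have hsq : Tendsto (fun τ : ℝ => ‖toL2 (fun x : ℝ => expMean τ x * h x) - h‖ ^ 2)
      (𝓝[>] 0) (𝓝 0) := by
    have hint : Integrable (fun x => 4 * ‖h x‖ ^ 2) :=
      ((memLp_two_iff_integrable_sq_norm (memLp_coe h).1).1 (memLp_coe h)).const_mul 4
    have hlim := tendsto_integral_filter_of_dominated_convergence (μ := volume) (l := 𝓝[>] (0 : ℝ))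
      (F := fun (τ : ℝ) (x : ℝ) => ‖expMean τ x * h x - h x‖ ^ 2) (f := fun _ => (0 : ℝ))
      (fun x => 4 * ‖h x‖ ^ 2) ?_ ?_ hint ?_
    · rw [integral_zero] at hlim
      refine hlim.congr' ?_
      filter_upwards [self_mem_nhdsWithin] with τ hτ
      rw [norm_sq_eq_integral]
      refine integral_congr_ae ?_
      filter_upwards [coe_toL2 (memLp_expMean_mul (le_of_lt hτ) h),
        Lp.coeFn_sub (toL2 (fun x : ℝ => expMean τ x * h x)) h] with x h1 h2
      rw [h2, Pi.sub_apply, h1]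
    · filter_upwards [self_mem_nhdsWithin] with τ hτ
      exact ((memLp_expMean_mul (le_of_lt hτ) h).1.sub (memLp_coe h).1).norm.pow 2
    · filter_upwards [self_mem_nhdsWithin] with τ hτ
      refine Eventually.of_forall fun x => ?_
      have h1 : ‖expMean τ x * h x - h x‖ ≤ 2 * ‖h x‖ := by
        rw [← sub_one_mul, norm_mul]
        refine mul_le_mul_of_nonneg_right ((norm_sub_le _ _).trans ?_) (norm_nonneg _)
        have := norm_expMean_le (le_of_lt hτ) (z := x) (by simp)
        rw [norm_one]
        linarith
      rw [norm_pow, norm_norm]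
      calc _ ≤ (2 * ‖h x‖) ^ 2 := pow_le_pow_left₀ (norm_nonneg _) h1 2
        _ = _ := by ring
    · refine Eventually.of_forall fun x => ?_
      have h1 := (((tendsto_expMean x).mul_const (h x)).sub_const (h x)).norm.pow 2
      simpa using h1
  have := (Real.continuous_sqrt.tendsto 0).comp hsq
  simpa [Function.comp_def, Real.sqrt_sq] using this

/-! ### The generator of the semigroup on a model space -/

section Generator

variable {m : ℕ} {a : Fin m → ℂ}

/-- The coefficient of `1/x` in the expansion of `P / ∏ (x - conj a_j)` at infinity. -/
noncomputable def topCoeff (m : ℕ) (P : Polynomial ℂ) : ℂ := P.coeff (m - 1)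

/-- The numerator of `x f - c_f R / ∏ (x - conj a_j)` for `f = P / ∏ (x - conj a_j)`. -/
noncomputable def shiftPoly (m : ℕ) (R P : Polynomial ℂ) : Polynomial ℂ :=
  Polynomial.X * P - Polynomial.C (topCoeff m P) * R

/-- The coefficient of `x^m` in `xP` is `topCoeff m P`, and subtracting that multiple of a monic
polynomial of degree `m` removes it. -/
theorem degree_shiftPoly {R P : Polynomial ℂ} (hR : R.Monic) (hRm : R.natDegree = m)
    (hP : P.degree < m) : (shiftPoly m R P).degree < m := by
  rw [Polynomial.degree_lt_iff_coeff_zero] at hP ⊢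
  intro k hk
  rw [shiftPoly, Polynomial.coeff_sub, Polynomial.coeff_C_mul, topCoeff]
  cases k with
  | zero =>
    -- Here `m = 0`: the truncated difference `m - 1` is `0`, and all coefficients of `P` vanish.
    rw [Polynomial.coeff_X_mul_zero, hP (m - 1) (by lia), zero_mul, sub_zero]
  | succ k =>
    rw [Polynomial.coeff_X_mul]
    rcases hk.lt_or_eq with h | h
    · rw [hP k (by lia), Polynomial.coeff_eq_zero_of_natDegree_lt (p := R) (by lia), mul_zero, sub_zero]
    · subst h
      have h1 := hR.coeff_natDegree
      rw [hRm] at h1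
      simp [h1]

theorem degree_const_mul {c : ℂ} {P : Polynomial ℂ} (hP : P.degree < m) :
    (Polynomial.C c * P).degree < m := by
  rw [← Polynomial.smul_eq_C_mul]
  exact (Polynomial.degree_smul_le _ _).trans_lt hP

theorem degree_add_lt {P R : Polynomial ℂ} (hP : P.degree < m) (hR : R.degree < m) :
    (P + R).degree < m := (Polynomial.degree_add_le _ _).trans_lt (max_lt hP hR)

theorem degree_den_sub_num : (den a - num a).degree < m := by
  rw [← degree_den a]
  refine Polynomial.degree_sub_lt_left ?_ (monic_den a).ne_zero ?_
  · rw [degree_den, degree_num]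
  · rw [(monic_den a).leadingCoeff, (monic_num a).leadingCoeff]

theorem eval_shiftPoly (R P : Polynomial ℂ) (z : ℂ) :
    (shiftPoly m R P).eval z = z * P.eval z - topCoeff m P * R.eval z := by
  simp [shiftPoly]

/-- Removing the `1/x` term makes the function `O(x⁻²)` while keeping it free of poles above;
concretely it is the kernel `1/(x + i)` times an element of the Hardy space, to which Cauchy's
theorem applies. -/
theorem integral_rat_sub_kernel (ha : ∀ j, 0 < (a j).im) {P : Polynomial ℂ} (hP : P.degree < m) :
    Integrable (fun x : ℝ => P.eval (x : ℂ) / (den a).eval (x : ℂ)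
      - topCoeff m P * kernelFun (-Complex.I) x) ∧
    ∫ x : ℝ, (P.eval (x : ℂ) / (den a).eval (x : ℂ)
      - topCoeff m P * kernelFun (-Complex.I) x) = 0 := by
  have hr : (-Complex.I).im < 0 := by simp
  set R := shiftPoly m (den a) P + Polynomial.C Complex.I * P
  have hR : R.degree < m := degree_add_lt (degree_shiftPoly (monic_den a) (natDegree_den a) hP)
    (degree_const_mul hP)
  have heq : (fun x : ℝ => kernelFun (-Complex.I) x * (R.eval (x : ℂ) / (den a).eval (x : ℂ)))
      = fun x : ℝ => P.eval (x : ℂ) / (den a).eval (x : ℂ)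
        - topCoeff m P * kernelFun (-Complex.I) x := by
    funext x
    have h1 := line_sub_ne_zero x hr.ne
    have h2 := noUpperRoots_den ha x (by simp)
    simp only [R, kernelFun, Polynomial.eval_add, eval_shiftPoly, Polynomial.eval_mul,
      Polynomial.eval_C]
    rw [sub_neg_eq_add] at h1 ⊢
    field_simp
    ring
  rw [← heq]
  refine ⟨integrable_mul_of_memLp (memLp_kernelFun hr.ne) (memLp_rat ha hR), ?_⟩
  rw [← integral_kernel_mul_eq_zero (hasBoundary_ratL2 ha hR) hr]
  refine integral_congr_ae ?_
  filter_upwards [coe_ratL2 ha hR] with x hx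
  rw [hx]

theorem integral_kernel_sub_conj :
    Integrable (fun x : ℝ => kernelFun (-Complex.I) x - conj (kernelFun (-Complex.I) x)) ∧
    ∫ x : ℝ, (kernelFun (-Complex.I) x - conj (kernelFun (-Complex.I) x))
      = -(2 * Real.pi * Complex.I) := by
  have h : (fun x : ℝ => kernelFun (-Complex.I) x - conj (kernelFun (-Complex.I) x))
      = fun x : ℝ => (-2 * Complex.I) * (((1 + x ^ 2)⁻¹ : ℝ) : ℂ) := by
    funext x
    have h1 := line_sub_ne_zero x (w := -Complex.I) (by simp)
    have h2 := line_sub_ne_zero x (w := Complex.I) (by simp)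
    have h3 : (1 + (x : ℂ) ^ 2) = (x - -Complex.I) * (x - Complex.I) := by
      linear_combination Complex.I_mul_I
    simp only [kernelFun, map_div₀, map_one, map_sub, map_neg, Complex.conj_I,
      Complex.conj_ofReal, neg_neg]
    push_cast
    rw [h3]
    field_simp
    ring
  rw [h]
  refine ⟨integrable_inv_one_add_sq.ofReal.const_mul _, ?_⟩
  rw [integral_const_mul, integral_complex_ofReal, integral_univ_inv_one_add_sq]
  ring

/-- With `f = P/den`, on the real line `conj(1 - θ) f = f - conj g`, where `g = conjPoly P / den` is
again analytic above and has the conjugate `1/x` coefficient. After regularising both terms with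
`1/(x + i)`, only the integral of `1/(x + i) - 1/(x - i)` survives, so pairing with `1 - θ` reads
off the coefficient at infinity. -/
theorem inner_ratL2_den_sub_num (ha : ∀ j, 0 < (a j).im) {P : Polynomial ℂ} (hP : P.degree < m) :
    inner ℂ (ratL2 a (den a - num a)) (ratL2 a P) = -(2 * Real.pi * Complex.I) * topCoeff m P := by
  have hP' : (conjPoly P).degree < m := by rwa [degree_conjPoly]
  have h1 := integral_rat_sub_kernel ha hP
  have h2 := integral_rat_sub_kernel ha hP'
  have h3 := integral_kernel_sub_conj
  have hint : ∀ A B C : ℝ → ℂ, Integrable A → Integrable B → Integrable C →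
      ∫ x, (A x - B x + C x) = (∫ x, A x) - (∫ x, B x) + ∫ x, C x := by
    intro A B C hA hB hC
    have h := integral_add (hA.sub hB) hC
    simp only [Pi.sub_apply] at h
    rw [h, integral_sub hA hB]
  have h2i : Integrable (fun x : ℝ => conj ((conjPoly P).eval (x : ℂ) / (den a).eval (x : ℂ)
      - topCoeff m (conjPoly P) * kernelFun (-Complex.I) x)) :=
    Complex.conjLIE.toContinuousLinearEquiv.toContinuousLinearMap.integrable_comp h2.1
  rw [ratL2, ratL2, inner_toL2_toL2 (memLp_rat ha degree_den_sub_num) (memLp_rat ha hP)]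
  calc _ = ∫ x : ℝ, ((P.eval (x : ℂ) / (den a).eval (x : ℂ)
          - topCoeff m P * kernelFun (-Complex.I) x)
        - conj ((conjPoly P).eval (x : ℂ) / (den a).eval (x : ℂ)
          - topCoeff m (conjPoly P) * kernelFun (-Complex.I) x)
        + topCoeff m P * (kernelFun (-Complex.I) x - conj (kernelFun (-Complex.I) x))) := by
        congr 1
        funext x
        have h1 := noUpperRoots_den ha x (by simp)
        have h2 := eval_num_ne_zero ha x
        simp only [topCoeff, coeff_conjPoly, map_sub, map_mul, map_div₀, eval_conjPoly,
          conj_eval_den, conj_eval_num, Complex.conj_conj, Polynomial.eval_sub]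
        field_simp
        ring
    _ = _ := by
        rw [hint _ _ _ h1.1 h2i (h3.1.const_mul _),
          integral_const_mul, h1.2, integral_conj, h2.2, h3.2, map_zero]
        ring

/-- The terms with `x` cancel because `x` is real. The rest of the difference of the integrands is
the conjugate of `S/den`, analytic above; the two `1/x` coefficients in `S` cancel, so its integral
is zero. -/
theorem inner_shiftPoly (ha : ∀ j, 0 < (a j).im) {P R : Polynomial ℂ} (hP : P.degree < m)
    (hR : R.degree < m) :
    inner ℂ (ratL2 a (shiftPoly m (num a) P)) (ratL2 a R)
      = inner ℂ (ratL2 a P) (ratL2 a (shiftPoly m (den a) R)) := by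
  have hP1 := degree_shiftPoly (monic_num a) (natDegree_num a) hP
  have hR1 := degree_shiftPoly (monic_den a) (natDegree_den a) hR
  have hR' : (conjPoly R).degree < m := by rwa [degree_conjPoly]
  set S := Polynomial.C (conj (topCoeff m R)) * P + Polynomial.C (-topCoeff m P) * conjPoly R
  have hS : S.degree < m := degree_add_lt (degree_const_mul hP) (degree_const_mul hR')
  have h1 := integral_rat_sub_kernel ha hS
  have hS0 : topCoeff m S = 0 := by
    simp only [S, topCoeff, Polynomial.coeff_add, Polynomial.coeff_C_mul, coeff_conjPoly]
    ring
  have h2 : ∫ x : ℝ, conj (S.eval (x : ℂ) / (den a).eval (x : ℂ)) = 0 := by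
    have := h1.2
    simp only [hS0, zero_mul, sub_zero] at this
    rw [integral_conj, this, map_zero]
  simp only [ratL2]
  rw [inner_toL2_toL2 (memLp_rat ha hP1) (memLp_rat ha hR),
    inner_toL2_toL2 (memLp_rat ha hP) (memLp_rat ha hR1), ← sub_eq_zero, ← integral_sub
      (integrable_mul_of_memLp (memLp_conj (memLp_rat ha hP1)) (memLp_rat ha hR))
      (integrable_mul_of_memLp (memLp_conj (memLp_rat ha hP)) (memLp_rat ha hR1)), ← h2]
  congr 1
  funext x
  have h1 := noUpperRoots_den ha x (by simp)
  have h2 := eval_num_ne_zero ha x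
  simp only [S, eval_shiftPoly, map_sub, map_mul, map_div₀, eval_conjPoly, conj_eval_den,
    conj_eval_num, Complex.conj_conj, Complex.conj_ofReal, Polynomial.eval_add,
    Polynomial.eval_mul, Polynomial.eval_C, map_add, map_neg, Polynomial.eval_neg]
  field_simp
  ring

/-- The difference quotient `(e^{iτx} - 1)f/(iτ)` equals `expMean τ · x f`, and `x f = h + c_f θ`
with `h` in the model space. The term `c_f θ · expMean τ` lies in `θH²` and is killed by the
projection, while `expMean τ · h → h`. -/
theorem generator_ratL2 (ha : ∀ j, 0 < (a j).im) {θ : ℂ → ℂ}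
    (hθ : ∀ z, θ z = (num a).eval z / (den a).eval z) {P : Polynomial ℂ} (hP : P.degree < m) :
    generator θ (ratL2 a P) = ratL2 a (shiftPoly m (num a) P) := by
  have hP1 := degree_shiftPoly (monic_num a) (natDegree_num a) hP
  have hK : ∀ R : Polynomial ℂ, R.degree < m → ratL2 a R ∈ modelSpace θ := fun R hR =>
    (mem_modelSpace_iff ha one_ne_zero (fun z => by rw [hθ, one_mul])).2 ⟨R, hR, rfl⟩
  have hmult : IsMult θ := (isMult_num_div_den ha).congr fun z _ => hθ z
  set h := ratL2 a (shiftPoly m (num a) P)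
  set f := ratL2 a P
  have hlim : Tendsto (fun τ : ℝ => orthProj (modelSpace θ)
      (toL2 (fun x : ℝ => expMean τ x * h x))) (𝓝[>] 0) (𝓝 h) := by
    have h1 := ((orthProj (modelSpace θ)).continuous.tendsto h).comp (tendsto_expMean_mul h)
    rwa [orthProj_of_mem (hK _ hP1)] at h1
  refine Tendsto.limUnder_eq (hlim.congr' ?_)
  filter_upwards [self_mem_nhdsWithin] with τ hτ
  have hτ : 0 < τ := hτ
  have hτ0 : (τ : ℂ) ≠ 0 := Complex.ofReal_ne_zero.2 hτ.ne'
  have hm := hasBoundary_expMean hτ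
  set g := toL2 (fun x : ℝ => expMean τ x) with hg
  have hθg : MemLp (fun x : ℝ => θ x * g x) 2 volume := hmult.memLp (memLp_coe g)
  have hef : MemLp (fun x : ℝ => Complex.exp (Complex.I * τ * x) * f x) 2 volume :=
    (isMult_exp hτ.le).memLp (memLp_coe f)
  have heq : toL2 (fun x : ℝ => expMean τ x * h x)
      = (Complex.I * τ : ℂ)⁻¹ • (toL2 (fun x : ℝ => Complex.exp (Complex.I * τ * x) * f x) - f)
        - topCoeff m P • toL2 (fun x : ℝ => θ x * g x) := by
    refine toL2_eq ?_
    filter_upwards [coe_ratL2 ha hP, coe_ratL2 ha hP1, coe_toL2 hm.1, coe_toL2 hθg, coe_toL2 hef,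
      Lp.coeFn_sub ((Complex.I * τ : ℂ)⁻¹ •
        (toL2 (fun x : ℝ => Complex.exp (Complex.I * τ * x) * f x) - f))
        (topCoeff m P • toL2 (fun x : ℝ => θ x * g x)),
      Lp.coeFn_smul (Complex.I * τ : ℂ)⁻¹
        (toL2 (fun x : ℝ => Complex.exp (Complex.I * τ * x) * f x) - f),
      Lp.coeFn_sub (toL2 (fun x : ℝ => Complex.exp (Complex.I * τ * x) * f x)) f,
      Lp.coeFn_smul (topCoeff m P) (toL2 (fun x : ℝ => θ x * g x))]
      with x h1 h2 h3 h4 h5 h6 h7 h8 h9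
    have hx1 := noUpperRoots_den ha x (by simp)
    rw [h6, Pi.sub_apply, h7, h9, Pi.smul_apply, Pi.smul_apply, h8, Pi.sub_apply, h4, h5, h3, h2,
      h1, smul_eq_mul, smul_eq_mul, hθ, eval_shiftPoly, ← sub_one_mul, ← mul_expMean]
    field_simp
  rw [heq, map_sub, map_smul, map_smul, map_sub, orthProj_of_mem (hK _ hP),
    orthProj_eq (K := modelSpace θ) (w := 0) (Submodule.zero_mem _) (v := toL2 fun x => θ x * g x),
    smul_zero, sub_zero, semigroup]
  intro k hk
  rw [sub_zero, ← inner_conj_symm, (Submodule.mem_orthogonal _ _).1 hk.2, map_zero]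
  exact Submodule.subset_span ⟨g, hm.2.mem_H2, rfl⟩

end Generator

end ModelSpaceGenerator

/-! ### The adjoint of the generator, its eigenvectors and its resolvent. -/

section BackwardShift

/-! ### The backward shift on a model space -/

/-- The coefficient of `1/x` at infinity of `f ∈ K_θ`. -/
noncomputable def topFunctional (θ : ℂ → ℂ) (f : L2) : ℂ :=
  Complex.I / (2 * Real.pi) * inner ℂ (oneSub θ) f

/-- The adjoint of the generator, `f ↦ x f - c_f`. -/
noncomputable def backShift (θ : ℂ → ℂ) (f : L2) : L2 :=
  generator θ f - topFunctional θ f • oneSub θ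

theorem topFunctional_add (θ : ℂ → ℂ) (f g : L2) :
    topFunctional θ (f + g) = topFunctional θ f + topFunctional θ g := by
  simp only [topFunctional, inner_add_right, mul_add]

theorem topFunctional_smul (θ : ℂ → ℂ) (c : ℂ) (f : L2) :
    topFunctional θ (c • f) = c * topFunctional θ f := by
  simp only [topFunctional, inner_smul_right]
  ring

theorem topFunctional_eq_zero_iff {θ : ℂ → ℂ} {f : L2} :
    topFunctional θ f = 0 ↔ inner ℂ (oneSub θ) f = 0 := by
  rw [topFunctional, mul_eq_zero, or_iff_right]
  simp [Real.pi_ne_zero]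

theorem norm_sub_lt_norm_sub_conj {z a : ℂ} (hz : 0 < z.im) (ha : 0 < a.im) :
    ‖z - a‖ < ‖z - conj a‖ := by
  rw [← abs_of_nonneg (norm_nonneg (z - a)), ← abs_of_nonneg (norm_nonneg (z - conj a)),
    ← sq_lt_sq, ← Complex.normSq_eq_norm_sq, ← Complex.normSq_eq_norm_sq, Complex.normSq_apply,
    Complex.normSq_apply]
  simp only [Complex.sub_re, Complex.sub_im, Complex.conj_re, Complex.conj_im]
  nlinarith [mul_pos hz ha]

/-- Every factor tends to `1` at infinity, so the normalisation forces the unimodular constant to be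
`1`. -/
theorem IsNormalizedBlaschke.exists_rep {θ : ℂ → ℂ} (hθ : IsNormalizedBlaschke θ) :
    ∃ (m : ℕ) (a : Fin m → ℂ), (∀ j, 0 < (a j).im) ∧
      (∀ z, θ z = (num a).eval z / (den a).eval z) ∧
      ∀ z, θ z = ∏ j, (z - a j) / (z - conj (a j)) := by
  obtain ⟨α, m, a, ha, h⟩ := hθ.blaschke
  have hfac : ∀ j, Tendsto (fun z : ℂ => (z - a j) / (z - conj (a j)))
      (Bornology.cobounded ℂ) (𝓝 1) := by
    intro j
    have h1 : Tendsto (fun z : ℂ => 1 + (conj (a j) - a j) * (z - conj (a j))⁻¹)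
        (Bornology.cobounded ℂ) (𝓝 (1 + (conj (a j) - a j) * 0)) := by
      refine tendsto_const_nhds.add (tendsto_const_nhds.mul ?_)
      exact tendsto_inv₀_cobounded.comp (tendsto_sub_const_cobounded _)
    rw [mul_zero, add_zero] at h1
    refine h1.congr' ?_
    have hne : ∀ᶠ z : ℂ in Bornology.cobounded ℂ, z ≠ conj (a j) :=
      Bornology.isBounded_singleton
    filter_upwards [hne] with z hz
    have := sub_ne_zero.2 hz
    field_simp
    ring
  have hlim := (tendsto_finsetProd Finset.univ fun j _ => hfac j).const_mul
    (Complex.exp (α * Complex.I))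
  rw [Finset.prod_const_one, mul_one] at hlim
  have h1 : Complex.exp (α * Complex.I) = 1 :=
    tendsto_nhds_unique (hlim.congr fun z => (h z).symm) hθ.at_infty
  have h2 : ∀ z, θ z = ∏ j, (z - a j) / (z - conj (a j)) := fun z => by rw [h, h1, one_mul]
  refine ⟨m, a, ha, fun z => ?_, h2⟩
  rw [h2, Finset.prod_div_distrib, num, den, Polynomial.eval_prod, Polynomial.eval_prod]
  simp

variable {θ : ℂ → ℂ}

section Rep

variable {m : ℕ} {a : Fin m → ℂ}

theorem mem_modelSpace_iff_exists_ratL2 (ha : ∀ j, 0 < (a j).im)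
    (hθ : ∀ z, θ z = (num a).eval z / (den a).eval z) {f : L2} :
    f ∈ modelSpace θ ↔ ∃ P : Polynomial ℂ, P.degree < m ∧ f = ratL2 a P :=
  mem_modelSpace_iff ha one_ne_zero (fun z => by rw [hθ, one_mul])

theorem oneSub_eq_ratL2 (ha : ∀ j, 0 < (a j).im)
    (hθ : ∀ z, θ z = (num a).eval z / (den a).eval z) : oneSub θ = ratL2 a (den a - num a) := by
  rw [oneSub, ratL2]
  congr 1
  funext x
  have h1 := noUpperRoots_den ha x (by simp)
  rw [hθ, Polynomial.eval_sub]
  field_simp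

theorem topFunctional_ratL2 (ha : ∀ j, 0 < (a j).im)
    (hθ : ∀ z, θ z = (num a).eval z / (den a).eval z) {P : Polynomial ℂ} (hP : P.degree < m) :
    topFunctional θ (ratL2 a P) = topCoeff m P := by
  have hpi : (Real.pi : ℂ) ≠ 0 := Complex.ofReal_ne_zero.2 Real.pi_ne_zero
  rw [topFunctional, oneSub_eq_ratL2 ha hθ, inner_ratL2_den_sub_num ha hP]
  field_simp
  linear_combination -topCoeff m P * Complex.I_sq

theorem backShift_ratL2 (ha : ∀ j, 0 < (a j).im)
    (hθ : ∀ z, θ z = (num a).eval z / (den a).eval z) {P : Polynomial ℂ} (hP : P.degree < m) :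
    backShift θ (ratL2 a P) = ratL2 a (shiftPoly m (den a) P) := by
  rw [backShift, generator_ratL2 ha hθ hP, topFunctional_ratL2 ha hθ hP, oneSub_eq_ratL2 ha hθ,
    sub_eq_iff_eq_add, ← ratL2_smul ha _ degree_den_sub_num,
    ← ratL2_add ha (degree_shiftPoly (monic_den a) (natDegree_den a) hP)
      (degree_const_mul degree_den_sub_num)]
  congr 1
  rw [shiftPoly, shiftPoly]
  ring

end Rep

theorem oneSub_mem (hθ : IsNormalizedBlaschke θ) : oneSub θ ∈ modelSpace θ := by
  obtain ⟨m, a, ha, h, -⟩ := hθ.exists_rep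
  exact (mem_modelSpace_iff_exists_ratL2 ha h).2 ⟨_, degree_den_sub_num, oneSub_eq_ratL2 ha h⟩

theorem finiteDimensional_modelSpace (hθ : IsNormalizedBlaschke θ) :
    FiniteDimensional ℂ (modelSpace θ) := by
  obtain ⟨m, a, ha, h, -⟩ := hθ.exists_rep
  let φ : Polynomial.degreeLT ℂ m →ₗ[ℂ] L2 :=
    { toFun := fun P => ratL2 a P
      map_add' := fun P R => ratL2_add ha (Polynomial.mem_degreeLT.1 P.2)
        (Polynomial.mem_degreeLT.1 R.2)
      map_smul' := fun c P => by
        simp only [SetLike.val_smul, Polynomial.smul_eq_C_mul, RingHom.id_apply]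
        exact ratL2_smul ha c (Polynomial.mem_degreeLT.1 P.2) }
  have hfin : FiniteDimensional ℂ (Polynomial.degreeLT ℂ m) :=
    (Polynomial.degreeLTEquiv ℂ m).symm.finiteDimensional
  have hK : modelSpace θ = LinearMap.range φ := by
    ext f
    rw [mem_modelSpace_iff_exists_ratL2 ha h, LinearMap.mem_range]
    constructor
    · rintro ⟨P, hP, rfl⟩
      exact ⟨⟨P, Polynomial.mem_degreeLT.2 hP⟩, rfl⟩
    · rintro ⟨P, rfl⟩
      exact ⟨P, Polynomial.mem_degreeLT.1 P.2, rfl⟩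
  rw [hK]
  infer_instance

theorem generator_mem (hθ : IsNormalizedBlaschke θ) {f : L2} (hf : f ∈ modelSpace θ) :
    generator θ f ∈ modelSpace θ := by
  obtain ⟨m, a, ha, h, -⟩ := hθ.exists_rep
  obtain ⟨P, hP, rfl⟩ := (mem_modelSpace_iff_exists_ratL2 ha h).1 hf
  rw [generator_ratL2 ha h hP]
  exact (mem_modelSpace_iff_exists_ratL2 ha h).2
    ⟨_, degree_shiftPoly (monic_num a) (natDegree_num a) hP, rfl⟩

theorem backShift_mem (hθ : IsNormalizedBlaschke θ) {f : L2} (hf : f ∈ modelSpace θ) :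
    backShift θ f ∈ modelSpace θ :=
  Submodule.sub_mem _ (generator_mem hθ hf) (Submodule.smul_mem _ _ (oneSub_mem hθ))

theorem generator_eq (θ : ℂ → ℂ) (f : L2) :
    generator θ f = backShift θ f + topFunctional θ f • oneSub θ := by
  rw [backShift, sub_add_cancel]

theorem ext_backShift (hθ : IsNormalizedBlaschke θ) {f : L2} (hf : f ∈ modelSpace θ) {z : ℂ}
    (hz : z ∈ upper) : ext (backShift θ f) z = z * ext f z - topFunctional θ f := by
  obtain ⟨m, a, ha, h, -⟩ := hθ.exists_rep
  obtain ⟨P, hP, rfl⟩ := (mem_modelSpace_iff_exists_ratL2 ha h).1 hf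
  have hz1 := noUpperRoots_den ha z (mem_upper.1 hz).le
  rw [backShift_ratL2 ha h hP, topFunctional_ratL2 ha h hP,
    (hasBoundary_ratL2 ha hP).ext_eq hz, (hasBoundary_ratL2 ha
      (degree_shiftPoly (monic_den a) (natDegree_den a) hP)).ext_eq hz, eval_shiftPoly]
  field_simp

theorem coe_generator (hθ : IsNormalizedBlaschke θ) {f : L2} (hf : f ∈ modelSpace θ) :
    ∀ᵐ x : ℝ, generator θ f x = x * f x - topFunctional θ f * θ x := by
  obtain ⟨m, a, ha, h, -⟩ := hθ.exists_rep
  obtain ⟨P, hP, rfl⟩ := (mem_modelSpace_iff_exists_ratL2 ha h).1 hf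
  rw [generator_ratL2 ha h hP, topFunctional_ratL2 ha h hP]
  filter_upwards [coe_ratL2 ha hP,
    coe_ratL2 ha (degree_shiftPoly (monic_num a) (natDegree_num a) hP)] with x h1 h2
  have hx1 := noUpperRoots_den ha x (by simp)
  rw [h1, h2, h, eval_shiftPoly]
  field_simp

theorem inner_backShift (hθ : IsNormalizedBlaschke θ) {f g : L2} (hf : f ∈ modelSpace θ)
    (hg : g ∈ modelSpace θ) :
    inner ℂ g (backShift θ f) = inner ℂ (generator θ g) f := by
  obtain ⟨m, a, ha, h, -⟩ := hθ.exists_rep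
  obtain ⟨P, hP, rfl⟩ := (mem_modelSpace_iff_exists_ratL2 ha h).1 hf
  obtain ⟨R, hR, rfl⟩ := (mem_modelSpace_iff_exists_ratL2 ha h).1 hg
  rw [backShift_ratL2 ha h hP, generator_ratL2 ha h hR, inner_shiftPoly ha hR hP]

theorem backShift_add (hθ : IsNormalizedBlaschke θ) {f g : L2} (hf : f ∈ modelSpace θ)
    (hg : g ∈ modelSpace θ) : backShift θ (f + g) = backShift θ f + backShift θ g := by
  have hfg := Submodule.add_mem _ hf hg
  refine eq_of_ext_eq (backShift_mem hθ hfg).1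
    (Submodule.add_mem _ (backShift_mem hθ hf) (backShift_mem hθ hg)).1 fun z hz => ?_
  rw [ext_add, ext_backShift hθ hfg hz, ext_backShift hθ hf hz, ext_backShift hθ hg hz, ext_add,
    topFunctional_add]
  ring

theorem backShift_smul (hθ : IsNormalizedBlaschke θ) (c : ℂ) {f : L2} (hf : f ∈ modelSpace θ) :
    backShift θ (c • f) = c • backShift θ f := by
  have hcf := Submodule.smul_mem _ c hf
  refine eq_of_ext_eq (backShift_mem hθ hcf).1
    (Submodule.smul_mem _ c (backShift_mem hθ hf)).1 fun z hz => ?_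
  rw [ext_smul, ext_backShift hθ hcf hz, ext_backShift hθ hf hz, ext_smul, topFunctional_smul]
  ring

theorem generator_smul (hθ : IsNormalizedBlaschke θ) (c : ℂ) {f : L2} (hf : f ∈ modelSpace θ) :
    generator θ (c • f) = c • generator θ f := by
  rw [generator_eq, generator_eq θ f, backShift_smul hθ c hf, topFunctional_smul]
  module

/-- The backward shift as a linear map. -/
noncomputable def backShiftLin (hθ : IsNormalizedBlaschke θ) :
    modelSpace θ →ₗ[ℂ] modelSpace θ where
  toFun f := ⟨backShift θ f, backShift_mem hθ f.2⟩
  map_add' f g := Subtype.ext (backShift_add hθ f.2 g.2)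
  map_smul' c f := Subtype.ext (backShift_smul hθ c f.2)

theorem isMult_blaschke (hθ : IsNormalizedBlaschke θ) : IsMult θ := by
  obtain ⟨m, a, ha, h, -⟩ := hθ.exists_rep
  exact (isMult_num_div_den ha).congr fun z _ => h z

theorem inner_blaschke_mul {f h : L2} (hf : f ∈ modelSpace θ) (hh : h ∈ H2) :
    inner ℂ (toL2 (fun x => θ x * h x)) f = 0 :=
  (Submodule.mem_orthogonal _ _).1 hf.2 _ (Submodule.subset_span ⟨h, hh, rfl⟩)

theorem memLp_oneSub (hθ : IsNormalizedBlaschke θ) :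
    MemLp (fun x : ℝ => 1 - θ x) 2 volume := by
  obtain ⟨m, a, ha, h, -⟩ := hθ.exists_rep
  refine (memLp_rat ha (degree_den_sub_num (a := a))).ae_eq (Eventually.of_forall fun x => ?_)
  have h1 := noUpperRoots_den ha x (by simp)
  simp only [h, Polynomial.eval_sub]
  field_simp

theorem ext_oneSub (hθ : IsNormalizedBlaschke θ) {z : ℂ} (hz : z ∈ upper) :
    ext (oneSub θ) z = 1 - θ z := by
  obtain ⟨m, a, ha, h, -⟩ := hθ.exists_rep
  have hz1 := noUpperRoots_den ha z (mem_upper.1 hz).le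
  rw [oneSub_eq_ratL2 ha h, (hasBoundary_ratL2 ha degree_den_sub_num).ext_eq hz, h,
    Polynomial.eval_sub]
  field_simp

theorem norm_blaschke_lt_one (hθ : IsNormalizedBlaschke θ) (hne : modelSpace θ ≠ ⊥) {z : ℂ}
    (hz : z ∈ upper) : ‖θ z‖ < 1 := by
  obtain ⟨m, a, ha, h, h'⟩ := hθ.exists_rep
  cases m with
  | zero =>
    refine absurd ((Submodule.eq_bot_iff _).2 fun f hf => ?_) hne
    obtain ⟨P, hP, rfl⟩ := (mem_modelSpace_iff_exists_ratL2 ha h).1 hf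
    have hP0 : P = 0 := by
      rw [Polynomial.degree_lt_iff_coeff_zero] at hP
      exact Polynomial.ext fun k => hP k (Nat.zero_le k)
    have := ratL2_smul ha 0 hP
    rw [Polynomial.C_0, zero_mul, zero_smul] at this
    rw [hP0, this]
  | succ m =>
    have hlt : ∀ j, ‖(z - a j) / (z - conj (a j))‖ < 1 := by
      intro j
      have := norm_sub_lt_norm_sub_conj hz (ha j)
      rw [norm_div, div_lt_one ((norm_nonneg _).trans_lt this)]
      exact this
    rw [h', Fin.prod_univ_succ, norm_mul, norm_prod]
    refine mul_lt_one_of_nonneg_of_lt_one_left (norm_nonneg _) (hlt 0) ?_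
    exact Finset.prod_le_one (fun _ _ => norm_nonneg _) fun j _ => (hlt _).le

/-! ### Resolvents of the backward shift -/

/-- The backward shift has no eigenvectors with vanishing coefficient at infinity. -/
theorem eq_zero_of_backShift_eq_smul (hθ : IsNormalizedBlaschke θ) {f : L2}
    (hf : f ∈ modelSpace θ) (hc : topFunctional θ f = 0) {t : ℂ}
    (ht : backShift θ f = t • f) : f = 0 := by
  have h0 : ∀ z ∈ upper, z ≠ t → ext f z = 0 := by
    intro z hz hzt
    have h1 := ext_backShift hθ hf hz
    rw [ht, ext_smul, hc, sub_zero, ← sub_eq_zero, ← sub_mul, mul_eq_zero] at h1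
    exact h1.resolve_left (sub_ne_zero.2 hzt.symm)
  have hF := hasBoundary_ext hf.1
  refine eq_of_ext_eq hf.1 H2.zero_mem fun z hz => ?_
  have hz0 : ext (0 : L2) z = 0 := by rw [ext, inner_zero_right, mul_zero]
  rw [hz0]
  have hcont : ContinuousAt (ext f) z := hF.holo.continuousOn.continuousAt
    (isOpen_upper.mem_nhds hz)
  have hev : ∀ᶠ w in 𝓝[≠] z, ext f w = 0 := by
    have h1 : ∀ᶠ w in 𝓝[≠] z, w ∈ upper := nhdsWithin_le_nhds (isOpen_upper.mem_nhds hz)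
    have h2 : ∀ᶠ w in 𝓝[≠] z, w ≠ t := by
      by_cases hzt : z = t
      · rw [hzt]
        exact eventually_mem_nhdsWithin
      · exact nhdsWithin_le_nhds (isOpen_ne.mem_nhds hzt)
    filter_upwards [h1, h2] with w hw1 hw2 using h0 w hw1 hw2
  refine tendsto_nhds_unique (hcont.tendsto.mono_left (nhdsWithin_le_nhds (s := {z}ᶜ))) ?_
  exact tendsto_const_nhds.congr' (hev.mono fun w hw => hw.symm)

/-- Evaluating `x f - c_f = z f` at the point `z` gives `c_f = 0`, which excludes an eigenvector. -/
theorem eq_zero_of_backShift_eq_smul_upper (hθ : IsNormalizedBlaschke θ) {f : L2}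
    (hf : f ∈ modelSpace θ) {z : ℂ} (hz : z ∈ upper)
    (ht : backShift θ f = z • f) : f = 0 := by
  refine eq_zero_of_backShift_eq_smul hθ hf ?_ ht
  have h1 := ext_backShift hθ hf hz
  rw [ht, ext_smul] at h1
  linear_combination h1

theorem exists_backShift_sub_smul_eq (hθ : IsNormalizedBlaschke θ) {f : L2}
    (hf : f ∈ modelSpace θ) {z : ℂ} (hz : z ∈ upper) :
    ∃ g ∈ modelSpace θ, backShift θ g - z • g = f := by
  have := finiteDimensional_modelSpace hθ
  set T : modelSpace θ →ₗ[ℂ] modelSpace θ := backShiftLin hθ - z • LinearMap.id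
  have hT : ∀ g : modelSpace θ, ((T g : modelSpace θ) : L2) = backShift θ g - z • (g : L2) :=
    fun g => rfl
  have hinj : Function.Injective T := by
    rw [injective_iff_map_eq_zero]
    intro g hg
    have h1 := hT g
    rw [hg, Submodule.coe_zero, eq_comm, sub_eq_zero] at h1
    exact Subtype.ext (eq_zero_of_backShift_eq_smul_upper hθ g.2 hz h1)
  obtain ⟨g, hg⟩ := LinearMap.surjective_of_injective hinj ⟨f, hf⟩
  refine ⟨g, g.2, ?_⟩
  rw [← hT, hg]

/-- At the point `z` the term `z g(z)` drops out of `(A* - z)g = f` and leaves `f(z) = -c_g`. Point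
values thus become matrix elements of the resolvent; this is the source of the formula for `u`. -/
theorem ext_eq_of_backShift_sub_smul (hθ : IsNormalizedBlaschke θ) {f g : L2}
    (hg : g ∈ modelSpace θ) {z : ℂ} (hz : z ∈ upper) (h : backShift θ g - z • g = f) :
    inner ℂ (oneSub θ) g = 2 * Real.pi * Complex.I * ext f z := by
  have hpi : (Real.pi : ℂ) ≠ 0 := Complex.ofReal_ne_zero.2 Real.pi_ne_zero
  have h1 := congrArg (fun f => ext f z) h
  simp only [ext_sub, ext_smul, ext_backShift hθ hg hz, topFunctional] at h1
  rw [← h1]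
  field_simp
  linear_combination inner ℂ (oneSub θ) g * Complex.I_sq

end BackwardShift

/-! ### Rational symbols, the Hankel operator on its range, Schmidt subspaces. -/

section HankelOperator

/-! ### Rational symbols -/

theorem ratEval_eq (u : RatFunc ℂ) (z : ℂ) : ratEval u z = u.num.eval z / u.denom.eval z := by
  rw [ratEval, RatFunc.eval, Polynomial.eval₂_id, Polynomial.eval₂_id]

/-- The polynomial part of `u` tends to `0` along the imaginary axis, so it is zero. -/
theorem IsSymbol.degree_lt {u : RatFunc ℂ} (hu : IsSymbol u) : u.num.degree < u.denom.degree := by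
  have hQ : NoUpperRoots u.denom := hu.no_poles
  have hmon := RatFunc.monic_denom u
  have hlt := Polynomial.degree_modByMonic_lt u.num hmon
  have hdiv := Polynomial.modByMonic_add_div u.num u.denom
  set d := u.num /ₘ u.denom
  set r := u.num %ₘ u.denom
  have h1 : Tendsto (fun y : ℝ => r.eval (y * Complex.I) / u.denom.eval (y * Complex.I)) atTop
      (𝓝 0) := by
    refine (tendsto_ext_atTop
      (toL2 (fun x : ℝ => r.eval (x : ℂ) / u.denom.eval (x : ℂ)))).congr' ?_
    filter_upwards [eventually_gt_atTop 0] with y hy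
    exact (hasBoundary_rat hQ hlt).2.ext_eq (by simpa [upper] using hy)
  have hinf : Tendsto (fun y : ℝ => ‖(y * Complex.I : ℂ)‖) atTop atTop := by
    simpa using tendsto_abs_atTop_atTop
  have h2 : Tendsto (fun y : ℝ => ratEval u (y * Complex.I)) atTop (𝓝 0) :=
    hu.at_infty.comp (tendsto_norm_atTop_iff_cobounded.1 hinf)
  have h3 : Tendsto (fun y : ℝ => d.eval (y * Complex.I)) atTop (𝓝 0) := by
    have := h2.sub h1
    rw [sub_zero] at this
    refine this.congr' ?_
    filter_upwards [eventually_ge_atTop 0] with y hy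
    have hne := hQ (y * Complex.I) (by simpa using hy)
    rw [ratEval_eq, ← sub_div]
    nth_rewrite 1 [← hdiv]
    rw [Polynomial.eval_add, Polynomial.eval_mul]
    field_simp
    ring
  have hd : d = 0 := by
    by_cases hdeg : 0 < d.degree
    · exact absurd h3.norm (not_tendsto_nhds_of_tendsto_atTop (d.tendsto_norm_atTop hdeg hinf) _)
    · rw [Polynomial.eq_C_of_degree_le_zero (not_lt.1 hdeg)] at h3 ⊢
      simp only [Polynomial.eval_C] at h3
      rw [tendsto_nhds_unique tendsto_const_nhds h3, Polynomial.C_0]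
  rw [hd, mul_zero, add_zero] at hdiv
  rwa [← hdiv]

/-- The symbol as an element of `L²(ℝ)`. -/
noncomputable def symbolL2 (u : RatFunc ℂ) : L2 := toL2 (fun x => ratEval u x)

variable {u : RatFunc ℂ}

theorem IsSymbol.hasBoundary (hu : IsSymbol u) :
    MemLp (fun x : ℝ => ratEval u x) 2 volume ∧ HasBoundary (ratEval u) (symbolL2 u) := by
  have h : ratEval u = fun z => u.num.eval z / u.denom.eval z := funext (ratEval_eq u)
  rw [symbolL2, h]
  exact hasBoundary_rat hu.no_poles hu.degree_lt

theorem IsSymbol.isMult (hu : IsSymbol u) : IsMult (ratEval u) := by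
  rw [show ratEval u = fun z => u.num.eval z / u.denom.eval z from funext (ratEval_eq u)]
  exact isMult_rat _ hu.no_poles rfl (Polynomial.natDegree_le_natDegree hu.degree_lt.le)

theorem IsSymbol.ext_symbolL2 (hu : IsSymbol u) {z : ℂ} (hz : z ∈ upper) :
    ext (symbolL2 u) z = ratEval u z := hu.hasBoundary.2.ext_eq hz

theorem eq_of_ratEval_eq {v : RatFunc ℂ} (hu : IsSymbol u) (hv : IsSymbol v)
    (h : ∀ z ∈ upper, ratEval v z = ratEval u z) : v = u := by
  have hpoly : v.num * u.denom = u.num * v.denom := by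
    refine Polynomial.eq_of_infinite_eval_eq _ _ (Set.Infinite.mono (s := upper) ?_ ?_)
    · intro z hz
      have h1 := h z hz
      have h2 := hu.no_poles z (mem_upper.1 hz).le
      have h3 := hv.no_poles z (mem_upper.1 hz).le
      rw [ratEval_eq, ratEval_eq, div_eq_div_iff h3 h2] at h1
      simpa using h1
    · exact infinite_of_mem_nhds Complex.I (isOpen_upper.mem_nhds (by simp [upper]))
  rw [← RatFunc.num_div_denom u, ← RatFunc.num_div_denom v, div_eq_div_iff]
  · rw [← map_mul, ← map_mul, hpoly]
  · exact (map_ne_zero_iff _ (RatFunc.algebraMap_injective ℂ)).2 v.denom_ne_zero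
  · exact (map_ne_zero_iff _ (RatFunc.algebraMap_injective ℂ)).2 u.denom_ne_zero

/-! ### Hankel operators -/

theorem IsSymbol.memLp_mul_conj (hu : IsSymbol u) (f : L2) :
    MemLp (fun x : ℝ => ratEval u x * conj (f x)) 2 volume :=
  hu.isMult.memLp (memLp_conj (memLp_coe f))

theorem hankel_add (hu : IsSymbol u) (f g : L2) :
    hankel u (f + g) = hankel u f + hankel u g := by
  rw [hankel, hankel, hankel, ← map_add,
    ← toL2_add (hu.memLp_mul_conj f) (hu.memLp_mul_conj g)]
  congr 1
  refine toL2_congr ?_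
  filter_upwards [Lp.coeFn_add f g] with x hx
  rw [hx, Pi.add_apply, map_add, mul_add]

theorem hankel_smul (hu : IsSymbol u) (c : ℂ) (f : L2) :
    hankel u (c • f) = conj c • hankel u f := by
  rw [hankel, hankel, ← map_smul, ← toL2_const_mul _ (hu.memLp_mul_conj f)]
  congr 1
  refine toL2_congr ?_
  filter_upwards [Lp.coeFn_smul c f] with x hx
  rw [hx, Pi.smul_apply, smul_eq_mul, map_mul]
  ring

theorem inner_hankel (hu : IsSymbol u) (f : L2) {g : L2} (hg : g ∈ H2) :
    inner ℂ g (hankel u f) = ∫ x : ℝ, conj (g x) * (ratEval u x * conj (f x)) := by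
  rw [hankel, inner_orthProj hg, inner_toL2_right _ (hu.memLp_mul_conj f)]

/-- Both sides are the integral of `u · conj f · conj g`. For an anti-linear operator this symmetry
plays the role of self-adjointness. -/
theorem inner_hankel_comm (hu : IsSymbol u) {f g : L2} (hf : f ∈ H2) (hg : g ∈ H2) :
    inner ℂ g (hankel u f) = inner ℂ f (hankel u g) := by
  rw [inner_hankel hu f hg, inner_hankel hu g hf]
  congr 1
  funext x
  ring

/-- The range of the Hankel operator with symbol `u` is the model space of `θ`. -/
structure HankelRange (u : RatFunc ℂ) (θ : ℂ → ℂ) : Prop where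
  symbol : IsSymbol u
  blaschke : IsNormalizedBlaschke θ
  range : hankel u '' (H2 : Set L2) = (modelSpace θ : Set L2)

namespace HankelRange

variable {θ : ℂ → ℂ}

theorem hankel_mem (H : HankelRange u θ) {f : L2} (hf : f ∈ H2) : hankel u f ∈ modelSpace θ := by
  have : hankel u f ∈ hankel u '' (H2 : Set L2) := ⟨f, hf, rfl⟩
  rwa [H.range] at this

theorem exists_hankel_eq (H : HankelRange u θ) {f : L2} (hf : f ∈ modelSpace θ) : ∃ g ∈ H2, hankel u g = f := by
  have : f ∈ hankel u '' (H2 : Set L2) := by rwa [H.range]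
  exact this

theorem blaschke_mul_mem (H : HankelRange u θ) {h : L2} (hh : h ∈ H2) : toL2 (fun x => θ x * h x) ∈ H2 := by
  obtain ⟨F, hF⟩ := hh
  exact (hF.mul (isMult_blaschke H.blaschke)).mem_H2

/-- Formally `u = H_u 1` lies in the range `K_θ` and is orthogonal to `θH²`. As `1` is not in `H²`,
the argument is run with `expMean τ` and passes to the limit by dominated convergence. -/
theorem integral_blaschke_mul_symbol (H : HankelRange u θ) {h : L2} (hh : h ∈ H2) :
    ∫ x : ℝ, conj (θ x * h x) * ratEval u x = 0 := by
  have hθh : MemLp (fun x : ℝ => θ x * h x) 2 volume :=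
    (isMult_blaschke H.blaschke).memLp (memLp_coe h)
  have h0 : ∀ τ : ℝ, 0 < τ →
      ∫ x : ℝ, conj (θ x * h x) * (ratEval u x * conj (expMean τ x)) = 0 := by
    intro τ hτ
    have hm := hasBoundary_expMean hτ
    have h1 := inner_blaschke_mul (H.hankel_mem hm.2.mem_H2) hh
    rw [inner_hankel H.symbol _ (H.blaschke_mul_mem hh)] at h1
    rw [← h1]
    refine integral_congr_ae ?_
    filter_upwards [coe_toL2 hm.1, coe_toL2 hθh] with x h1 h2
    rw [h1, h2]
  have hint : Integrable (fun x : ℝ => conj (θ x * h x) * ratEval u x) :=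
    integrable_mul_of_memLp (memLp_conj hθh) H.symbol.hasBoundary.1
  have hlim := tendsto_integral_filter_of_dominated_convergence (μ := volume) (l := 𝓝[>] (0 : ℝ))
    (F := fun (τ : ℝ) (x : ℝ) => conj (θ x * h x) * (ratEval u x * conj (expMean τ x)))
    (f := fun x : ℝ => conj (θ x * h x) * ratEval u x)
    (fun x : ℝ => ‖conj (θ x * h x) * ratEval u x‖) ?_ ?_ hint.norm ?_
  · refine tendsto_nhds_unique hlim (tendsto_const_nhds.congr' ?_)
    filter_upwards [self_mem_nhdsWithin] with τ hτ
    exact (h0 τ hτ).symm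
  · refine Eventually.of_forall fun τ => ?_
    simp_rw [← mul_assoc]
    exact hint.1.mul
      (Complex.continuous_conj.comp (continuous_expMean τ)).aestronglyMeasurable
  · filter_upwards [self_mem_nhdsWithin] with τ hτ
    refine Eventually.of_forall fun x => ?_
    rw [← mul_assoc, norm_mul _ (conj (expMean τ x)), Complex.norm_conj (expMean τ x)]
    exact mul_le_of_le_one_right (norm_nonneg _) (norm_expMean_le (le_of_lt hτ) (by simp))
  · refine Eventually.of_forall fun x => ?_
    have h1 := (Complex.continuous_conj.tendsto 1).comp (tendsto_expMean x)
    rw [map_one] at h1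
    have h2 := (h1.const_mul (ratEval u x)).const_mul (conj (θ x * h x))
    simpa [Function.comp_def] using h2

theorem inner_blaschke_mul_symbolL2 (H : HankelRange u θ) {h : L2} (hh : h ∈ H2) :
    inner ℂ (toL2 (fun x => θ x * h x)) (symbolL2 u) = 0 := by
  rw [symbolL2, inner_toL2_toL2 ((isMult_blaschke H.blaschke).memLp (memLp_coe h))
    H.symbol.hasBoundary.1]
  exact H.integral_blaschke_mul_symbol hh

theorem symbolL2_mem (H : HankelRange u θ) : symbolL2 u ∈ modelSpace θ := by
  refine ⟨H.symbol.hasBoundary.2.mem_H2, ?_⟩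
  rw [SetLike.mem_coe, Submodule.mem_orthogonal]
  intro v hv
  induction hv using Submodule.span_induction with
  | mem v hv =>
    obtain ⟨h, hh, rfl⟩ := hv
    exact H.inner_blaschke_mul_symbolL2 hh
  | zero => simp
  | add v w _ _ hv hw => rw [inner_add_left, hv, hw, add_zero]
  | smul c v _ hv => rw [inner_smul_left, hv, mul_zero]

/-- In `u conj(1 - θ) = u - u conj θ` the last term is orthogonal to `H²`, because `u` is orthogonal
to `θH²`. -/
theorem hankel_oneSub (H : HankelRange u θ) : hankel u (oneSub θ) = symbolL2 u := by
  refine orthProj_eq H.symbol.hasBoundary.2.mem_H2 fun k hk => ?_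
  rw [inner_sub_right, inner_toL2_right _ (H.symbol.memLp_mul_conj _), symbolL2,
    inner_toL2_right _ H.symbol.hasBoundary.1, ← integral_sub
      (integrable_mul_of_memLp (memLp_conj (memLp_coe k)) (H.symbol.memLp_mul_conj _))
      (integrable_mul_of_memLp (memLp_conj (memLp_coe k)) H.symbol.hasBoundary.1),
    ← neg_eq_zero, ← integral_neg, ← H.integral_blaschke_mul_symbol hk]
  refine integral_congr_ae ?_
  filter_upwards [coe_toL2 (memLp_oneSub H.blaschke)] with x hx
  rw [oneSub, hx, map_sub, map_one, map_mul]
  ring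

/-- The Hankel operator intertwines the generator with its adjoint. -/
theorem hankel_generator (H : HankelRange u θ) {f : L2} (hf : f ∈ modelSpace θ) :
    hankel u (generator θ f) = backShift θ (hankel u f) := by
  have hAf := generator_mem H.blaschke hf
  have hHf := H.hankel_mem hf.1
  have hd := Submodule.sub_mem _ (H.hankel_mem hAf.1) (backShift_mem H.blaschke hHf)
  rw [← sub_eq_zero, ← inner_self_eq_zero (𝕜 := ℂ)]
  have key : ∀ g ∈ modelSpace θ,
      inner ℂ g (hankel u (generator θ f) - backShift θ (hankel u f)) = 0 := by
    intro g hg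
    have hAg := generator_mem H.blaschke hg
    -- In the difference of the two pairings the factors `x` cancel, being real, and what is left is
    -- the integral of `conj(θ k) u`, which vanishes.
    set k := topFunctional θ g • f - topFunctional θ f • g
    have hk : k ∈ H2 := Submodule.sub_mem _ (H2.smul_mem _ hf.1) (H2.smul_mem _ hg.1)
    rw [inner_sub_right, inner_backShift H.blaschke hHf hg, inner_hankel H.symbol _ hg.1,
      inner_hankel H.symbol _ hAg.1, ← integral_sub
        (integrable_mul_of_memLp (memLp_conj (memLp_coe _)) (H.symbol.memLp_mul_conj _))
        (integrable_mul_of_memLp (memLp_conj (memLp_coe _)) (H.symbol.memLp_mul_conj _)),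
      ← H.integral_blaschke_mul_symbol hk]
    refine integral_congr_ae ?_
    filter_upwards [coe_generator H.blaschke hf, coe_generator H.blaschke hg,
      Lp.coeFn_sub (topFunctional θ g • f) (topFunctional θ f • g),
      Lp.coeFn_smul (topFunctional θ g) f, Lp.coeFn_smul (topFunctional θ f) g]
      with x h1 h2 h3 h4 h5
    rw [h1, h2, h3, Pi.sub_apply, h4, h5]
    simp only [Pi.smul_apply, smul_eq_mul, map_sub, map_mul, Complex.conj_ofReal]
    ring
  exact key _ hd

/-- Writing `f = H_u g`, one has `⟨f, f⟩ = ⟨H_u f, g⟩ = 0`: the range meets the kernel trivially. -/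
theorem eq_zero_of_hankel_eq_zero (H : HankelRange u θ) {f : L2} (hf : f ∈ modelSpace θ) (h : hankel u f = 0) :
    f = 0 := by
  obtain ⟨g, hg, rfl⟩ := H.exists_hankel_eq hf
  rw [← inner_self_eq_zero (𝕜 := ℂ), inner_hankel_comm H.symbol hg hf.1, h, inner_zero_right]

end HankelRange

/-! ### Schmidt subspaces -/

theorem mem_schmidt_iff (hu : IsSymbol u) {s : ℝ} {f : L2} :
    f ∈ schmidt u s ↔ f ∈ H2 ∧ hankel u (hankel u f) = ((s : ℂ) ^ 2) • f := by
  refine ⟨fun hf => ?_, fun hf => Submodule.subset_span hf⟩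
  induction hf using Submodule.span_induction with
  | mem v hv => exact hv
  | zero =>
    have h0 : hankel u 0 = 0 := by simpa using hankel_smul hu 0 0
    exact ⟨H2.zero_mem, by rw [h0, h0, smul_zero]⟩
  | add v w _ _ hv hw =>
    exact ⟨H2.add_mem hv.1 hw.1, by rw [hankel_add hu, hankel_add hu, hv.2, hw.2, smul_add]⟩
  | smul c v _ hv =>
    refine ⟨H2.smul_mem c hv.1, ?_⟩
    rw [hankel_smul hu, hankel_smul hu, hv.2, Complex.conj_conj, smul_comm]

namespace HankelRange

variable {θ : ℂ → ℂ}

theorem schmidt_le (H : HankelRange u θ) {s : ℝ} (hs : 0 < s) : schmidt u s ≤ modelSpace θ := by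
  intro f hf
  obtain ⟨hf, h⟩ := (mem_schmidt_iff H.symbol).1 hf
  have hs2 : ((s : ℂ) ^ 2) ≠ 0 := by
    have := Complex.ofReal_ne_zero.2 hs.ne'
    positivity
  have h1 : f = ((s : ℂ) ^ 2)⁻¹ • hankel u (hankel u f) := by
    rw [h, smul_smul, inv_mul_cancel₀ hs2, one_smul]
  rw [h1]
  exact Submodule.smul_mem _ _ (H.hankel_mem (H.hankel_mem hf).1)

theorem hankel_mem_schmidt (H : HankelRange u θ) {s : ℝ} {f : L2} (hf : f ∈ schmidt u s) :
    hankel u f ∈ schmidt u s := by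
  obtain ⟨hf, h⟩ := (mem_schmidt_iff H.symbol).1 hf
  refine (mem_schmidt_iff H.symbol).2 ⟨(H.hankel_mem hf).1, ?_⟩
  rw [h, hankel_smul H.symbol, map_pow, Complex.conj_ofReal]

/-- The square of the Hankel operator on its range. -/
noncomputable def sqLin (H : HankelRange u θ) : modelSpace θ →ₗ[ℂ] modelSpace θ where
  toFun f := ⟨hankel u (hankel u f), H.hankel_mem (H.hankel_mem f.2.1).1⟩
  map_add' f g := Subtype.ext (by
    simp only [Submodule.coe_add, hankel_add H.symbol])
  map_smul' c f := Subtype.ext (by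
    simp only [Submodule.coe_smul, hankel_smul H.symbol, Complex.conj_conj, RingHom.id_apply])

theorem sqLin_isSymmetric (H : HankelRange u θ) : H.sqLin.IsSymmetric := by
  intro f g
  have hf := H.hankel_mem f.2.1
  have hg := H.hankel_mem g.2.1
  change inner ℂ (hankel u (hankel u f)) (g : L2) = inner ℂ (f : L2) (hankel u (hankel u g))
  rw [inner_hankel_comm H.symbol hg.1 f.2.1, ← inner_conj_symm,
    inner_hankel_comm H.symbol hf.1 g.2.1, inner_conj_symm]

/-- The Schmidt subspaces span the range of the Hankel operator. -/
theorem eq_zero_of_orthogonal_schmidt (H : HankelRange u θ) {f : L2} (hf : f ∈ modelSpace θ)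
    (h : ∀ s : ℝ, 0 < s → schmidt u s ≠ ⊥ → ∀ k ∈ schmidt u s, inner ℂ k f = 0) : f = 0 := by
  have := finiteDimensional_modelSpace H.blaschke
  have hbot := H.sqLin_isSymmetric.orthogonalComplement_iSup_eigenspaces_eq_bot
  have hmem : (⟨f, hf⟩ : modelSpace θ) ∈ (⨆ μ, Module.End.eigenspace H.sqLin μ)ᗮ := by
    rw [← Submodule.iInf_orthogonal, Submodule.mem_iInf]
    intro μ
    rw [Submodule.mem_orthogonal]
    intro v hv
    rw [Module.End.mem_eigenspace_iff] at hv
    change inner ℂ (v : L2) f = 0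
    by_cases hv0 : (v : L2) = 0
    · rw [hv0, inner_zero_left]
    have hv' : hankel u (hankel u v) = μ • (v : L2) := congrArg Subtype.val hv
    have hHv := H.hankel_mem v.2.1
    have hHv0 : hankel u v ≠ 0 := fun h0 => hv0 (H.eq_zero_of_hankel_eq_zero v.2 h0)
    have h1 := inner_hankel_comm H.symbol hHv.1 v.2.1
    rw [hv', inner_smul_right, inner_self_eq_norm_sq_to_K, inner_self_eq_norm_sq_to_K] at h1
    have hn1 := norm_pos_iff.2 hv0
    have hn2 := norm_pos_iff.2 hHv0
    -- Pairing `H_u² v = μ v` with `v` gives `μ‖v‖² = ‖H_u v‖²`. So every eigenvalue is `s²` with `s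
    -- > 0`, and the spectral theorem for `H_u²` on the range involves Schmidt subspaces only.
    have hμ : μ = ((‖hankel u v‖ / ‖(v : L2)‖ : ℝ) : ℂ) ^ 2 := by
      have hn : (‖(v : L2)‖ : ℂ) ≠ 0 := Complex.ofReal_ne_zero.2 hn1.ne'
      rw [Complex.ofReal_div, div_pow, eq_div_iff (pow_ne_zero 2 hn)]
      exact h1
    have hvs : (v : L2) ∈ schmidt u (‖hankel u v‖ / ‖(v : L2)‖) :=
      (mem_schmidt_iff H.symbol).2 ⟨v.2.1, by rw [hv', hμ]⟩
    refine h _ (div_pos hn2 hn1) (fun hb => hv0 ?_) _ hvs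
    rwa [hb, Submodule.mem_bot] at hvs
  rw [hbot, Submodule.mem_bot] at hmem
  exact congrArg Subtype.val hmem

end HankelRange

end HankelOperator

/-! ### The backward shift on Schmidt subspaces, and isometric multipliers. -/

section SchmidtSubspaces

/-! ### Schmidt subspaces and isometric multipliers -/

variable {u : RatFunc ℂ} {θ : ℂ → ℂ}

theorem conj_I_div_two_pi : conj (Complex.I / (2 * Real.pi)) = -(Complex.I / (2 * Real.pi)) := by
  rw [map_div₀, map_mul, Complex.conj_I, Complex.conj_ofReal, Complex.conj_ofNat, neg_div]

/-- The generator has non-negative imaginary part, of rank one. -/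
theorem im_inner_generator (hθ : IsNormalizedBlaschke θ) {f : L2} (hf : f ∈ modelSpace θ) :
    (inner ℂ f (generator θ f)).im = ‖inner ℂ (oneSub θ) f‖ ^ 2 / (4 * Real.pi) := by
  have hpi : (Real.pi : ℂ) ≠ 0 := Complex.ofReal_ne_zero.2 Real.pi_ne_zero
  set w := inner ℂ f (generator θ f) with hw
  have h1 : w = conj w + topFunctional θ f * inner ℂ f (oneSub θ) := by
    rw [hw, inner_conj_symm, ← inner_backShift hθ hf hf, ← inner_smul_right, ← inner_add_right,
      ← generator_eq]
  have h2 : inner ℂ (oneSub θ) f * inner ℂ f (oneSub θ)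
      = ((‖inner ℂ (oneSub θ) f‖ ^ 2 : ℝ) : ℂ) := by
    rw [← inner_conj_symm f, Complex.mul_conj, Complex.normSq_eq_norm_sq]
  rw [topFunctional, mul_assoc, h2] at h1
  have h3 := Complex.sub_conj w
  have h4 : w - conj w = Complex.I / (2 * Real.pi)
      * ((‖inner ℂ (oneSub θ) f‖ ^ 2 : ℝ) : ℂ) := by linear_combination h1
  rw [h4] at h3
  apply Complex.ofReal_injective
  have h5 : ((w.im : ℝ) : ℂ) = ((‖inner ℂ (oneSub θ) f‖ ^ 2 : ℝ) : ℂ) / (4 * Real.pi) := by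
    field_simp at h3 ⊢
    push_cast at h3 ⊢
    linear_combination -h3
  rw [h5]
  push_cast
  rfl

namespace HankelRange

/-- The commutation relation between the generator and the square of the Hankel operator, on
Schmidt subspaces. -/
theorem inner_generator_schmidt (H : HankelRange u θ) {s t : ℝ} (hs : 0 < s) (ht : 0 < t)
    {f g : L2} (hf : f ∈ schmidt u s) (hg : g ∈ schmidt u t) :
    ((t : ℂ) ^ 2 - (s : ℂ) ^ 2) * inner ℂ g (generator θ f)
      = Complex.I / (2 * Real.pi) * (inner ℂ (symbolL2 u) f * inner ℂ g (symbolL2 u)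
        - (s : ℂ) ^ 2 * (inner ℂ (oneSub θ) f * inner ℂ g (oneSub θ))) := by
  have hfK := H.schmidt_le hs hf
  have hgK := H.schmidt_le ht hg
  have hHf := H.hankel_mem hfK.1
  have hHg := H.hankel_mem hgK.1
  have hAf := generator_mem H.blaschke hfK
  have hAHf := generator_mem H.blaschke hHf
  have hff := ((mem_schmidt_iff H.symbol).1 hf).2
  have hgg := ((mem_schmidt_iff H.symbol).1 hg).2
  have hq := oneSub_mem H.blaschke
  -- The pairing of `H_u A f` with `H_u g` is computed in two ways: moving `H_u` across produces
  -- `H_u² g = t² g`; replacing `H_u A` by `A* H_u = A H_u - c q` and moving `H_u` across afterwards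
  -- produces `H_u² f = s² f`.
  have h1 : (t : ℂ) ^ 2 * inner ℂ g (generator θ f)
      = inner ℂ (hankel u (generator θ f)) (hankel u g) := by
    have h2 : (t : ℂ) ^ 2 * inner ℂ g (generator θ f)
        = inner ℂ (hankel u (hankel u g)) (generator θ f) := by
      rw [hgg, inner_smul_left, map_pow, Complex.conj_ofReal]
    rw [h2, ← inner_conj_symm, inner_hankel_comm H.symbol hHg.1 hAf.1, inner_conj_symm]
  have h3 : inner ℂ (generator θ (hankel u f)) (hankel u g)
      = (s : ℂ) ^ 2 * (inner ℂ g (generator θ f)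
        - topFunctional θ f * inner ℂ g (oneSub θ)) := by
    rw [inner_hankel_comm H.symbol hgK.1 hAHf.1, H.hankel_generator hHf, hff,
      backShift_smul H.blaschke _ hfK, backShift, inner_smul_right, inner_sub_right,
      inner_smul_right]
  have h4 : inner ℂ (oneSub θ) (hankel u g) = inner ℂ g (symbolL2 u) := by
    rw [inner_hankel_comm H.symbol hgK.1 hq.1, H.hankel_oneSub]
  have h5 : inner ℂ (oneSub θ) (hankel u f) = inner ℂ f (symbolL2 u) := by
    rw [inner_hankel_comm H.symbol hfK.1 hq.1, H.hankel_oneSub]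
  rw [H.hankel_generator hfK, backShift, inner_sub_left, inner_smul_left, h3, h4, topFunctional,
    topFunctional, h5, map_mul, conj_I_div_two_pi, inner_conj_symm] at h1
  linear_combination h1

/-- Schmidt subspaces of different singular values are orthogonal. -/
theorem inner_schmidt_eq_zero (H : HankelRange u θ) {s t : ℝ} (hs : 0 < s) (ht : 0 < t)
    (hst : s ≠ t) {f g : L2} (hf : f ∈ schmidt u s) (hg : g ∈ schmidt u t) :
    inner ℂ g f = 0 := by
  have hfK := H.schmidt_le hs hf
  have hgK := H.schmidt_le ht hg
  have h := H.sqLin_isSymmetric ⟨g, hgK⟩ ⟨f, hfK⟩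
  change inner ℂ (hankel u (hankel u g)) f = inner ℂ g (hankel u (hankel u f)) at h
  rw [((mem_schmidt_iff H.symbol).1 hf).2, ((mem_schmidt_iff H.symbol).1 hg).2, inner_smul_left,
    inner_smul_right, map_pow, Complex.conj_ofReal, ← sub_eq_zero, ← sub_mul, mul_eq_zero] at h
  refine h.resolve_left fun h0 => hst ?_
  have h1 : t ^ 2 = s ^ 2 := by exact_mod_cast sub_eq_zero.1 h0
  exact ((pow_left_inj₀ hs.le ht.le two_ne_zero).1 h1.symm)

/-- Elements of the model space are determined by their inner products with the Schmidt
subspaces. -/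
theorem ext_inner_schmidt (H : HankelRange u θ) {f g : L2} (hf : f ∈ modelSpace θ)
    (hg : g ∈ modelSpace θ)
    (h : ∀ s : ℝ, 0 < s → schmidt u s ≠ ⊥ → ∀ k ∈ schmidt u s, inner ℂ k f = inner ℂ k g) :
    f = g := by
  rw [← sub_eq_zero]
  refine H.eq_zero_of_orthogonal_schmidt (Submodule.sub_mem _ hf hg) fun s hs hne k hk => ?_
  rw [inner_sub_right, h s hs hne k hk, sub_self]

theorem finiteDimensional_schmidt (H : HankelRange u θ) {s : ℝ} (hs : 0 < s) :
    FiniteDimensional ℂ (schmidt u s) := by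
  have := finiteDimensional_modelSpace H.blaschke
  exact Submodule.finiteDimensional_of_le (H.schmidt_le hs)

end HankelRange

/-- The projection of `1 - θ` onto a Schmidt subspace. -/
noncomputable def oneProj (u : RatFunc ℂ) (θ : ℂ → ℂ) (s : ℝ) : L2 :=
  orthProj (schmidt u s) (oneSub θ)

namespace HankelRange

theorem oneProj_mem (H : HankelRange u θ) {s : ℝ} (hs : 0 < s) :
    oneProj u θ s ∈ schmidt u s := by
  have := H.finiteDimensional_schmidt hs
  exact orthProj_mem _ _

theorem inner_oneProj {s : ℝ} {k : L2} (hk : k ∈ schmidt u s) :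
    inner ℂ k (oneProj u θ s) = inner ℂ k (oneSub θ) := inner_orthProj hk _

theorem inner_oneProj_left {s : ℝ} {k : L2} (hk : k ∈ schmidt u s) :
    inner ℂ (oneProj u θ s) k = inner ℂ (oneSub θ) k := by
  rw [← inner_conj_symm, inner_oneProj hk, inner_conj_symm]

/-- The projection onto a Schmidt subspace commutes with `H_u`, and `u = H_u(1 - θ)`. -/
theorem symbolProj_eq_hankel (H : HankelRange u θ) {s : ℝ} (hs : 0 < s) :
    symbolProj u s = hankel u (oneProj u θ s) := by
  have hq := H.oneProj_mem hs
  refine orthProj_eq (H.hankel_mem_schmidt hq) fun k hk => ?_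
  have hkK := H.schmidt_le hs hk
  have h1 := inner_hankel_comm H.symbol (oneSub_mem H.blaschke).1 hkK.1
  rw [H.hankel_oneSub] at h1
  change inner ℂ k (symbolL2 u - _) = 0
  rw [inner_sub_right, h1, inner_hankel_comm H.symbol (H.schmidt_le hs hq).1 hkK.1,
    inner_oneProj_left (H.hankel_mem_schmidt hk), sub_self]

/-- Since `u_n = H_u q_n`, the phase relation reads `λ_n e^{iφ_n} u_n = H_u² q_n = λ_n² q_n`. -/
theorem symbolProj_eq_smul (H : HankelRange u θ) {s : ℝ} (hs : 0 < s) {e : Circle}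
    (he : hankel u (symbolProj u s) = ((s : ℂ) * (e : ℂ)) • symbolProj u s) :
    symbolProj u s = ((s : ℂ) * conj (e : ℂ)) • oneProj u θ s := by
  have h1 := ((mem_schmidt_iff H.symbol).1 (H.oneProj_mem hs)).2
  rw [← H.symbolProj_eq_hankel hs, he] at h1
  have hs0 : (s : ℂ) ≠ 0 := Complex.ofReal_ne_zero.2 hs.ne'
  have hee : (e : ℂ) * conj (e : ℂ) = 1 := by
    rw [Complex.mul_conj, Circle.normSq_coe, Complex.ofReal_one]
  have h2 := congrArg (fun v => ((s : ℂ)⁻¹ * conj (e : ℂ)) • v) h1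
  simp only [smul_smul] at h2
  rw [show (s : ℂ)⁻¹ * conj (e : ℂ) * (s * e) = 1 by
      rw [← hee]; field_simp, one_smul,
    show (s : ℂ)⁻¹ * conj (e : ℂ) * s ^ 2 = s * conj (e : ℂ) by field_simp] at h2
  exact h2

theorem inner_symbolL2 (H : HankelRange u θ) {s : ℝ} (hs : 0 < s) {e : Circle}
    (he : hankel u (symbolProj u s) = ((s : ℂ) * (e : ℂ)) • symbolProj u s) {k : L2}
    (hk : k ∈ schmidt u s) :
    inner ℂ k (symbolL2 u) = s * conj (e : ℂ) * inner ℂ k (oneSub θ) := by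
  have h1 : inner ℂ k (symbolProj u s) = inner ℂ k (symbolL2 u) := inner_orthProj hk _
  rw [← h1, H.symbolProj_eq_smul hs he, inner_smul_right, inner_oneProj hk]

theorem inner_symbolL2_left (H : HankelRange u θ) {s : ℝ} (hs : 0 < s) {e : Circle}
    (he : hankel u (symbolProj u s) = ((s : ℂ) * (e : ℂ)) • symbolProj u s) {k : L2}
    (hk : k ∈ schmidt u s) :
    inner ℂ (symbolL2 u) k = s * e * inner ℂ (oneSub θ) k := by
  rw [← inner_conj_symm, H.inner_symbolL2 hs he hk, map_mul, map_mul, Complex.conj_ofReal,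
    Complex.conj_conj, inner_conj_symm]

/-- Elements of a Schmidt subspace which are orthogonal to `1 - θ` are mapped into the Schmidt
subspace by the backward shift. -/
theorem backShift_mem_schmidt (H : HankelRange u θ) {s : ℝ} (hs : 0 < s) {e : Circle}
    (he : hankel u (symbolProj u s) = ((s : ℂ) * (e : ℂ)) • symbolProj u s) {f : L2}
    (hf : f ∈ schmidt u s) (h0 : inner ℂ (oneSub θ) f = 0) : backShift θ f ∈ schmidt u s := by
  have := H.finiteDimensional_schmidt hs
  have hfK := H.schmidt_le hs hf
  have hB := backShift_mem H.blaschke hfK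
  have hP := orthProj_mem (schmidt u s) (backShift θ f)
  have hgen : generator θ f = backShift θ f := by
    rw [generator_eq, topFunctional_eq_zero_iff.2 h0, zero_smul, add_zero]
  rw [H.ext_inner_schmidt hB (H.schmidt_le hs hP) fun t ht _ k hk => ?_]
  · exact hP
  by_cases hst : t = s
  · subst hst
    exact (inner_orthProj hk _).symm
  · rw [H.inner_schmidt_eq_zero hs ht (Ne.symm hst) hP hk]
    -- Both terms on the right contain the factor `⟨f, 1 - θ⟩ = 0`, so all components in the other
    -- Schmidt subspaces vanish.
    have h1 := H.inner_generator_schmidt hs ht hf hk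
    rw [H.inner_symbolL2_left hs he hf, h0, hgen] at h1
    have h2 : ((t : ℂ) ^ 2 - (s : ℂ) ^ 2) * inner ℂ k (backShift θ f) = 0 := by
      rw [h1]; ring
    refine (mul_eq_zero.1 h2).resolve_left fun h3 => hst ?_
    have h4 : t ^ 2 = s ^ 2 := by exact_mod_cast sub_eq_zero.1 h3
    exact (pow_left_inj₀ ht.le hs.le two_ne_zero).1 h4

/-- If the projection were zero, the whole Schmidt subspace would be orthogonal to `1 - θ` and
invariant under the backward shift. It would contain an eigenvector without `1/x` term, and there is
none. -/
theorem oneProj_ne_zero (H : HankelRange u θ) {s : ℝ} (hs : 0 < s) {e : Circle}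
    (he : hankel u (symbolProj u s) = ((s : ℂ) * (e : ℂ)) • symbolProj u s)
    (hne : schmidt u s ≠ ⊥) : oneProj u θ s ≠ 0 := by
  intro h0
  have hq : ∀ f ∈ schmidt u s, inner ℂ (oneSub θ) f = 0 := fun f hf => by
    rw [← inner_oneProj_left hf, h0, inner_zero_left]
  have := H.finiteDimensional_schmidt hs
  have := Submodule.nontrivial_iff_ne_bot.2 hne
  let T : schmidt u s →ₗ[ℂ] schmidt u s :=
    { toFun := fun f => ⟨backShift θ f, H.backShift_mem_schmidt hs he f.2 (hq f f.2)⟩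
      map_add' := fun f g => Subtype.ext
        (backShift_add H.blaschke (H.schmidt_le hs f.2) (H.schmidt_le hs g.2))
      map_smul' := fun c f => Subtype.ext (backShift_smul H.blaschke c (H.schmidt_le hs f.2)) }
  obtain ⟨μ, hμ⟩ := Module.End.exists_eigenvalue T
  obtain ⟨f, hf⟩ := hμ.exists_hasEigenvector
  have h1 : backShift θ (f : L2) = μ • (f : L2) := congrArg Subtype.val hf.apply_eq_smul
  refine hf.2 (Subtype.ext ?_)
  exact eq_zero_of_backShift_eq_smul H.blaschke (H.schmidt_le hs f.2)
    (topFunctional_eq_zero_iff.2 (hq f f.2)) h1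

end HankelRange

/-! ### Isometric multipliers -/

theorem IsProduct.ext_eq {p : ℂ → ℂ} {f g : L2} (h : IsProduct p f g) {z : ℂ} (hz : z ∈ upper) :
    ext g z = p z * ext f z := by
  obtain ⟨F, hF, hpF⟩ := h
  rw [hF.ext_eq hz, hpF.ext_eq hz]

theorem IsProduct.mem_H2 {p : ℂ → ℂ} {f g : L2} (h : IsProduct p f g) : g ∈ H2 := by
  obtain ⟨F, hF, hpF⟩ := h
  exact hpF.mem_H2

theorem IsProduct.unique {p : ℂ → ℂ} {f g g' : L2} (h : IsProduct p f g)
    (h' : IsProduct p f g') : g = g' :=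
  eq_of_ext_eq h.mem_H2 h'.mem_H2 fun z hz => by rw [h.ext_eq hz, h'.ext_eq hz]

/-- Multiplication by an isometric multiplier, as a linear isometry. -/
theorem IsIsometricMultiplier.exists_linearIsometry {p ψ : ℂ → ℂ}
    (hp : IsIsometricMultiplier p ψ) :
    ∃ U : modelSpace ψ →ₗᵢ[ℂ] L2, (∀ f, U f ∈ multSpace p ψ) ∧
      (∀ g ∈ multSpace p ψ, ∃ f, U f = g) ∧
      ∀ f, U f ∈ H2 ∧ ∀ z ∈ upper, ext (U f) z = p z * ext f z := by
  choose U hU hnorm using hp.isom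
  let V : modelSpace ψ →ₗ[ℂ] L2 :=
    { toFun := fun f => U f f.2
      map_add' := fun f g => by
        refine eq_of_ext_eq (hU _ _).mem_H2 (H2.add_mem (hU _ _).mem_H2 (hU _ _).mem_H2)
          fun z hz => ?_
        rw [ext_add, (hU _ _).ext_eq hz, (hU _ _).ext_eq hz, (hU _ _).ext_eq hz,
          Submodule.coe_add, ext_add]
        ring
      map_smul' := fun c f => by
        refine eq_of_ext_eq (hU _ _).mem_H2 (H2.smul_mem _ (hU _ _).mem_H2) fun z hz => ?_
        rw [RingHom.id_apply, ext_smul, (hU _ _).ext_eq hz, (hU _ _).ext_eq hz,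
          Submodule.coe_smul, ext_smul]
        ring }
  refine ⟨⟨V, fun f => hnorm f f.2⟩, fun f => ⟨f, f.2, hU _ _⟩, ?_, fun f =>
    ⟨(hU f f.2).mem_H2, fun z hz => (hU f f.2).ext_eq hz⟩⟩
  rintro g ⟨f, hf, hfg⟩
  exact ⟨⟨f, hf⟩, (hU f hf).unique hfg⟩

theorem isPreconnected_upper : IsPreconnected upper :=
  (convex_halfSpace_im_gt 0).isPreconnected

/-- If multiplication by `p` maps `f ∈ K_ψ` to a function without `1/x`-term whose image under the
backward shift is again in `p K_ψ`, then it commutes with the backward shift at `f`. -/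
theorem backShift_of_multiplier {p ψ : ℂ → ℂ} (hp : DifferentiableOn ℂ p upper)
    (hp0 : ∃ z ∈ upper, p z ≠ 0) (hψ : IsNormalizedBlaschke ψ) {f g : L2}
    (hf : f ∈ modelSpace ψ) (hg : g ∈ modelSpace ψ)
    (h : ∀ z ∈ upper, p z * ext g z = z * (p z * ext f z)) :
    inner ℂ (oneSub ψ) f = 0 ∧ g = backShift ψ f := by
  have hB := backShift_mem hψ hf
  have hD := Submodule.sub_mem _ hg hB
  have hz0 : ∀ z ∈ upper, ext (g - backShift ψ f) z - topFunctional ψ f = 0 := by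
    -- The product of `p` with `g - A*f - c_f` vanishes identically, so by the identity theorem the
    -- second factor does; as elements of `H²` decay at `i∞`, the constant `c_f` is then zero.
    have hmul : ∀ z ∈ upper, p z * (ext (g - backShift ψ f) z - topFunctional ψ f) = 0 := by
      intro z hz
      rw [ext_sub, ext_backShift hψ hf hz]
      linear_combination h z hz
    have hhol : DifferentiableOn ℂ (fun z => ext (g - backShift ψ f) z - topFunctional ψ f)
        upper := (hasBoundary_ext hD.1).holo.sub_const _
    rcases AnalyticOnNhd.eq_zero_or_eq_zero_of_mul_eq_zero (hp.analyticOnNhd isOpen_upper)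
      (hhol.analyticOnNhd isOpen_upper) hmul isPreconnected_upper with h1 | h1
    · obtain ⟨z, hz, hpz⟩ := hp0
      exact absurd (h1 z hz) hpz
    · exact h1
  have hc : topFunctional ψ f = 0 := by
    refine tendsto_nhds_unique (f := fun _ : ℝ => topFunctional ψ f) tendsto_const_nhds
      ((tendsto_ext_atTop (g - backShift ψ f)).congr' ?_)
    filter_upwards [eventually_gt_atTop 0] with y hy
    exact sub_eq_zero.1 (hz0 _ (by simpa [upper] using hy))
  refine ⟨topFunctional_eq_zero_iff.1 hc, ?_⟩
  refine eq_of_ext_eq hg.1 hB.1 fun z hz => ?_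
  have := hz0 z hz
  rw [ext_sub, hc, sub_zero] at this
  exact sub_eq_zero.1 this

end SchmidtSubspaces

/-! ### Diagonal blocks: the compression of the backward shift to `p K_ψ`. -/

section Resolvent

/-! ### The compressed resolvent -/

variable {θ ψ : ℂ → ℂ}

/-- The function `b(x)` up to affine normalisation. -/
noncomputable def herglotzFun (ψ : ℂ → ℂ) (z : ℂ) : ℂ :=
  Complex.I * ((‖oneSub ψ‖ ^ 2 / (4 * Real.pi) : ℝ) : ℂ) * ((1 + ψ z) / (1 - ψ z))
    + (((inner ℂ (oneSub ψ) (generator ψ (oneSub ψ))).re / ‖oneSub ψ‖ ^ 2 : ℝ) : ℂ)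

theorem one_sub_blaschke_ne_zero (hψ : IsNormalizedBlaschke ψ) (hne : modelSpace ψ ≠ ⊥) {z : ℂ}
    (hz : z ∈ upper) : 1 - ψ z ≠ 0 := by
  intro h
  have := norm_blaschke_lt_one hψ hne hz
  rw [← sub_eq_zero.1 h, norm_one] at this
  exact lt_irrefl _ this

theorem oneSub_ne_zero (hψ : IsNormalizedBlaschke ψ) (hne : modelSpace ψ ≠ ⊥) :
    oneSub ψ ≠ 0 := by
  intro h
  have hI : Complex.I ∈ upper := by simp [upper]
  refine one_sub_blaschke_ne_zero hψ hne hI ?_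
  rw [← ext_oneSub hψ hI, h, ext, inner_zero_right, mul_zero]

theorem conj_inner_generator_oneSub (hψ : IsNormalizedBlaschke ψ) :
    conj (inner ℂ (oneSub ψ) (generator ψ (oneSub ψ)))
      = ((inner ℂ (oneSub ψ) (generator ψ (oneSub ψ))).re : ℂ)
        - Complex.I * ((‖oneSub ψ‖ : ℂ) ^ 4 / (4 * Real.pi)) := by
  have h := im_inner_generator hψ (oneSub_mem hψ)
  set α := inner ℂ (oneSub ψ) (generator ψ (oneSub ψ))
  have h1 : ‖inner ℂ (oneSub ψ) (oneSub ψ)‖ = ‖oneSub ψ‖ ^ 2 := by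
    rw [inner_self_eq_norm_sq_to_K]
    simp
  rw [h1] at h
  have h2 : conj α = (α.re : ℂ) - Complex.I * (α.im : ℂ) := by
    apply Complex.ext <;> simp
  rw [h2, h]
  push_cast
  ring

/-- The left side is `‖Q‖²/⟨h, Q⟩ - ⟨A*Q, Q⟩/‖Q‖²` for `Q = 1 - ψ` and `h = (A* - z)⁻¹ Q`, with `A*
= A_ψ*`. The imaginary part of `⟨A Q, Q⟩` is `‖Q‖⁴/4π`, which turns `1/(1 - ψ)` into half of `(1 +
ψ)/(1 - ψ)`. -/
theorem herglotzFun_eq (hψ : IsNormalizedBlaschke ψ) (hne : modelSpace ψ ≠ ⊥) {z : ℂ}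
    (hz : z ∈ upper) :
    (‖oneSub ψ‖ : ℂ) ^ 2 / (2 * Real.pi * Complex.I * (1 - ψ z))
      - conj (inner ℂ (oneSub ψ) (generator ψ (oneSub ψ))) / (‖oneSub ψ‖ : ℂ) ^ 2
      = -herglotzFun ψ z := by
  have hpi : (Real.pi : ℂ) ≠ 0 := Complex.ofReal_ne_zero.2 Real.pi_ne_zero
  have h1 := one_sub_blaschke_ne_zero hψ hne hz
  have h2 : (‖oneSub ψ‖ : ℂ) ≠ 0 :=
    Complex.ofReal_ne_zero.2 (norm_ne_zero_iff.2 (oneSub_ne_zero hψ hne))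
  have h3 : (1 : ℂ) / (2 * Real.pi * Complex.I * (1 - ψ z))
      = -Complex.I / (2 * Real.pi * (1 - ψ z)) := by
    field_simp
    rw [Complex.I_sq]
    ring
  rw [conj_inner_generator_oneSub hψ, herglotzFun, div_eq_mul_one_div, h3]
  push_cast
  field_simp
  ring

section Compression

variable {V W : Type*} [NormedAddCommGroup V] [InnerProductSpace ℂ V] [NormedAddCommGroup W]
  [InnerProductSpace ℂ W]

theorem exists_eq_smul_of_inner_eq_zero {r Q : V} (hr : r ≠ 0)
    (h : ∀ f, inner ℂ r f = 0 → inner ℂ Q f = 0) : ∃ μ : ℂ, Q = μ • r := by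
  have hrr : (inner ℂ r r : ℂ) ≠ 0 := inner_self_ne_zero.2 hr
  set f := Q - (inner ℂ r Q / inner ℂ r r : ℂ) • r with hf
  have h1 : inner ℂ r f = 0 := by
    rw [hf, inner_sub_right, inner_smul_right, div_mul_cancel₀ _ hrr, sub_self]
  have h2 : inner ℂ Q f = 0 := h f h1
  have h3 : inner ℂ f f = 0 := by
    nth_rewrite 1 [hf]
    rw [inner_sub_left, inner_smul_left, h1, h2, mul_zero, sub_zero]
  exact ⟨_, sub_eq_zero.1 (inner_self_eq_zero.1 h3)⟩

/-- Two sesquilinear forms which agree as soon as one of the arguments is orthogonal to `r`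
differ by a form of rank one. -/
theorem inner_map_eq_add_rank_one {U : V →ₗᵢ[ℂ] W} {X : V →ₗ[ℂ] W} {Y : V →ₗ[ℂ] V} {r : V}
    (hr : r ≠ 0) (h1 : ∀ f, inner ℂ r f = 0 → X f = U (Y f))
    (h2 : ∀ f g, inner ℂ r f = 0 → inner ℂ (U f) (X g) = inner ℂ f (Y g)) (f g : V) :
    inner ℂ (U f) (X g) = inner ℂ f (Y g) + (inner ℂ (U r) (X r) - inner ℂ r (Y r))
      * (inner ℂ f r * inner ℂ r g) / (inner ℂ r r) ^ 2 := by
  have hM : (inner ℂ r r : ℂ) ≠ 0 := inner_self_ne_zero.2 hr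
  set M : ℂ := inner ℂ r r with hMdef
  have hMc : conj M = M := by rw [hMdef, inner_conj_symm]
  have hdec : ∀ f : V, ∃ f' : V, inner ℂ r f' = 0 ∧ f = f' + (inner ℂ r f / M : ℂ) • r := by
    intro f
    refine ⟨f - (inner ℂ r f / M : ℂ) • r, ?_, (sub_add_cancel _ _).symm⟩
    rw [inner_sub_right, inner_smul_right, ← hMdef, div_mul_cancel₀ _ hM, sub_self]
  obtain ⟨f', hf', hf⟩ := hdec f
  obtain ⟨g', hg', hg⟩ := hdec g
  have hfc : conj (inner ℂ r f / M : ℂ) = inner ℂ f r / M := by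
    rw [map_div₀, hMc, inner_conj_symm]
  have e1 : inner ℂ (U f) (X g) = inner ℂ f' (Y g)
      + inner ℂ f r / M * (inner ℂ r (Y g') + inner ℂ r g / M * inner ℂ (U r) (X r)) := by
    have e2 : inner ℂ (U r) (X g)
        = inner ℂ r (Y g') + inner ℂ r g / M * inner ℂ (U r) (X r) := by
      nth_rewrite 1 [hg]
      rw [map_add, map_smul, h1 g' hg', inner_add_right, inner_smul_right, U.inner_map_map]
    rw [← e2, ← h2 f' g hf', ← hfc, ← inner_smul_left, ← inner_add_left, ← map_smul, ← map_add,
      ← hf]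
  have e3 : inner ℂ f (Y g) = inner ℂ f' (Y g)
      + inner ℂ f r / M * (inner ℂ r (Y g') + inner ℂ r g / M * inner ℂ r (Y r)) := by
    have e4 : inner ℂ r (Y g) = inner ℂ r (Y g') + inner ℂ r g / M * inner ℂ r (Y r) := by
      nth_rewrite 1 [hg]
      rw [map_add, map_smul, inner_add_right, inner_smul_right]
    rw [← e4, ← hfc, ← inner_smul_left, ← inner_add_left, ← hf]
  rw [e1, e3]
  field_simp
  ring

/-- In the application `U` is multiplication by `p`, `X` the big backward shift composed with `U`,
`Y` the small one, `U r` the projection of `1 - θ`, and `Q = 1 - ψ`. The vectors `Q` and `r` are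
proportional, and the forms of `X` and `Y` differ by a rank one form along `r`, so `h` solves the
compressed equation as well, up to scaling. The unknown ratio of `Q` and `r` drops out because both
quotients in `Q` are invariant under scaling. -/
theorem exists_compressed_resolvent {U : V →ₗᵢ[ℂ] W} {X : V →ₗ[ℂ] W} {Y : V →ₗ[ℂ] V} {r Q h : V}
    (hr : r ≠ 0) (hQ : Q ≠ 0) (hrQ : ∀ f, inner ℂ r f = 0 → inner ℂ Q f = 0)
    (h1 : ∀ f, inner ℂ r f = 0 → X f = U (Y f))
    (h2 : ∀ f g, inner ℂ r f = 0 → inner ℂ (U f) (X g) = inner ℂ f (Y g)) {z : ℂ}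
    (hres : Y h - z • h = Q) (hρ : (inner ℂ Q h : ℂ) ≠ 0) :
    ∃ h', inner ℂ r h' = 1 ∧ ∀ f, inner ℂ (U f) (X h' - z • U h')
      = (inner ℂ (U r) (X r) / (inner ℂ r r) ^ 2
        + (inner ℂ Q Q / inner ℂ Q h - inner ℂ Q (Y Q) / inner ℂ Q Q) / inner ℂ r r)
        * inner ℂ f r := by
  obtain ⟨μ, rfl⟩ := exists_eq_smul_of_inner_eq_zero hr hrQ
  have hμ : μ ≠ 0 := fun h0 => hQ (by rw [h0, zero_smul])
  have hμc : conj μ ≠ 0 := (map_ne_zero _).2 hμ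
  have hM : (inner ℂ r r : ℂ) ≠ 0 := inner_self_ne_zero.2 hr
  have hrh : (inner ℂ r h : ℂ) ≠ 0 := fun h0 => hρ (by rw [inner_smul_left, h0, mul_zero])
  refine ⟨(inner ℂ r h : ℂ)⁻¹ • h, ?_, fun f => ?_⟩
  · rw [inner_smul_right, inv_mul_cancel₀ hrh]
  · have h3 : inner ℂ f (Y h) - z * inner ℂ f h = μ * inner ℂ f r := by
      rw [← inner_smul_right, ← inner_smul_right, ← hres, inner_sub_right]
    have h4 := inner_map_eq_add_rank_one hr h1 h2 f h
    have h5 : inner ℂ (U f) (X h - z • U h) = μ * inner ℂ f r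
        + (inner ℂ (U r) (X r) - inner ℂ r (Y r)) * (inner ℂ f r * inner ℂ r h)
          / (inner ℂ r r) ^ 2 := by
      rw [inner_sub_right, inner_smul_right, U.inner_map_map, h4, ← h3]
      ring
    rw [map_smul, map_smul, smul_comm z, ← smul_sub, inner_smul_right, h5]
    simp only [map_smul, inner_smul_left, inner_smul_right]
    field_simp
    ring

end Compression

/-- The resolvent of the compression of the backward shift to the subspace `p K_ψ`, applied to the
projection of `1 - θ`. -/
theorem exists_resolvent_vector (hθ : IsNormalizedBlaschke θ) {E : Submodule ℂ L2}
    (hE : E ≤ modelSpace θ) (hne : E ≠ ⊥) (hψ : IsNormalizedBlaschke ψ) {p : ℂ → ℂ}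
    (hp : IsIsometricMultiplier p ψ) (hEp : (E : Set L2) = multSpace p ψ) {q : L2} (hqE : q ∈ E)
    (hq : ∀ k ∈ E, inner ℂ k q = inner ℂ k (oneSub θ))
    (hB : ∀ f ∈ E, inner ℂ (oneSub θ) f = 0 → backShift θ f ∈ E) {z : ℂ} (hz : z ∈ upper) :
    modelSpace ψ ≠ ⊥ ∧ ∃ h ∈ E, inner ℂ (oneSub θ) h = 1 ∧
      ∀ k ∈ E, inner ℂ k (backShift θ h - z • h)
        = (conj (inner ℂ q (generator θ q)) / (‖q‖ : ℂ) ^ 4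
          - herglotzFun ψ z / (‖q‖ : ℂ) ^ 2) * inner ℂ k q := by
  obtain ⟨U, hU1, hU2, hU3⟩ := hp.exists_linearIsometry
  have hUE : ∀ f, U f ∈ E := fun f => by
    have := hU1 f
    rwa [← hEp] at this
  have hEU : ∀ g ∈ E, ∃ f, U f = g := fun g hg => hU2 g (by rwa [← hEp])
  have hUK : ∀ f, U f ∈ modelSpace θ := fun f => hE (hUE f)
  have hq' : ∀ k ∈ E, inner ℂ q k = inner ℂ (oneSub θ) k := fun k hk => by
    rw [← inner_conj_symm, hq k hk, inner_conj_symm]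
  obtain ⟨g₀, hg₀, hg₀ne⟩ := Submodule.exists_mem_ne_zero_of_ne_bot hne
  have hKne : modelSpace ψ ≠ ⊥ := by
    obtain ⟨f, rfl⟩ := hEU g₀ hg₀
    intro hb
    have : f = 0 := Subtype.ext ((Submodule.eq_bot_iff _).1 hb _ f.2)
    exact hg₀ne (by rw [this, map_zero])
  refine ⟨hKne, ?_⟩
  have hp0 : ∃ z ∈ upper, p z ≠ 0 := by
    by_contra! hp0
    obtain ⟨f, rfl⟩ := hEU g₀ hg₀
    refine hg₀ne (eq_of_ext_eq (hU3 f).1 H2.zero_mem fun z hz => ?_)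
    rw [(hU3 f).2 z hz, hp0 z hz, zero_mul, ext, inner_zero_right, mul_zero]
  -- on the orthogonal complement of `1 - θ`, the shifts are intertwined
  have hinter : ∀ f : modelSpace ψ, inner ℂ (oneSub θ) (U f) = 0 →
      inner ℂ (oneSub ψ) (f : L2) = 0 ∧ backShift θ (U f) = U (backShiftLin hψ f) := by
    intro f hf
    obtain ⟨g, hg⟩ := hEU _ (hB _ (hUE f) hf)
    obtain ⟨h1, h2⟩ := backShift_of_multiplier hp.holo hp0 hψ f.2 g.2 fun w hw => by
      rw [← (hU3 g).2 w hw, hg, ext_backShift hθ (hE (hUE f)) hw, (hU3 f).2 w hw,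
        topFunctional_eq_zero_iff.2 hf, sub_zero]
    refine ⟨h1, ?_⟩
    rw [← hg]
    congr 1
    exact Subtype.ext h2
  let Q : modelSpace ψ := ⟨oneSub ψ, oneSub_mem hψ⟩
  have hQ0 : Q ≠ 0 := fun h0 => oneSub_ne_zero hψ hKne (congrArg Subtype.val h0)
  obtain ⟨r, hr⟩ := hEU q hqE
  have hrU : ∀ f : modelSpace ψ, inner ℂ (oneSub θ) (U f) = inner ℂ r f := fun f => by
    rw [← hq' _ (hUE f), ← hr, U.inner_map_map]
  have hr0 : r ≠ 0 := by
    -- Were `r = 0`, every vector would count as orthogonal to it, and `1 - ψ` would be orthogonal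
    -- to itself.
    rintro rfl
    have h1 := hinter Q (by rw [hrU, inner_zero_left])
    exact hQ0 (Subtype.ext (inner_self_eq_zero.1 h1.1))
  obtain ⟨h₀, hh₀, hres⟩ := exists_backShift_sub_smul_eq hψ (oneSub_mem hψ) hz
  have hρ0 := mul_ne_zero two_pi_I_ne_zero (one_sub_blaschke_ne_zero hψ hKne hz)
  have hQh : inner ℂ (oneSub ψ) h₀ = 2 * Real.pi * Complex.I * (1 - ψ z) := by
    rw [ext_eq_of_backShift_sub_smul hψ hh₀ hz hres, ext_oneSub hψ hz]
  let X : modelSpace ψ →ₗ[ℂ] L2 :=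
    { toFun := fun f => backShift θ (U f)
      map_add' := fun f g => by rw [map_add, backShift_add hθ (hUK _) (hUK _)]
      map_smul' := fun c f => by rw [map_smul, backShift_smul hθ _ (hUK _), RingHom.id_apply] }
  have hX : ∀ f : modelSpace ψ, inner ℂ r f = 0 → X f = U (backShiftLin hψ f) :=
    fun f hf => (hinter f ((hrU f).trans hf)).2
  -- On vectors orthogonal to `1 - θ`, respectively `1 - ψ`, the generator agrees with the backward
  -- shift, so passing to adjoints carries the intertwining over to the other argument.
  have hX2 : ∀ f g : modelSpace ψ, inner ℂ r f = 0 →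
      inner ℂ (U f) (X g) = inner ℂ f (backShiftLin hψ g) := by
    intro f g hf
    have hf0 := (hrU f).trans hf
    have hAf : generator θ (U f) = U (backShiftLin hψ f) := by
      rw [generator_eq, topFunctional_eq_zero_iff.2 hf0, zero_smul, add_zero, (hinter f hf0).2]
    have hgen : generator ψ (f : L2) = backShift ψ f := by
      rw [generator_eq, topFunctional_eq_zero_iff.2 (hinter f hf0).1, zero_smul, add_zero]
    change inner ℂ (U f) (backShift θ (U g)) = inner ℂ (f : L2) (backShift ψ g)
    rw [inner_backShift hθ (hUK g) (hUK f), hAf, U.inner_map_map,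
      inner_backShift hψ g.2 f.2, hgen]
    rfl
  have hrQ : ∀ f : modelSpace ψ, inner ℂ r f = 0 → inner ℂ Q f = 0 :=
    fun f hf => (hinter f ((hrU f).trans hf)).1
  have hQh' : inner ℂ Q (⟨h₀, hh₀⟩ : modelSpace ψ)
      = 2 * Real.pi * Complex.I * (1 - ψ z) := hQh
  obtain ⟨h₁, hh₁⟩ : ∃ h : modelSpace ψ, h = ⟨h₀, hh₀⟩ := ⟨_, rfl⟩
  rw [← hh₁] at hQh'
  have hres' : backShiftLin hψ h₁ - z • h₁ = Q := by
    rw [hh₁]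
    exact Subtype.ext hres
  have hQh0 : (inner ℂ Q h₁ : ℂ) ≠ 0 := by rwa [hQh']
  obtain ⟨h', hh', hk⟩ := exists_compressed_resolvent hr0 hQ0 hrQ hX hX2 hres' hQh0
  have hrr : (inner ℂ r r : ℂ) = (‖q‖ : ℂ) ^ 2 := by
    rw [← U.inner_map_map, hr]
    exact inner_self_eq_norm_sq_to_K _
  have hQQ : (inner ℂ Q Q : ℂ) = (‖oneSub ψ‖ : ℂ) ^ 2 :=
    inner_self_eq_norm_sq_to_K (𝕜 := ℂ) (oneSub ψ)
  have hYQ : inner ℂ Q (backShiftLin hψ Q)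
      = conj (inner ℂ (oneSub ψ) (generator ψ (oneSub ψ))) := by
    rw [inner_conj_symm]
    exact inner_backShift hψ (oneSub_mem hψ) (oneSub_mem hψ)
  have hXr : inner ℂ (U r) (X r) = conj (inner ℂ q (generator θ q)) := by
    rw [inner_conj_symm, ← hr]
    exact inner_backShift hθ (hUK r) (hUK r)
  refine ⟨U h', hUE h', (hrU h').trans hh', fun k hkE => ?_⟩
  obtain ⟨f, rfl⟩ := hEU k hkE
  refine (hk f).trans ?_
  rw [hrr, hQQ, hYQ, hXr, hQh', herglotzFun_eq hψ hKne hz, ← hr, U.inner_map_map]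
  ring

end Resolvent

/-! ### Invariance under Frostman shifts, the matrix `Q`, the formula for `u`. -/

section SpectralFormula

variable {u : RatFunc ℂ} {θ ψ ψ' : ℂ → ℂ}

/-! ### Frostman shifts -/

theorem ofReal_mul_I_mem_upper {y : ℝ} (hy : 0 < y) : (y : ℂ) * Complex.I ∈ upper := by
  simpa [upper] using hy

theorem tendsto_blaschke_atTop (hψ : IsNormalizedBlaschke ψ) :
    Tendsto (fun y : ℝ => ψ (y * Complex.I)) atTop (𝓝 1) := by
  have h : Tendsto (fun y : ℝ => 1 - ext (oneSub ψ) (y * Complex.I)) atTop (𝓝 (1 - 0)) :=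
    (tendsto_ext_atTop (oneSub ψ)).const_sub 1
  rw [sub_zero] at h
  refine h.congr' ?_
  filter_upwards [eventually_gt_atTop 0] with y hy
  rw [ext_oneSub hψ (ofReal_mul_I_mem_upper hy), sub_sub_cancel]

/-- If `1 - ψ = c/z + d/z² + …` at infinity, then `herglotzFun ψ = c/(1 - ψ) + d/c`, and expanding
gives `z + o(1)`. The additive constant in `herglotzFun` is the one that cancels the constant term.
-/
theorem tendsto_herglotzFun_sub (hψ : IsNormalizedBlaschke ψ) (hne : modelSpace ψ ≠ ⊥) :
    Tendsto (fun y : ℝ => herglotzFun ψ (y * Complex.I) - y * Complex.I) atTop (𝓝 0) := by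
  have hq := oneSub_mem hψ
  have hBq := backShift_mem hψ hq
  have hpi : (Real.pi : ℂ) ≠ 0 := Complex.ofReal_ne_zero.2 Real.pi_ne_zero
  have hM : (‖oneSub ψ‖ : ℂ) ≠ 0 :=
    Complex.ofReal_ne_zero.2 (norm_ne_zero_iff.2 (oneSub_ne_zero hψ hne))
  set c := topFunctional ψ (oneSub ψ) with hc
  set d := topFunctional ψ (backShift ψ (oneSub ψ)) with hd
  have hc' : c = Complex.I / (2 * Real.pi) * (‖oneSub ψ‖ : ℂ) ^ 2 := by
    rw [hc, topFunctional, inner_self_eq_norm_sq_to_K]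
    rfl
  have hd' : d = Complex.I / (2 * Real.pi)
      * conj (inner ℂ (oneSub ψ) (generator ψ (oneSub ψ))) := by
    rw [hd, topFunctional, inner_backShift hψ hq hq, inner_conj_symm]
  have hc0 : c ≠ 0 := by
    rw [hc']
    exact mul_ne_zero (div_ne_zero Complex.I_ne_zero (mul_ne_zero two_ne_zero hpi))
      (pow_ne_zero _ hM)
  have h1 := tendsto_ext_atTop (backShift ψ (oneSub ψ))
  have h2 := tendsto_ext_atTop (backShift ψ (backShift ψ (oneSub ψ)))
  -- Applying the backward shift twice gives the exact remainder: `z(1 - ψ) = c + f₁` and `z f₁ = d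
  -- + f₂`, with `f₁` and `f₂` tending to `0` along the imaginary axis.
  have h3 : Tendsto (fun y : ℝ => d / c
      - (d + ext (backShift ψ (backShift ψ (oneSub ψ))) (y * Complex.I))
        / (c + ext (backShift ψ (oneSub ψ)) (y * Complex.I))) atTop
      (𝓝 (d / c - (d + 0) / (c + 0))) :=
    ((h2.const_add d).div (h1.const_add c) (by rwa [add_zero])).const_sub _
  rw [add_zero, add_zero, sub_self] at h3
  refine h3.congr' ?_
  filter_upwards [eventually_gt_atTop 0] with y hy
  have hz := ofReal_mul_I_mem_upper hy
  have hz0 : (y : ℂ) * Complex.I ≠ 0 :=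
    mul_ne_zero (Complex.ofReal_ne_zero.2 hy.ne') Complex.I_ne_zero
  set z := (y : ℂ) * Complex.I
  have hH := herglotzFun_eq hψ hne hz
  have hψ1 := one_sub_blaschke_ne_zero hψ hne hz
  rw [ext_backShift hψ hBq hz, ext_backShift hψ hq hz, ext_oneSub hψ hz, ← hc, ← hd,
    ← neg_neg (herglotzFun ψ z), ← hH, add_sub_cancel, add_sub_cancel]
  have e1 : (‖oneSub ψ‖ : ℂ) ^ 2 / (2 * Real.pi * Complex.I * (1 - ψ z)) = -c / (1 - ψ z) := by
    rw [hc']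
    field_simp
    rw [Complex.I_sq]
    ring
  have e2 : conj (inner ℂ (oneSub ψ) (generator ψ (oneSub ψ))) / (‖oneSub ψ‖ : ℂ) ^ 2 = d / c := by
    rw [hc', hd']
    have := Complex.I_ne_zero
    field_simp
  rw [e1, e2]
  field_simp
  ring

theorem eq_one_and_eq_zero_of_tendsto {a b : ℂ}
    (h : Tendsto (fun y : ℝ => (a - 1) * (y * Complex.I) + b) atTop (𝓝 0)) : a = 1 ∧ b = 0 := by
  have hinv : Tendsto (fun y : ℝ => ((y⁻¹ : ℝ) : ℂ)) atTop (𝓝 0) := by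
    have := (Complex.continuous_ofReal.tendsto 0).comp tendsto_inv_atTop_zero
    rwa [Complex.ofReal_zero] at this
  have h1 : Tendsto (fun y : ℝ => ((y⁻¹ : ℝ) : ℂ) * ((a - 1) * (y * Complex.I) + b)
      - ((y⁻¹ : ℝ) : ℂ) * b) atTop (𝓝 (0 * 0 - 0 * b)) :=
    (hinv.mul h).sub (hinv.mul_const b)
  have ha : (a - 1) * Complex.I = 0 := by
    refine tendsto_nhds_unique (f := fun _ : ℝ => (a - 1) * Complex.I) (l := atTop) tendsto_const_nhds ?_
    simp only [zero_mul, sub_zero] at h1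
    refine h1.congr' ?_
    filter_upwards [eventually_gt_atTop 0] with y hy
    have : (y : ℂ) ≠ 0 := Complex.ofReal_ne_zero.2 hy.ne'
    push_cast
    field_simp
    ring
  have ha' : a - 1 = 0 := (mul_eq_zero.1 ha).resolve_right Complex.I_ne_zero
  refine ⟨sub_eq_zero.1 ha', ?_⟩
  simp only [ha', zero_mul, zero_add] at h
  exact tendsto_nhds_unique tendsto_const_nhds h

/-- A Frostman shift acts affinely on `1/(1 - ψ)`, hence the two Herglotz functions satisfy
`herglotzFun ψ' = a · herglotzFun ψ + b`. Both are `z + o(1)` at `i∞`, which forces `a = 1` and `b =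
0`. -/
theorem herglotzFun_frostman (hψ : IsNormalizedBlaschke ψ) (hne : modelSpace ψ ≠ ⊥)
    (hψ' : IsNormalizedBlaschke ψ') (hne' : modelSpace ψ' ≠ ⊥) (h : IsFrostmanShift ψ ψ') {z : ℂ}
    (hz : z ∈ upper) : herglotzFun ψ' z = herglotzFun ψ z := by
  obtain ⟨w, α, hw, hshift⟩ := h
  set κ := Complex.exp (α * Complex.I)
  have hw1 : w - 1 ≠ 0 := by
    intro h0
    rw [sub_eq_zero.1 h0, norm_one] at hw
    exact lt_irrefl _ hw
  have hwc : 1 - conj w ≠ 0 := by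
    intro h0
    apply hw1
    have := congrArg conj h0
    rw [map_sub, map_one, Complex.conj_conj, map_zero] at this
    linear_combination -this
  have hden : ∀ x : ℂ, ‖x‖ < 1 → 1 - conj w * x ≠ 0 := by
    intro x hx h0
    have h1 : ‖conj w * x‖ < 1 := by
      rw [norm_mul, RCLike.norm_conj]
      nlinarith [norm_nonneg w, norm_nonneg x]
    rw [← sub_eq_zero.1 h0, norm_one] at h1
    exact lt_irrefl _ h1
  have hww : 1 - conj w * w ≠ 0 := hden w hw
  -- Comparing the limits `ψ(∞) = ψ'(∞) = 1` determines the unimodular constant; only with this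
  -- value is the action on `1/(1 - ψ)` affine.
  have hκ : κ * (w - 1) = 1 - conj w := by
    have h1 := tendsto_blaschke_atTop hψ
    have h2 : Tendsto (fun y : ℝ => κ * ((w - ψ (y * Complex.I))
        / (1 - conj w * ψ (y * Complex.I)))) atTop (𝓝 (κ * ((w - 1) / (1 - conj w * 1)))) :=
      ((h1.const_sub w).div ((h1.const_mul _).const_sub 1) (by rwa [mul_one])).const_mul κ
    have h3 : κ * ((w - 1) / (1 - conj w * 1)) = 1 := by
      refine tendsto_nhds_unique (h2.congr' ?_) (tendsto_blaschke_atTop hψ')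
      filter_upwards [eventually_gt_atTop 0] with y hy
      exact (hshift _ (ofReal_mul_I_mem_upper hy)).symm
    rw [mul_one] at h3
    field_simp at h3
    exact h3
  have hMob : ∀ z ∈ upper, (1 - ψ' z)⁻¹
      = (1 - w) / (1 - conj w * w) * ((1 - conj w) * (1 - ψ z)⁻¹ + conj w) := by
    intro z hz
    have h1 := one_sub_blaschke_ne_zero hψ hne hz
    have h2 := hden _ (norm_blaschke_lt_one hψ hne hz)
    have h3 : 1 - ψ' z = (1 - conj w * w) * (1 - ψ z) / ((1 - w) * (1 - conj w * ψ z)) := by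
      have hw2 : 1 - w ≠ 0 := fun h0 => hw1 (by linear_combination -h0)
      have h4 : (w - ψ z) / (1 - conj w * ψ z) * (1 - conj w * ψ z) = w - ψ z :=
        div_mul_cancel₀ _ h2
      rw [hshift z hz, eq_div_iff (mul_ne_zero hw2 h2)]
      linear_combination (w - ψ z) * hκ - κ * (1 - w) * h4
    have hw2 : 1 - w ≠ 0 := fun h0 => hw1 (by linear_combination -h0)
    rw [h3, inv_div]
    field_simp
    ring
  have hform : ∀ φ : ℂ → ℂ, IsNormalizedBlaschke φ → modelSpace φ ≠ ⊥ →
      ∃ A B : ℂ, A ≠ 0 ∧ ∀ z ∈ upper, herglotzFun φ z = A * (1 - φ z)⁻¹ + B := by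
    intro φ hφ hφne
    set C := Complex.I * ((‖oneSub φ‖ ^ 2 / (4 * Real.pi) : ℝ) : ℂ) with hC
    refine ⟨2 * C,
      (((inner ℂ (oneSub φ) (generator φ (oneSub φ))).re / ‖oneSub φ‖ ^ 2 : ℝ) : ℂ) - C, ?_,
      fun z hz => ?_⟩
    · have := norm_pos_iff.2 (oneSub_ne_zero hφ hφne)
      exact mul_ne_zero two_ne_zero (mul_ne_zero Complex.I_ne_zero
        (Complex.ofReal_ne_zero.2 (by positivity)))
    · have h1 := one_sub_blaschke_ne_zero hφ hφne hz
      rw [herglotzFun, ← hC]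
      field_simp
      ring
  obtain ⟨A, B, hA, hAB⟩ := hform ψ hψ hne
  obtain ⟨A', B', -, hAB'⟩ := hform ψ' hψ' hne'
  obtain ⟨a, b, hab⟩ : ∃ a b : ℂ, ∀ z ∈ upper, herglotzFun ψ' z = a * herglotzFun ψ z + b := by
    set s := (1 - w) / (1 - conj w * w)
    refine ⟨A' * s * (1 - conj w) / A, A' * s * conj w + B' - A' * s * (1 - conj w) / A * B,
      fun z hz => ?_⟩
    rw [hAB z hz, hAB' z hz, hMob z hz]
    field_simp
    ring
  have hlim : Tendsto (fun y : ℝ => (a - 1) * (y * Complex.I) + b) atTop (𝓝 (0 - a * 0)) := by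
    refine ((tendsto_herglotzFun_sub hψ' hne').sub
      ((tendsto_herglotzFun_sub hψ hne).const_mul a)).congr' ?_
    filter_upwards [eventually_gt_atTop 0] with y hy
    rw [hab _ (ofReal_mul_I_mem_upper hy)]
    ring
  rw [mul_zero, sub_zero] at hlim
  obtain ⟨rfl, rfl⟩ := eq_one_and_eq_zero_of_tendsto hlim
  rw [hab z hz, one_mul, add_zero]

theorem bFun_eq (l : ℝ) (ψ : ℂ → ℂ) (w x : ℂ) :
    bFun l ψ w x = 1 / (nuSq l w : ℂ) * (herglotzFun ψ x - x) := rfl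

/-! ### The matrix -/

namespace HankelRange

theorem inner_generator_symbolProj (H : HankelRange u θ) {s : ℝ} (hs : 0 < s) {e : Circle}
    (he : hankel u (symbolProj u s) = ((s : ℂ) * (e : ℂ)) • symbolProj u s) :
    inner ℂ (symbolProj u s) (generator θ (symbolProj u s))
      = ((s ^ 2 : ℝ) : ℂ) * inner ℂ (oneProj u θ s) (generator θ (oneProj u θ s)) := by
  have hee : (e : ℂ) * conj (e : ℂ) = 1 := by
    rw [Complex.mul_conj, Circle.normSq_coe, Complex.ofReal_one]
  rw [H.symbolProj_eq_smul hs he,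
    generator_smul H.blaschke _ (H.schmidt_le hs (H.oneProj_mem hs)), inner_smul_left,
    inner_smul_right, map_mul, Complex.conj_ofReal, Complex.conj_conj]
  push_cast
  linear_combination (s : ℂ) ^ 2 * inner ℂ (oneProj u θ s) (generator θ (oneProj u θ s)) * hee

theorem im_inner_generator_oneProj (H : HankelRange u θ) {s : ℝ} (hs : 0 < s) :
    (inner ℂ (oneProj u θ s) (generator θ (oneProj u θ s))).im
      = ‖oneProj u θ s‖ ^ 4 / (4 * Real.pi) := by
  have hq := H.oneProj_mem hs
  rw [im_inner_generator H.blaschke (H.schmidt_le hs hq), ← inner_oneProj_left hq,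
    inner_self_eq_norm_sq_to_K]
  congr 1
  simp only [norm_pow, RCLike.norm_ofReal, abs_norm]
  ring

theorem im_inner_generator_symbolProj (H : HankelRange u θ) {s : ℝ} (hs : 0 < s) {e : Circle}
    (he : hankel u (symbolProj u s) = ((s : ℂ) * (e : ℂ)) • symbolProj u s) :
    (inner ℂ (symbolProj u s) (generator θ (symbolProj u s))).im
      = s ^ 2 * ‖oneProj u θ s‖ ^ 4 / (4 * Real.pi) := by
  rw [H.inner_generator_symbolProj hs he, Complex.im_ofReal_mul, H.im_inner_generator_oneProj hs,
    mul_div_assoc]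

/-- This is the meaning of `ν`: the imaginary part of the generator is of rank one along `1 - θ`, so
`4π Im ω_n = λ_n² ‖q_n‖⁴`. -/
theorem nuSq_eq (H : HankelRange u θ) {s : ℝ} (hs : 0 < s) {e : Circle}
    (he : hankel u (symbolProj u s) = ((s : ℂ) * (e : ℂ)) • symbolProj u s) :
    nuSq s (inner ℂ (symbolProj u s) (generator θ (symbolProj u s)))
      = ‖oneProj u θ s‖ ^ 2 := by
  have h1 : 4 * Real.pi * (inner ℂ (symbolProj u s) (generator θ (symbolProj u s))).im
      = (s * ‖oneProj u θ s‖ ^ 2) ^ 2 := by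
    rw [H.im_inner_generator_symbolProj hs he]
    have := Real.pi_ne_zero
    field_simp
  rw [nuSq, h1, Real.sqrt_sq (by positivity), mul_div_cancel_left₀ _ hs.ne']

/-- The off-diagonal entries of `𝒜*`: on a Schmidt subspace `u` acts as `λ e^{-iφ}(1 - θ)`, so the
commutation relation reduces to one scalar divided by `s² - t²`. -/
theorem inner_backShift_schmidt (H : HankelRange u θ) {s t : ℝ} (hs : 0 < s) (ht : 0 < t)
    (hst : s ≠ t) {e f : Circle}
    (he : hankel u (symbolProj u s) = ((s : ℂ) * (e : ℂ)) • symbolProj u s)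
    (hf : hankel u (symbolProj u t) = ((t : ℂ) * (f : ℂ)) • symbolProj u t) {g h : L2}
    (hg : g ∈ schmidt u s) (hh : h ∈ schmidt u t) (h1 : inner ℂ (oneSub θ) h = 1) :
    inner ℂ g (backShift θ h)
      = conj (Complex.I / (2 * Real.pi) * (((s : ℂ) ^ 2 - s * t * ((e : ℂ) * conj (f : ℂ)))
        / ((s : ℂ) ^ 2 - (t : ℂ) ^ 2))) * inner ℂ g (oneSub θ) := by
  have hst' : (s : ℂ) ^ 2 - (t : ℂ) ^ 2 ≠ 0 := by
    intro h0
    have h2 : s ^ 2 = t ^ 2 := by exact_mod_cast sub_eq_zero.1 h0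
    exact hst ((pow_left_inj₀ hs.le ht.le two_ne_zero).1 h2)
  have hh1 : inner ℂ h (oneSub θ) = 1 := by
    rw [← inner_conj_symm, h1, map_one]
  have h2 := H.inner_generator_schmidt hs ht hg hh
  rw [H.inner_symbolL2_left hs he hg, H.inner_symbolL2 ht hf hh, hh1] at h2
  rw [inner_backShift H.blaschke (H.schmidt_le ht hh) (H.schmidt_le hs hg), ← inner_conj_symm,
    ← inner_conj_symm g, ← map_mul]
  congr 1
  rw [mul_div_assoc', div_mul_eq_mul_div, eq_div_iff hst']
  linear_combination -h2

end HankelRange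

namespace IsSpectralData

variable {N : ℕ} {lam : Fin N → ℝ} {ψ : Fin N → ℂ → ℂ} {e : Fin N → Circle} {ω : Fin N → ℂ}

theorem pos (hd : IsSpectralData u lam ψ e ω) (n : Fin N) : 0 < lam n :=
  ((hd.singular _).1 ⟨n, rfl⟩).1

theorem schmidt_ne_bot (hd : IsSpectralData u lam ψ e ω) (n : Fin N) : schmidt u (lam n) ≠ ⊥ :=
  ((hd.singular _).1 ⟨n, rfl⟩).2

theorem exists_hankelRange (hd : IsSpectralData u lam ψ e ω) (hu : IsSymbol u) :
    ∃ θ, HankelRange u θ ∧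
      ∀ n, ω n = inner ℂ (symbolProj u (lam n)) (generator θ (symbolProj u (lam n))) := by
  obtain ⟨θ, h1, h2, h3⟩ := hd.moment
  exact ⟨θ, ⟨hu, h1, h2⟩, h3⟩

theorem im_pos (hd : IsSpectralData u lam ψ e ω) (hu : IsSymbol u) (n : Fin N) :
    0 < (ω n).im := by
  obtain ⟨θ, H, hω⟩ := hd.exists_hankelRange hu
  have h1 := norm_pos_iff.2 (H.oneProj_ne_zero (hd.pos n) (hd.phase n) (hd.schmidt_ne_bot n))
  have h2 := hd.pos n
  rw [hω n, H.im_inner_generator_symbolProj h2 (hd.phase n)]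
  have := Real.pi_pos
  positivity

theorem exists_resolvent_vector (hd : IsSpectralData u lam ψ e ω) (H : HankelRange u θ)
    (n : Fin N) {z : ℂ} (hz : z ∈ upper) :
    modelSpace (ψ n) ≠ ⊥ ∧ ∃ h ∈ schmidt u (lam n), inner ℂ (oneSub θ) h = 1 ∧
      ∀ k ∈ schmidt u (lam n), inner ℂ k (backShift θ h - z • h)
        = (conj (inner ℂ (oneProj u θ (lam n)) (generator θ (oneProj u θ (lam n))))
            / (‖oneProj u θ (lam n)‖ : ℂ) ^ 4
          - herglotzFun (ψ n) z / (‖oneProj u θ (lam n)‖ : ℂ) ^ 2) * inner ℂ k (oneSub θ) := by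
  obtain ⟨p, hp, hEp⟩ := hd.model n
  have hs := hd.pos n
  obtain ⟨h1, h, hh, h2, h3⟩ := SzegoHankel.exists_resolvent_vector H.blaschke
    (H.schmidt_le hs) (hd.schmidt_ne_bot n) (hd.blaschke n) hp hEp (H.oneProj_mem hs)
    (fun k hk => HankelRange.inner_oneProj hk)
    (fun f hf h0 => H.backShift_mem_schmidt hs (hd.phase n) hf h0) hz
  exact ⟨h1, h, hh, h2, fun k hk => by rw [h3 k hk, HankelRange.inner_oneProj hk]⟩

theorem matQ_apply_ne {n k : Fin N} (hnk : k ≠ n) (z : ℂ) : matQ lam ψ e ω z k n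
    = conj (Complex.I / (2 * Real.pi) *
      (((lam k : ℂ) ^ 2 - lam k * lam n * ((e k : ℂ) * conj (e n : ℂ)))
        / ((lam k : ℂ) ^ 2 - (lam n : ℂ) ^ 2))) - z * (Matrix.diagonal fun n =>
          (nuSq (lam n) (ω n) : ℂ))⁻¹ k n := by
  simp only [matQ, matA, Matrix.sub_apply, Matrix.conjTranspose_apply, Matrix.of_apply,
    Matrix.smul_apply, smul_eq_mul, Matrix.diagonal_apply_ne _ hnk, sub_zero, if_neg hnk]
  rfl

/-- The vector `h` yields the `n`-th column of `Q(z)`: the backward shift minus `z` sends it to the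
combination of the projections `q_k` with coefficients `Q_{kn}(z)`. -/
theorem exists_matQ_vector (hd : IsSpectralData u lam ψ e ω) (H : HankelRange u θ)
    (hω : ∀ n, ω n = inner ℂ (symbolProj u (lam n)) (generator θ (symbolProj u (lam n))))
    (n : Fin N) {z : ℂ} (hz : z ∈ upper) :
    ∃ h ∈ schmidt u (lam n), inner ℂ (oneSub θ) h = 1 ∧
      ∀ k, ∀ g ∈ schmidt u (lam k), inner ℂ g (backShift θ h - z • h)
        = matQ lam ψ e ω z k n * inner ℂ g (oneSub θ) := by
  have hnu : ∀ k, nuSq (lam k) (ω k) = ‖oneProj u θ (lam k)‖ ^ 2 := fun k => by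
    rw [hω k, H.nuSq_eq (hd.pos k) (hd.phase k)]
  have hq0 : ∀ k, (‖oneProj u θ (lam k)‖ : ℂ) ≠ 0 := fun k => Complex.ofReal_ne_zero.2
    (norm_ne_zero_iff.2 (H.oneProj_ne_zero (hd.pos k) (hd.phase k) (hd.schmidt_ne_bot k)))
  have hinv : (Matrix.diagonal fun n => (nuSq (lam n) (ω n) : ℂ))⁻¹
      = Matrix.diagonal fun n => ((‖oneProj u θ (lam n)‖ : ℂ) ^ 2)⁻¹ := by
    refine Matrix.inv_eq_right_inv ?_
    rw [Matrix.diagonal_mul_diagonal, ← Matrix.diagonal_one]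
    congr 1
    funext k
    rw [hnu, Complex.ofReal_pow, mul_inv_cancel₀ (pow_ne_zero _ (hq0 k))]
  obtain ⟨-, h, hh, h1, h2⟩ := hd.exists_resolvent_vector H n hz
  refine ⟨h, hh, h1, fun k g hg => ?_⟩
  by_cases hkn : k = n
  · subst hkn
    have hs := hd.pos k
    have hs0 : (lam k : ℂ) ≠ 0 := Complex.ofReal_ne_zero.2 hs.ne'
    have hpi : (Real.pi : ℂ) ≠ 0 := Complex.ofReal_ne_zero.2 Real.pi_ne_zero
    have hdiag : conj (ω k / (4 * Real.pi * (ω k).im))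
        = conj (inner ℂ (oneProj u θ (lam k)) (generator θ (oneProj u θ (lam k))))
            / (‖oneProj u θ (lam k)‖ : ℂ) ^ 4 := by
      rw [hω k, H.im_inner_generator_symbolProj hs (hd.phase k),
        H.inner_generator_symbolProj hs (hd.phase k)]
      simp only [map_div₀, map_mul, Complex.conj_ofReal, Complex.conj_ofNat]
      push_cast
      have := hq0 k
      field_simp
    rw [h2 g hg, matQ, hinv]
    simp only [matA, Matrix.sub_apply, Matrix.conjTranspose_apply, Matrix.of_apply,
      Matrix.smul_apply, smul_eq_mul, Matrix.diagonal_apply_eq, if_true]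
    -- The `-x` inside `b` cancels the `-x/ν²` of the matrix, leaving `-herglotzFun/‖q_k‖²` next to
    -- the entry of `𝒜*`.
    rw [bFun_eq, hnu, ← starRingEnd_apply, hdiag, Complex.ofReal_pow]
    have := hq0 k
    field_simp
    ring
  · have hlam : lam k ≠ lam n := fun h0 => hkn (hd.anti.injective h0)
    rw [matQ_apply_ne hkn, hinv, Matrix.diagonal_apply_ne _ hkn, mul_zero, sub_zero,
      inner_sub_right, inner_smul_right,
      H.inner_schmidt_eq_zero (hd.pos n) (hd.pos k) (Ne.symm hlam) hh hg, mul_zero, sub_zero]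
    exact H.inner_backShift_schmidt (hd.pos k) (hd.pos n) hlam (hd.phase k) (hd.phase n) hg hh h1

/-- On combinations of the vectors `h n`, the operator `A* - z` acts through the matrix `Q(z)`.
Injectivity of the operator gives invertibility of the matrix, and solving for the coefficients of
`u` gives the resolvent that evaluates `u` at `z`. -/
theorem isUnit_and_eq (hd : IsSpectralData u lam ψ e ω) (hu : IsSymbol u) {z : ℂ}
    (hz : z ∈ upper) :
    IsUnit (matQ lam ψ e ω z) ∧ ratEval u z = symbolFormula lam ψ e ω z := by
  obtain ⟨θ, H, hω⟩ := hd.exists_hankelRange hu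
  choose h hE h1 hQ using fun n => hd.exists_matQ_vector H hω n hz
  have hK : ∀ n, h n ∈ modelSpace θ := fun n => H.schmidt_le (hd.pos n) (hE n)
  have hsum : ∀ X : Fin N → ℂ, ∑ n, X n • h n ∈ modelSpace θ := fun X =>
    Submodule.sum_mem _ fun n _ => Submodule.smul_mem _ _ (hK n)
  have hB : ∀ X : Fin N → ℂ, backShift θ (∑ n, X n • h n) = ∑ n, X n • backShift θ (h n) := by
    intro X
    have h2 := map_sum (backShiftLin H.blaschke)
      (fun n => X n • (⟨h n, hK n⟩ : modelSpace θ)) Finset.univ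
    have h3 := congrArg Subtype.val h2
    have h4 : ((∑ n, X n • (⟨h n, hK n⟩ : modelSpace θ) : modelSpace θ) : L2)
        = ∑ n, X n • h n := by
      rw [Submodule.coe_sum]
      rfl
    change backShift θ ((∑ n, X n • (⟨h n, hK n⟩ : modelSpace θ) : modelSpace θ) : L2) = _ at h3
    rw [h4, Submodule.coe_sum] at h3
    rw [h3]
    exact Finset.sum_congr rfl fun n _ => backShift_smul H.blaschke (X n) (hK n)
  have hres : ∀ (X : Fin N → ℂ) (k : Fin N), ∀ g ∈ schmidt u (lam k),
      inner ℂ g (backShift θ (∑ n, X n • h n) - z • ∑ n, X n • h n)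
        = (matQ lam ψ e ω z).mulVec X k * inner ℂ g (oneSub θ) := by
    intro X k g hg
    rw [hB, Finset.smul_sum, ← Finset.sum_sub_distrib, inner_sum, Matrix.mulVec, dotProduct,
      Finset.sum_mul]
    refine Finset.sum_congr rfl fun n _ => ?_
    rw [smul_comm z, ← smul_sub, inner_smul_right, hQ n k g hg]
    ring
  have hext : ∀ f g : L2, f ∈ modelSpace θ → g ∈ modelSpace θ →
      (∀ k, ∀ v ∈ schmidt u (lam k), inner ℂ v f = inner ℂ v g) → f = g := by
    intro f g hf hg hfg
    refine H.ext_inner_schmidt hf hg fun s hs hne v hv => ?_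
    obtain ⟨k, rfl⟩ := (hd.singular s).2 ⟨hs, hne⟩
    exact hfg k v hv
  have hunit : IsUnit (matQ lam ψ e ω z) := by
    rw [← Matrix.mulVec_injective_iff_isUnit]
    rw [← Matrix.coe_mulVecLin, injective_iff_map_eq_zero]
    intro X hX
    have hX' : (matQ lam ψ e ω z).mulVec X = 0 := hX
    have hG : ∑ n, X n • h n = 0 := by
      refine eq_zero_of_backShift_eq_smul_upper H.blaschke (hsum X) hz ?_
      rw [← sub_eq_zero]
      refine hext _ _ (Submodule.sub_mem _ (backShift_mem H.blaschke (hsum X))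
        (Submodule.smul_mem _ _ (hsum X))) (Submodule.zero_mem _) fun k v hv => ?_
      rw [hres X k v hv, hX', Pi.zero_apply, zero_mul, inner_zero_right]
    funext k
    -- The `h n` are independent: pairing with `q_k` picks out one coefficient, by orthogonality of
    -- the Schmidt subspaces and `⟨h_k, 1 - θ⟩ = 1`.
    have h2 : inner ℂ (oneProj u θ (lam k)) (∑ n, X n • h n) = X k := by
      have hqk := H.oneProj_mem (hd.pos k)
      rw [inner_sum, Finset.sum_eq_single k]
      · rw [inner_smul_right, HankelRange.inner_oneProj_left (hE k), h1, mul_one]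
      · intro n _ hnk
        rw [inner_smul_right, H.inner_schmidt_eq_zero (hd.pos n) (hd.pos k)
          (fun h0 => hnk (hd.anti.injective h0)) (hE n) hqk, mul_zero]
      · intro h0
        exact absurd (Finset.mem_univ k) h0
    rw [← h2, hG, inner_zero_right]
    rfl
  refine ⟨hunit, ?_⟩
  set y : Fin N → ℂ := fun n => (lam n : ℂ) * conj (e n : ℂ) with hy
  set X := (matQ lam ψ e ω z)⁻¹.mulVec y with hX
  have hQX : (matQ lam ψ e ω z).mulVec X = y := by
    rw [hX, Matrix.mulVec_mulVec, Matrix.mul_nonsing_inv _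
      ((Matrix.isUnit_iff_isUnit_det _).1 hunit), Matrix.one_mulVec]
  -- Both sides pair with `E(λ_k)` as `λ_k e^{-iφ_k}(1 - θ)`, and an element of the model space is
  -- determined by such pairings.
  have hG : backShift θ (∑ n, X n • h n) - z • ∑ n, X n • h n = symbolL2 u := by
    refine hext _ _ (Submodule.sub_mem _ (backShift_mem H.blaschke (hsum X))
      (Submodule.smul_mem _ _ (hsum X))) H.symbolL2_mem fun k v hv => ?_
    rw [hres X k v hv, hQX, H.inner_symbolL2 (hd.pos k) (hd.phase k) hv]
  have h3 := ext_eq_of_backShift_sub_smul H.blaschke (hsum X) hz hG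
  rw [hu.ext_symbolL2 hz] at h3
  have h4 : inner ℂ (oneSub θ) (∑ n, X n • h n) = ∑ n, X n := by
    rw [inner_sum]
    exact Finset.sum_congr rfl fun n _ => by rw [inner_smul_right, h1, mul_one]
  have h5 : symbolFormula lam ψ e ω z = (2 * Real.pi * Complex.I)⁻¹ * ∑ n, X n := by
    have h6 : (Matrix.diagonal fun n => (lam n : ℂ)).mulVec
        ((Matrix.diagonal fun n => conj (e n : ℂ)).mulVec 1) = y := by
      funext n
      simp [Matrix.mulVec_diagonal, hy]
    rw [symbolFormula, ← Matrix.mulVec_mulVec, ← Matrix.mulVec_mulVec, h6, ← hX]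
    simp [dotProduct]
  rw [h5, ← h4, h3, inv_mul_cancel_left₀ two_pi_I_ne_zero]

/-- The Blaschke products enter the formula only through `herglotzFun`. Both sets of spectral data
are needed, to know that neither model space is trivial. -/
theorem symbolFormula_frostman {v : RatFunc ℂ} {ψ' : Fin N → ℂ → ℂ}
    (hd : IsSpectralData u lam ψ e ω) (hu : IsSymbol u) (hd' : IsSpectralData v lam ψ' e ω)
    (hv : IsSymbol v) (hψ : ∀ n, IsFrostmanShift (ψ n) (ψ' n)) {z : ℂ} (hz : z ∈ upper) :
    symbolFormula lam ψ' e ω z = symbolFormula lam ψ e ω z := by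
  obtain ⟨θ, H, -⟩ := hd.exists_hankelRange hu
  obtain ⟨θ', H', -⟩ := hd'.exists_hankelRange hv
  have h1 : (fun n => bFun (lam n) (ψ' n) (ω n) z) = fun n => bFun (lam n) (ψ n) (ω n) z := by
    funext n
    rw [bFun_eq, bFun_eq, herglotzFun_frostman (hd.blaschke n)
      (hd.exists_resolvent_vector H n hz).1 (hd'.blaschke n)
      (hd'.exists_resolvent_vector H' n hz).1 (hψ n) hz]
  have h2 : matQ lam ψ' e ω z = matQ lam ψ e ω z := by
    rw [matQ, matQ, h1]
  rw [symbolFormula, symbolFormula, h2]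

end IsSpectralData

end SpectralFormula

end SzegoHankel

theorem theorem5p4 (u : RatFunc ℂ) (hu : SzegoHankel.IsSymbol u)
    {N : ℕ} (lam : Fin N → ℝ) (ψ : Fin N → ℂ → ℂ) (e : Fin N → Circle) (ω : Fin N → ℂ)
    (hdata : SzegoHankel.IsSpectralData u lam ψ e ω) :
    (∀ n, 0 < (ω n).im) ∧
    (∀ x : ℂ, 0 < x.im →
      IsUnit (SzegoHankel.matQ lam ψ e ω x) ∧
      SzegoHankel.ratEval u x = SzegoHankel.symbolFormula lam ψ e ω x) ∧
    (∀ (v : RatFunc ℂ) (ψ' : Fin N → ℂ → ℂ), SzegoHankel.IsSymbol v →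
      (∀ n, SzegoHankel.IsFrostmanShift (ψ n) (ψ' n)) →
      SzegoHankel.IsSpectralData v lam ψ' e ω → v = u) := by
  refine ⟨hdata.im_pos hu, fun x hx => hdata.isUnit_and_eq hu hx, fun v ψ' hv hψ hdata' => ?_⟩
  refine SzegoHankel.eq_of_ratEval_eq hu hv fun z hz => ?_
  rw [(hdata.isUnit_and_eq hu hz).2, (hdata'.isUnit_and_eq hv hz).2,
    hdata.symbolFormula_frostman hu hdata' hv hψ hz]
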